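/- **Lemma (well-posedness of the local H-interpolation).** Let $d\in\{2,3\}$, let $T\subset\mathbb{R}^d$ be a (closed, nondegenerate) simplex with diameter $h_T$, faces $F\in\mathcal F_{\partial T}$ and unit outward normal $n_T$, let $\ell_\Omega>0$ (the diameter of the computational domain) and $\tau_T:=\ell_\Omega h_T^{-1}$. Let $k\ge 0$ and let $k'=k$ (equal order) or $k'=k+1$ (mixed order). Denote by $\mathbb P^m(T)$, $\mathbb P^m(F)$ the polynomials of total degree at most $m$ restricted to $T$, $F$, with $\mathbb P^{-1}(T):=\{0\}$; by $\mathbb P^m(T;\mathbb R^d)$ their vector-valued version; by $\tilde{\mathbb P}^{k+1}(T)$ the homogeneous polynomials of degree $k+1$; set $\mathbb P^k(\mathcal F_{\partial T}):=\prod_{F}\mathbb P^k(F)$; let $(\cdot,\cdot)_T$, $(\cdot,\cdot)_{\partial T}$ be the $L^2$-inner products on $T$ and on $\partial T$, and $\Pi^k_T$, $\Pi^k_{\partial T}$ the (componentwise) $L^2$-orthogonal projections onto $\mathbb P^k(T)$ and $\mathbb P^k(\mathcal F_{\partial T})$. For $v_T\in\mathbb P^{k'}(T)$ and $v_{\partial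 T}\in\mathbb P^k(\mathcal F_{\partial T})$ let $$S_{\partial T}(v_T,v_{\partial T}):=\begin{cases}\Pi^k_{\partial T}\{v_T-v_{\partial T}+(1-\Pi^k_T)R_T(v_T,v_{\partial T})\}& \text{if }k'=k,\\ \Pi^k_{\partial T}\{v_T-v_{\partial T}\}& \text{if }k'=k+1,\end{cases}$$ where $R_T(v_T,v_{\partial T})\in\mathbb P^{k+1}(T)$ is determined by $(R_T(v_T,v_{\partial T})-v_T,1)_T=0$ and $(\nabla R_T(v_T,v_{\partial T}),\nabla w)_T=(\nabla v_T,\nabla w)_T-(v_T-v_{\partial T},\nabla w\cdot n_T)_{\partial T}$ for all $w\in\mathbb P^{k+1}(T)$. Let $\nu_\sigma,\nu_v>\tfrac12$, and let $\sigma\in H^{\nu_\sigma}(T)^d$ and $v\in H^{\nu_v}(T)$, where $H^\nu(T)$ is the space of restrictions to $T$ of functions in $H^\nu(\mathbb R^d)$. Then the components of $\sigma$ and the function $v$ have a well-defined trace in $L^2(F)$ on each face $F$ of $T$ (the limit in $L^2(F)$ of the restrictions of smooth functions converging in $H^{\nu}$; it exists and is unique), and there is exactly one pair $(\Pi^\sigma,\Pi^v)\in\mathbb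 P^k(T;\mathbb R^d)\times\mathbb P^{k'}(T)$ such that $$\begin{aligned} &\text{(a)}&(\Pi^v-v,w)_T&=0&&\forall w\in\mathbb P^{k-1}(T),\\ &\text{(b)}&(\Pi^\sigma-\sigma,\xi)_T&=0&&\forall \xi\in\mathbb P^{k-1}(T;\mathbb R^d),\\ &\text{(c)}&((\sigma-\Pi^\sigma)\cdot n_T,\mu)_{\partial T}&=\tau_T\big(S_{\partial T}(\Pi^v,\Pi^k_{\partial T}(v|_{\partial T})),S_{\partial T}(0,\mu)\big)_{\partial T}&&\forall\mu\in\mathbb P^k(\mathcal F_{\partial T}),\\ &\text{(d)}&(\Pi^\sigma-\sigma,\nabla q)_T&=((\Pi^k_{\partial T}(\sigma|_{\partial T})-\sigma)\cdot n_T,q)_{\partial T}&&\forall q\in\mathbb P^{k'}(T). \end{aligned}$$ Moreover, for $k'=k$ condition (d) is redundant: the system (a)-(c) has the same unique solution. For $k'=k+1$, requiring (d) only for $q\in\tilde{\mathbb P}^{k+1}(T)$ gives an equivalent system, which again has the same unique solution. -/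

import Mathlib

open MeasureTheory Filter Topology
open scoped SchwartzMap

noncomputable section

namespace HInterp

/-- The Euclidean space `ℝᵈ`. -/
abbrev Space (d : ℕ) := EuclideanSpace ℝ (Fin d)

/-- Real polynomials in `d` variables. -/
abbrev Poly (d : ℕ) := MvPolynomial (Fin d) ℝ

/-- The value of a polynomial at a point of `ℝᵈ`. -/
def ev {d : ℕ} (p : Poly d) (x : Space d) : ℝ := MvPolynomial.eval (fun j => x j) p

/-- The value at `x` of the `j`-th partial derivative of a polynomial. -/
def evD {d : ℕ} (p : Poly d) (j : Fin d) (x : Space d) : ℝ := ev (MvPolynomial.pderiv j p) x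

/-- `ℙᵏ`: the polynomials of total degree at most `k`.  Restricting them to a simplex `T` gives
`ℙᵏ(T; ℝ)` (bijectively), and restricting them to a face `F` gives `ℙᵏ(F; ℝ)` (surjectively: an
element of `ℙᵏ(F; ℝ)` is represented by any `d`-variate polynomial which agrees with it on `F`). -/
def polyDeg (d k : ℕ) : Submodule ℝ (Poly d) := MvPolynomial.restrictTotalDegree (Fin d) ℝ k

/-- `ℙᵏ⁻¹`, with the convention `ℙ⁻¹ = {0}`. -/
def polyDegPred (d : ℕ) : ℕ → Submodule ℝ (Poly d)
  | 0 => ⊥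
  | k + 1 => polyDeg d k

/-! ### Geometry of a simplex -/

section Simplex

variable {d : ℕ} [NeZero d]

/-- The closed simplex `T` as a set. -/
def cell (T : Affine.Simplex ℝ (Space d) d) : Set (Space d) := T.closedInterior

/-- The face of `T` opposite to the vertex of index `i`, as a (closed) set. -/
def face (T : Affine.Simplex ℝ (Space d) d) (i : Fin (d + 1)) : Set (Space d) :=
  (T.faceOpposite i).closedInterior

/-- Lebesgue measure on `T`. -/
def cellMeasure (T : Affine.Simplex ℝ (Space d) d) : Measure (Space d) :=
  volume.restrict (cell T)

/-- Surface measure (`(d-1)`-dimensional Hausdorff measure, normalized to agree with the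
`(d-1)`-dimensional Lebesgue measure on hyperplanes) on the face opposite to the vertex `i`. -/
def faceMeasure (T : Affine.Simplex ℝ (Space d) d) (i : Fin (d + 1)) : Measure (Space d) :=
  (μHE[d - 1] : Measure (Space d)).restrict (face T i)

/-- The unit outward normal of `T` on the face opposite to the vertex `i`: the unit vector pointing
from this vertex to the foot of the altitude through it. -/
def normal (T : Affine.Simplex ℝ (Space d) d) (i : Fin (d + 1)) : Space d :=
  (T.height i)⁻¹ • (T.altitudeFoot i -ᵥ T.points i)

/-- The weight `τ_T = ℓ / h_T`, where `h_T` is the diameter of `T`. -/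
def tau (T : Affine.Simplex ℝ (Space d) d) (l : ℝ) : ℝ := l / Metric.diam (cell T)

end Simplex

/-! ### Sobolev spaces and traces -/

section Sobolev

variable {d : ℕ} [NeZero d]

/-- `V ∈ H^ν(ℝᵈ)` is an extension of the function `v` on `T`. -/
def IsExtension (ν : ℝ) (T : Affine.Simplex ℝ (Space d) d) (v : Space d → ℝ)
    (V : Lp ℂ 2 (volume : Measure (Space d))) : Prop :=
  TemperedDistribution.MemSobolev ν 2 (V : 𝓢'(Space d, ℂ)) ∧
    ∀ᵐ x ∂(cellMeasure T), V x = (v x : ℂ)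

/-- `v ∈ H^ν(T)` (for `ν ≥ 0`): `v` is the restriction to `T` of an element of `H^ν(ℝᵈ)`. -/
def MemH (ν : ℝ) (T : Affine.Simplex ℝ (Space d) d) (v : Space d → ℝ) : Prop :=
  ∃ V : Lp ℂ 2 (volume : Measure (Space d)), IsExtension ν T v V

/-- The sequence of Schwartz functions `φ` converges to `V` in the norm of `H^ν(ℝᵈ)`, which is the
`L²`-norm of the Bessel potential of order `ν`. -/
def TendstoH (ν : ℝ) (φ : ℕ → 𝓢(Space d, ℂ))
    (V : Lp ℂ 2 (volume : Measure (Space d))) : Prop :=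
  ∃ w : ℕ → Lp ℂ 2 (volume : Measure (Space d)),
    (∀ n, TemperedDistribution.besselPotential (Space d) ℂ ν
      ((V : 𝓢'(Space d, ℂ)) - (φ n : 𝓢'(Space d, ℂ))) = (w n : 𝓢'(Space d, ℂ))) ∧
    Tendsto w atTop (𝓝 0)

/-- `g ∈ L²(F)` is the trace of `v ∈ H^ν(T)` on the face `F` opposite to the vertex `i`: smooth
functions converging to `v` in `H^ν` have restrictions to `F` converging to `g` in `L²(F)`. -/
def IsTrace (ν : ℝ) (T : Affine.Simplex ℝ (Space d) d) (i : Fin (d + 1))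
    (v g : Space d → ℝ) : Prop :=
  MemLp g 2 (faceMeasure T i) ∧
    ∃ (V : Lp ℂ 2 (volume : Measure (Space d))) (φ : ℕ → 𝓢(Space d, ℂ)),
      IsExtension ν T v V ∧ TendstoH ν φ V ∧
      Tendsto (fun n => eLpNorm (fun x => φ n x - (g x : ℂ)) 2 (faceMeasure T i)) atTop (𝓝 0)

end Sobolev

/-! ### Projections, potential reconstruction and stabilization -/

section Operators

variable {d : ℕ} [NeZero d]

/-- `π ∈ ℙᵏ` satisfies the equations of the `L²(m)`-orthogonal projection of `g` onto `ℙᵏ`. -/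
def IsProj (m : Measure (Space d)) (k : ℕ) (g : Space d → ℝ) (π : Poly d) : Prop :=
  π ∈ polyDeg d k ∧ ∀ q ∈ polyDeg d k, ∫ x, (ev π x - g x) * ev q x ∂m = 0

/-- The `L²(m)`-orthogonal projection onto `ℙᵏ`: `Π^k_T` for `m = cellMeasure T`, and `Π^k_F` for
`m = faceMeasure T i` (where the polynomial is determined only by its values on the face, which
are all that matters below). -/
def proj (m : Measure (Space d)) (k : ℕ) (g : Space d → ℝ) : Poly d :=
  Classical.epsilon (IsProj m k g)

/-- The defining equations of the potential reconstruction `R_T(v_T, v_∂T) ∈ ℙᵏ⁺¹(T)`. -/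
def IsRecon (T : Affine.Simplex ℝ (Space d) d) (k : ℕ) (vT : Poly d) (vF : Fin (d + 1) → Poly d)
    (R : Poly d) : Prop :=
  R ∈ polyDeg d (k + 1) ∧
  (∀ w ∈ polyDeg d (k + 1),
    ∫ x, ∑ j, evD R j x * evD w j x ∂(cellMeasure T) =
      (∫ x, ∑ j, evD vT j x * evD w j x ∂(cellMeasure T)) -
      ∑ i, ∫ x, (ev vT x - ev (vF i) x) * ∑ j, evD w j x * normal T i j ∂(faceMeasure T i)) ∧
  ∫ x, (ev R x - ev vT x) ∂(cellMeasure T) = 0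

/-- The potential reconstruction `R_T(v_T, v_∂T)`. -/
def recon (T : Affine.Simplex ℝ (Space d) d) (k : ℕ) (vT : Poly d) (vF : Fin (d + 1) → Poly d) :
    Poly d :=
  Classical.epsilon (IsRecon T k vT vF)

/-- Equal-order stabilization
`S^eo(v_T, v_∂T) = Π^k_∂T { v_T - v_∂T + (1 - Π^k_T) R_T(v_T, v_∂T) }`. -/
def stabEO (T : Affine.Simplex ℝ (Space d) d) (k : ℕ) (vT : Poly d) (vF : Fin (d + 1) → Poly d)
    (i : Fin (d + 1)) : Poly d :=
  proj (faceMeasure T i) k (fun x =>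
    (ev vT x - ev (vF i) x) +
      (ev (recon T k vT vF) x - ev (proj (cellMeasure T) k (ev (recon T k vT vF))) x))

/-- Mixed-order stabilization `S^mo(v_T, v_∂T) = Π^k_∂T { v_T - v_∂T }`. -/
def stabMO (T : Affine.Simplex ℝ (Space d) d) (k : ℕ) (vT : Poly d) (vF : Fin (d + 1) → Poly d)
    (i : Fin (d + 1)) : Poly d :=
  proj (faceMeasure T i) k (fun x => ev vT x - ev (vF i) x)

/-- The stabilization: `S^eo` for `k' = k`, `S^mo` otherwise (that is, for `k' = k + 1`). -/
def stab (T : Affine.Simplex ℝ (Space d) d) (k k' : ℕ) (vT : Poly d) (vF : Fin (d + 1) → Poly d) :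
    Fin (d + 1) → Poly d :=
  if k' = k then stabEO T k vT vF else stabMO T k vT vF

end Operators

/-! ### The local interpolation system -/

section System

variable {d : ℕ} [NeZero d]

/-- The conditions common to all forms of the local system, for the data `(σ, v)` with boundary
traces `(γσ, γv)` and the unknown `p = (p.1, p.2) ∈ ℙᵏ(T; ℝᵈ) × ℙᵏ'(T; ℝ)`. -/
structure CommonConditions (T : Affine.Simplex ℝ (Space d) d) (l : ℝ) (k k' : ℕ)
    (σ : Fin d → Space d → ℝ) (v : Space d → ℝ)
    (γσ : Fin (d + 1) → Fin d → Space d → ℝ) (γv : Fin (d + 1) → Space d → ℝ)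
    (p : (Fin d → Poly d) × Poly d) : Prop where
  mem_dual : ∀ j, p.1 j ∈ polyDeg d k
  mem_primal : p.2 ∈ polyDeg d k'
  /-- moments of the primal variable -/
  primal_moments : ∀ w ∈ polyDegPred d k,
    ∫ x, (ev p.2 x - v x) * ev w x ∂(cellMeasure T) = 0
  /-- moments of the dual variable -/
  dual_moments : ∀ ξ : Fin d → Poly d, (∀ j, ξ j ∈ polyDegPred d k) →
    ∫ x, ∑ j, (ev (p.1 j) x - σ j x) * ev (ξ j) x ∂(cellMeasure T) = 0
  /-- normal traces -/
  normal_traces : ∀ μ : Fin (d + 1) → Poly d, (∀ i, μ i ∈ polyDeg d k) →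
    ∑ i, ∫ x, (∑ j, (γσ i j x - ev (p.1 j) x) * normal T i j) * ev (μ i) x ∂(faceMeasure T i) =
      tau T l * ∑ i, ∫ x, ev (stab T k k' p.2 (fun i => proj (faceMeasure T i) k (γv i)) i) x *
        ev (stab T k k' 0 μ i) x ∂(faceMeasure T i)

/-- The gradient condition
`(p.1 - σ, ∇q)_T = ((Π^k_∂T(σ|_∂T) - σ) · n_T, q)_∂T` for one test polynomial `q`. -/
def GradientCondition (T : Affine.Simplex ℝ (Space d) d) (k : ℕ)
    (σ : Fin d → Space d → ℝ) (γσ : Fin (d + 1) → Fin d → Space d → ℝ)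
    (p : (Fin d → Poly d) × Poly d) (q : Poly d) : Prop :=
  ∫ x, ∑ j, (ev (p.1 j) x - σ j x) * evD q j x ∂(cellMeasure T) =
    ∑ i, ∫ x, (∑ j, (ev (proj (faceMeasure T i) k (γσ i j)) x - γσ i j x) * normal T i j) *
      ev q x ∂(faceMeasure T i)

/-- `p` solves the unified system: the gradient condition is imposed for all `q ∈ ℙᵏ'(T)`. -/
def IsHInterp (νσ νv : ℝ) (T : Affine.Simplex ℝ (Space d) d) (l : ℝ) (k k' : ℕ)
    (σ : Fin d → Space d → ℝ) (v : Space d → ℝ) (p : (Fin d → Poly d) × Poly d) : Prop :=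
  ∃ (γσ : Fin (d + 1) → Fin d → Space d → ℝ) (γv : Fin (d + 1) → Space d → ℝ),
    (∀ i j, IsTrace νσ T i (σ j) (γσ i j)) ∧ (∀ i, IsTrace νv T i v (γv i)) ∧
    CommonConditions T l k k' σ v γσ γv p ∧
    ∀ q ∈ polyDeg d k', GradientCondition T k σ γσ p q

/-- `p` solves the equal-order system (`k' = k`), in which there is no gradient condition. -/
def IsHInterpEO (νσ νv : ℝ) (T : Affine.Simplex ℝ (Space d) d) (l : ℝ) (k : ℕ)
    (σ : Fin d → Space d → ℝ) (v : Space d → ℝ) (p : (Fin d → Poly d) × Poly d) : Prop :=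
  ∃ (γσ : Fin (d + 1) → Fin d → Space d → ℝ) (γv : Fin (d + 1) → Space d → ℝ),
    (∀ i j, IsTrace νσ T i (σ j) (γσ i j)) ∧ (∀ i, IsTrace νv T i v (γv i)) ∧
    CommonConditions T l k k σ v γσ γv p

/-- `p` solves the mixed-order system (`k' = k + 1`), in which the gradient condition is imposed for
all homogeneous polynomials `q` of degree `k + 1`. -/
def IsHInterpMO (νσ νv : ℝ) (T : Affine.Simplex ℝ (Space d) d) (l : ℝ) (k : ℕ)
    (σ : Fin d → Space d → ℝ) (v : Space d → ℝ) (p : (Fin d → Poly d) × Poly d) : Prop :=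
  ∃ (γσ : Fin (d + 1) → Fin d → Space d → ℝ) (γv : Fin (d + 1) → Space d → ℝ),
    (∀ i j, IsTrace νσ T i (σ j) (γσ i j)) ∧ (∀ i, IsTrace νv T i v (γv i)) ∧
    CommonConditions T l k (k + 1) σ v γσ γv p ∧
    ∀ q : Poly d, q.IsHomogeneous (k + 1) → GradientCondition T k σ γσ p q

end System

end HInterp

end

noncomputable section

namespace HInterp

open scoped RealInnerProductSpace ENNReal FourierTransform

section

variable {d : ℕ} [NeZero d] (T : Affine.Simplex ℝ (Space d) d)

/-! ### Barycentric coordinates -/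

/-! There are two independent parts: linear algebra for the polynomial system, and a trace theorem
that makes its data meaningful.

Write the system as A(x, y) = l(y), with x the unknown pair and y ranging over all test tuples for
(a)-(d). There are more test polynomials than unknowns, for two reasons. A polynomial on a face F is
represented by a polynomial in d variables, so face tests of the form λ_F r, with λ_F the
barycentric coordinate vanishing on F, test nothing. And for q in ℙᵏ, condition (d) is condition (b)
with ξ = ∇q, because q restricted to F lies in ℙᵏ(F) and the projection in (d) drops out. These
redundant tests form a space of dimension exactly dim Y - dim X, and both A and l vanish on it. By
the Fredholm alternative (`exists_of_injective_of_finrank`), existence and uniqueness both follow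
once the homogeneous system has only the zero solution.

For that (`eq_zero_of_homogeneous`), let (s, u) be a homogeneous solution. Integration by parts, (a)
and (d) with q = u give (s·n, u)_∂T = 0. In the equal-order case S(u, u|_∂T) = 0, since the
reconstruction reproduces u, so testing (c) with μ = u yields S(0, u|_∂T) = 0 and hence S(u, 0) = 0.
In the mixed case S(0, μ) = -μ, and testing with μ = Π_∂T u yields Π_∂T u = 0. Either way the
stabilization term disappears from (c), so s·n_F vanishes on F; being orthogonal to ℙᵏ⁻¹ it is zero
(`eq_zero_of_face_of_moments`), and s = 0. Finally, for equal order the reconstruction of (u, 0) is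
constant, so u vanishes on the faces and the same lemma gives u = 0; for mixed order integration by
parts gives ∇u = 0, and the constant u has zero projection on a face.

For the traces, the Fourier transform of the restriction of φ to a hyperplane is the integral of 𝓕
φ, up to a phase, along the normal lines. Cauchy-Schwarz with weight (1 + t²)^(-ν), integrable
because ν > 1/2, bounds the restriction by the H^ν norm, uniformly over parallel hyperplanes
(`lintegral_hyp_le`). Completeness gives existence. Uniqueness must not depend on the extension of v
outside T: the uniform bound on slices parallel to a face shows that convergence to zero in L²(T)
forces convergence to zero on the face (`tendsto_face_of_tendsto_cell`). -/

/-- The barycentric coordinate with respect to the vertex `i`. -/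
def lam (i : Fin (d + 1)) (x : Space d) : ℝ :=
  1 - (T.height i)⁻¹ * ⟪x - T.points i, normal T i⟫

lemma inner_points_sub_normal {i j : Fin (d + 1)} (h : i ≠ j) :
    ⟪T.points j - T.points i, normal T i⟫ = T.height i := by
  have h1 := T.inner_vsub_vsub_altitudeFoot_eq_height_sq h
  have h2 := (T.height_pos i).ne'
  rw [vsub_eq_sub, vsub_eq_sub] at h1
  rw [normal, inner_smul_right, vsub_eq_sub, ← neg_sub (T.points i), ← neg_sub (T.points i),
    inner_neg_neg, h1]
  field_simp

lemma altitudeFoot_eq (i : Fin (d + 1)) :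
    T.altitudeFoot i = T.points i + T.height i • normal T i := by
  have h2 := (T.height_pos i).ne'
  rw [normal, smul_smul, mul_inv_cancel₀ h2, one_smul, vsub_eq_sub]
  abel

lemma norm_normal (i : Fin (d + 1)) : ‖normal T i‖ = 1 := by
  have h2 := (T.height_pos i)
  rw [normal, norm_smul, norm_inv, Real.norm_of_nonneg h2.le, vsub_eq_sub, ← dist_eq_norm,
    dist_comm, ← Affine.Simplex.height, inv_mul_cancel₀ h2.ne']

lemma lam_points (i j : Fin (d + 1)) : lam T i (T.points j) = if i = j then 1 else 0 := by
  have h2 := (T.height_pos i).ne'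
  split_ifs with h
  · subst h; simp [lam]
  · rw [lam, inner_points_sub_normal T h, inv_mul_cancel₀ h2, sub_self]

lemma lam_add (i : Fin (d + 1)) (x y : Space d) :
    lam T i (x + y) = lam T i x - (T.height i)⁻¹ * ⟪y, normal T i⟫ := by
  rw [lam, lam, add_sub_right_comm, inner_add_left]; ring

lemma lam_affine_sum (i : Fin (d + 1)) (w : Fin (d + 1) → ℝ) (hw : ∑ j, w j = 1) :
    lam T i (∑ j, w j • T.points j) = w i := by
  have h1 : ∑ j, w j • T.points j - T.points i = ∑ j, w j • (T.points j - T.points i) := by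
    simp_rw [smul_sub, Finset.sum_sub_distrib, ← Finset.sum_smul, hw, one_smul]
  have h3 : ∀ j, w j * lam T i (T.points j) =
      w j - (T.height i)⁻¹ * ⟪w j • (T.points j - T.points i), normal T i⟫ := by
    intro j; rw [lam, inner_smul_left]; simp; ring
  have h4 := Finset.sum_congr rfl (fun j (_ : j ∈ Finset.univ) => h3 j)
  rw [Finset.sum_sub_distrib, hw, ← Finset.mul_sum, ← sum_inner, ← h1] at h4
  rw [lam, ← h4]
  simp [lam_points]

omit [NeZero d] in
lemma affineSpan_points : affineSpan ℝ (Set.range T.points) = ⊤ :=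
  (T.independent.affineSpan_eq_top_iff_card_eq_finrank_add_one).2 (by simp)

omit [NeZero d] in
lemma exists_weights (x : Space d) :
    ∃ w : Fin (d + 1) → ℝ, ∑ j, w j = 1 ∧ x = ∑ j, w j • T.points j ∧
      x = Finset.univ.affineCombination ℝ T.points w := by
  have hx : x ∈ affineSpan ℝ (Set.range T.points) := by
    rw [affineSpan_points]; exact AffineSubspace.mem_top _ _ _
  obtain ⟨w, hw, h⟩ := eq_affineCombination_of_mem_affineSpan_of_fintype hx
  refine ⟨w, hw, ?_, h⟩
  rw [h, Finset.affineCombination_eq_linear_combination _ _ _ hw]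

lemma sum_lam (x : Space d) : ∑ i, lam T i x = 1 := by
  obtain ⟨w, hw, h, -⟩ := exists_weights T x
  simp_rw [h, lam_affine_sum T _ w hw, hw]

lemma sum_lam_smul (x : Space d) : ∑ i, lam T i x • T.points i = x := by
  obtain ⟨w, hw, h, -⟩ := exists_weights T x
  conv_rhs => rw [h]
  refine Finset.sum_congr rfl fun i _ => ?_
  rw [h, lam_affine_sum T _ w hw]

lemma eq_affineCombination_lam (x : Space d) :
    x = Finset.univ.affineCombination ℝ T.points (fun i => lam T i x) := by
  rw [Finset.affineCombination_eq_linear_combination _ _ _ (sum_lam T x), sum_lam_smul]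

lemma mem_cell {x : Space d} : x ∈ cell T ↔ ∀ i, 0 ≤ lam T i x := by
  rw [cell]
  conv_lhs => rw [eq_affineCombination_lam T x]
  rw [Affine.Simplex.affineCombination_mem_closedInterior_iff (sum_lam T x)]
  refine ⟨fun h i => (h i).1, fun h i => ⟨h i, ?_⟩⟩
  rw [← sum_lam T x]
  exact Finset.single_le_sum (fun t _ => h t) (Finset.mem_univ i)

lemma mem_face {i : Fin (d + 1)} {x : Space d} :
    x ∈ face T i ↔ lam T i x = 0 ∧ ∀ j, 0 ≤ lam T j x := by
  rw [face, Affine.Simplex.faceOpposite]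
  conv_lhs => rw [eq_affineCombination_lam T x]
  rw [Affine.Simplex.affineCombination_mem_closedInterior_face_iff_nonneg _ _ (sum_lam T x)]
  constructor
  · intro h
    refine ⟨h.2 i (by simp), fun j => ?_⟩
    by_cases hj : j = i
    · subst hj; exact (h.2 j (by simp)).ge
    · exact h.1 j (by simpa using hj)
  · intro h
    refine ⟨fun j _ => h.2 j, fun j hj => ?_⟩
    have : j = i := by simpa using hj
    subst this; exact h.1

lemma lam_eq_zero_iff {i : Fin (d + 1)} {x : Space d} :
    lam T i x = 0 ↔ ⟪x - T.altitudeFoot i, normal T i⟫ = 0 := by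
  have h2 := (T.height_pos i).ne'
  rw [altitudeFoot_eq, lam, ← sub_sub, inner_sub_left (x - T.points i), inner_smul_left,
    real_inner_self_eq_norm_sq, norm_normal]
  simp only [conj_trivial, one_pow, mul_one]
  constructor
  · intro h
    field_simp at h
    linarith
  · intro h
    field_simp
    linarith

lemma continuous_lam (i : Fin (d + 1)) : Continuous (lam T i) := by
  unfold lam; fun_prop

lemma isClosed_cell : IsClosed (cell T) := by
  have : cell T = ⋂ i, {x | 0 ≤ lam T i x} := by ext x; simp [mem_cell]
  rw [this]
  exact isClosed_iInter fun i => isClosed_le continuous_const (continuous_lam T i)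

lemma isClosed_face (i : Fin (d + 1)) : IsClosed (face T i) := by
  have : face T i = {x | lam T i x = 0} ∩ ⋂ i, {x | 0 ≤ lam T i x} := by ext x; simp [mem_face]
  rw [this]
  exact (isClosed_eq (continuous_lam T i) continuous_const).inter
    (isClosed_iInter fun i => isClosed_le continuous_const (continuous_lam T i))

lemma face_subset_cell (i : Fin (d + 1)) : face T i ⊆ cell T := fun _ hx =>
  (mem_cell T).2 ((mem_face T).1 hx).2

lemma isCompact_cell : IsCompact (cell T) := by
  refine Metric.isCompact_of_isClosed_isBounded (isClosed_cell T) ?_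
  refine isBounded_iff_forall_norm_le.2 ⟨∑ i, ‖T.points i‖, fun x hx => ?_⟩
  have hx' := (mem_cell T).1 hx
  have h1 : ∀ i, lam T i x ≤ 1 := fun i => by
    rw [← sum_lam T x]
    exact Finset.single_le_sum (fun t _ => hx' t) (Finset.mem_univ i)
  conv_lhs => rw [← sum_lam_smul T x]
  refine (norm_sum_le _ _).trans (Finset.sum_le_sum fun i _ => ?_)
  rw [norm_smul, Real.norm_of_nonneg (hx' i)]
  exact mul_le_of_le_one_left (norm_nonneg _) (h1 i)

lemma isCompact_face (i : Fin (d + 1)) : IsCompact (face T i) :=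
  (isCompact_cell T).of_isClosed_subset (isClosed_face T i) (face_subset_cell T i)

/-- The vertices of a face span it: a weighted mean point with prescribed positive weights. -/
lemma exists_pos_point (i : Fin (d + 1)) :
    ∃ x, lam T i x = 0 ∧ ∀ j, j ≠ i → 0 < lam T j x := by
  have hd : (0 : ℝ) < d := Nat.cast_pos.2 (NeZero.pos d)
  -- The barycentre of the face, which has d vertices.
  refine ⟨∑ j, (if j = i then 0 else (d : ℝ)⁻¹) • T.points j, ?_⟩
  have hw : ∑ j : Fin (d + 1), (if j = i then 0 else (d : ℝ)⁻¹) = 1 := by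
    rw [Finset.sum_ite]
    simp [Finset.filter_ne', hd.ne']
  refine ⟨by rw [lam_affine_sum T _ _ hw]; simp, fun j hj => ?_⟩
  rw [lam_affine_sum T _ _ hw, if_neg hj]
  positivity

lemma interior_cell_nonempty : (interior (cell T)).Nonempty := by
  have hw : ∑ _j : Fin (d + 1), ((d : ℝ) + 1)⁻¹ = 1 := by
    rw [Finset.sum_const]; simp; field_simp
  refine ⟨∑ j, ((d : ℝ) + 1)⁻¹ • T.points j, ?_⟩
  have : IsOpen {x | ∀ i, 0 < lam T i x} := by
    simp only [Set.ofPred_forall]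
    exact isOpen_iInter_of_finite fun i => isOpen_lt continuous_const (continuous_lam T i)
  refine interior_maximal (fun x hx => (mem_cell T).2 fun i => (hx i).le) this ?_
  intro i
  rw [lam_affine_sum T i _ hw]
  positivity

/-! ### Orthogonal decomposition along a normal and the face measure -/

/-- The direction of the hyperplane spanned by a face. -/
abbrev Hyp (n : Space d) : Submodule ℝ (Space d) := (Submodule.span ℝ {n})ᗮ

omit [NeZero d] in
lemma finrank_hyp {n : Space d} (hn : ‖n‖ = 1) : Module.finrank ℝ (Hyp n) = d - 1 := by
  have h0 : n ≠ 0 := by rintro rfl; simp at hn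
  have h1 := Submodule.finrank_add_finrank_orthogonal (Submodule.span ℝ {n})
  rw [finrank_span_singleton h0, finrank_euclideanSpace, Fintype.card_fin] at h1
  change Module.finrank ℝ (Submodule.span ℝ {n})ᗮ = d - 1
  omega

/-- Orthogonal coordinates along a unit vector. -/
def frame (n a : Space d) (q : ℝ × Hyp n) : Space d := a + q.1 • n + q.2

-- The splitting of ℝᵈ into the line of n and its orthogonal complement is measure preserving; since
-- n is a unit vector, the line can be parametrized by arc length. This supplies Fubini for the cone
-- formula and for the trace estimate.
omit [NeZero d] in
lemma measurePreserving_frame {n : Space d} (hn : ‖n‖ = 1) (a : Space d) :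
    MeasurePreserving (frame n a) ((volume : Measure ℝ).prod volume) volume := by
  have h1 := ((Submodule.span ℝ {n}).measurePreserving_measurableEquivProd a).symm
  rw [InnerProductSpace.euclideanHausdorffMeasure_eq_volume] at h1
  have h2 := (LinearIsometryEquiv.toSpanUnitSingleton n hn).measurePreserving
  have h3 := h2.prod (MeasurePreserving.id (volume : Measure (Hyp n)))
  have h4 := h1.comp h3
  suffices h5 : frame n a = ((Submodule.span ℝ {n}).measurableEquivProd a).symm ∘
      Prod.map (LinearIsometryEquiv.toSpanUnitSingleton n hn) id by rw [h5]; exact h4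
  funext q
  change a + q.1 • n + (q.2 : Space d) = _
  simp only [Function.comp_apply, Submodule.measurableEquivProd_symm_apply]
  simp
  abel

omit [NeZero d] in
lemma lintegral_frame {n : Space d} (hn : ‖n‖ = 1) (a : Space d) {f : Space d → ℝ≥0∞}
    (hf : Measurable f) :
    ∫⁻ x, f x = ∫⁻ t : ℝ, ∫⁻ w : Hyp n, f (a + t • n + w) := by
  rw [← (measurePreserving_frame hn a).lintegral_comp hf, lintegral_prod]
  · rfl
  · exact (hf.comp (measurePreserving_frame hn a).measurable).aemeasurable

lemma range_add_hyp (i : Fin (d + 1)) :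
    Set.range (fun w : Hyp (normal T i) => T.altitudeFoot i + (w : Space d)) =
      {x | lam T i x = 0} := by
  ext x
  simp only [Set.mem_range, Set.mem_ofPred_eq, lam_eq_zero_iff]
  constructor
  · rintro ⟨w, rfl⟩
    rw [add_sub_cancel_left]
    exact Submodule.mem_orthogonal_singleton_iff_inner_left.1 w.2
  · intro h
    exact ⟨⟨x - T.altitudeFoot i, Submodule.mem_orthogonal_singleton_iff_inner_left.2 h⟩, by simp⟩

lemma isometry_add_hyp (i : Fin (d + 1)) :
    Isometry (fun w : Hyp (normal T i) => T.altitudeFoot i + (w : Space d)) := by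
  refine Isometry.of_dist_eq fun x y => ?_
  rw [dist_add_left]; rfl

/-- An isometric embedding carries the normalized Hausdorff measure to its restriction to the range,
here the hyperplane of the face, and on the model space `Hyp` this measure is Lebesgue measure. -/
lemma faceMeasure_eq_map (i : Fin (d + 1)) :
    faceMeasure T i = (Measure.map
      (fun w : Hyp (normal T i) => T.altitudeFoot i + (w : Space d)) volume).restrict (face T i) := by
  rw [faceMeasure, ← InnerProductSpace.euclideanHausdorffMeasure_eq_volume,
    finrank_hyp (norm_normal T i), (isometry_add_hyp T i).map_euclideanHausdorffMeasure,
    Measure.restrict_restrict (isClosed_face T i).measurableSet, range_add_hyp,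
    Set.inter_eq_left.2 (show face T i ⊆ {x | lam T i x = 0} from
      fun _ hx => ((mem_face T).1 hx).1)]

lemma lintegral_face (i : Fin (d + 1)) {f : Space d → ℝ≥0∞} (hf : Measurable f) :
    ∫⁻ y, f y ∂(faceMeasure T i) = ∫⁻ w : Hyp (normal T i),
      (face T i).indicator f (T.altitudeFoot i + w) := by
  rw [faceMeasure_eq_map, ← lintegral_indicator (isClosed_face T i).measurableSet,
    lintegral_map (hf.indicator (isClosed_face T i).measurableSet)
      (isometry_add_hyp T i).continuous.measurable]

instance (i : Fin (d + 1)) : IsFiniteMeasure (faceMeasure T i) := by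
  refine ⟨?_⟩
  rw [faceMeasure_eq_map, Measure.restrict_apply_univ, Measure.map_apply
    (isometry_add_hyp T i).continuous.measurable (isClosed_face T i).measurableSet]
  exact ((isometry_add_hyp T i).isClosedEmbedding.isCompact_preimage
    (isCompact_face T i)).measure_lt_top

instance : IsFiniteMeasure (cellMeasure T) :=
  ⟨by rw [cellMeasure, Measure.restrict_apply_univ]; exact (isCompact_cell T).measure_lt_top⟩

end

section

variable {d : ℕ} [NeZero d] (T : Affine.Simplex ℝ (Space d) d)

/-! ### Integration over a simplex as over a cone with a face as its base -/

lemma lintegral_eq_smul {E : Type*} [NormedAddCommGroup E] [NormedSpace ℝ E] [MeasurableSpace E]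
    [BorelSpace E] [FiniteDimensional ℝ E] (μ : Measure E) [μ.IsAddHaarMeasure] {f : E → ℝ≥0∞}
    (hf : Measurable f) {r : ℝ} (hr : 0 < r) :
    ∫⁻ x, f x ∂μ = ENNReal.ofReal (r ^ Module.finrank ℝ E) * ∫⁻ x, f (r • x) ∂μ := by
  have h1 := Measure.map_addHaar_smul μ hr.ne'
  have h2 : ∫⁻ x, f (r • x) ∂μ = ∫⁻ x, f x ∂(Measure.map (fun x => r • x) μ) :=
    (lintegral_map hf (measurable_const_smul r)).symm
  rw [h2, h1, lintegral_smul_measure, smul_eq_mul, ← mul_assoc, ← ENNReal.ofReal_mul (by positivity),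
    abs_of_pos (by positivity), mul_inv_cancel₀ (by positivity), ENNReal.ofReal_one, one_mul]

lemma lam_cone (i j : Fin (d + 1)) (r : ℝ) (y : Space d) :
    lam T j (T.points i + r • (y - T.points i)) =
      (1 - r) * (if j = i then 1 else 0) + r * lam T j y := by
  rw [← lam_points T j i, lam_add, inner_smul_left]
  simp only [lam, inner_sub_left, conj_trivial]
  ring

lemma cone_mem_cell_iff {i : Fin (d + 1)} {r : ℝ} (h0 : 0 < r) (h1 : r ≤ 1) {y : Space d}
    (hy : lam T i y = 0) : T.points i + r • (y - T.points i) ∈ cell T ↔ y ∈ face T i := by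
  rw [mem_cell, mem_face]
  simp_rw [lam_cone]
  constructor
  · intro h
    refine ⟨hy, fun j => ?_⟩
    by_cases hj : j = i
    · subst hj; exact hy.ge
    · have := h j
      simp only [hj, if_false, mul_zero, zero_add] at this
      exact nonneg_of_mul_nonneg_right this h0
  · rintro ⟨-, h⟩ j
    have := h j
    split_ifs <;> nlinarith [mul_nonneg h0.le this]

/-- The slice at distance `T.height i * r` from the vertex `i` is the face scaled by r about this
vertex. The scaling contributes r^(d-1), the change of variable along the altitude contributes the
height. -/
lemma lintegral_cell (i : Fin (d + 1)) {f : Space d → ℝ≥0∞} (hf : Measurable f) :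
    ∫⁻ x, f x ∂(cellMeasure T) = ∫⁻ r in Set.Ioo (0 : ℝ) 1,
      ENNReal.ofReal (T.height i * r ^ (d - 1)) *
        ∫⁻ y, f (T.points i + r • (y - T.points i)) ∂(faceMeasure T i) := by
  have hh := T.height_pos i
  have hn := norm_normal T i
  set G := (cell T).indicator f with hG
  have hGm : Measurable G := hf.indicator (isClosed_cell T).measurableSet
  have hlam : ∀ (r : ℝ) (w : Hyp (normal T i)),
      lam T i (T.points i + (T.height i * r) • normal T i + w) = 1 - r := by
    intro r w
    rw [lam_add, lam_add, lam_points, if_pos rfl, inner_smul_left, real_inner_self_eq_norm_sq, hn,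
      Submodule.mem_orthogonal_singleton_iff_inner_left.1 w.2]
    simp only [conj_trivial]
    field_simp
    ring
  have hJ : Measurable fun t : ℝ => ∫⁻ w : Hyp (normal T i), G (T.points i + t • normal T i + w) := by
    have : Measurable fun q : ℝ × Hyp (normal T i) =>
        G (T.points i + q.1 • normal T i + q.2) := by
      refine hGm.comp ?_
      fun_prop
    exact this.lintegral_prod_right'
  rw [cellMeasure, ← lintegral_indicator (isClosed_cell T).measurableSet, ← hG,
    lintegral_frame hn (T.points i) hGm, lintegral_eq_smul volume hJ hh]
  simp only [Module.finrank_self, pow_one, smul_eq_mul]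
  -- On this slice the coordinate of the vertex is 1 - r, so the slice misses the simplex unless r
  -- lies in [0, 1].
  have h1 : ∫⁻ r : ℝ, ∫⁻ w : Hyp (normal T i), G (T.points i + (T.height i * r) • normal T i + w) =
      ∫⁻ r in Set.Ioo (0 : ℝ) 1, ∫⁻ w : Hyp (normal T i),
        G (T.points i + (T.height i * r) • normal T i + w) := by
    rw [Measure.restrict_congr_set Ioo_ae_eq_Icc, ← lintegral_indicator measurableSet_Icc]
    refine lintegral_congr fun r => ?_
    by_cases hr : r ∈ Set.Icc (0 : ℝ) 1
    · rw [Set.indicator_of_mem hr]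
    · rw [Set.indicator_of_notMem hr]
      refine (lintegral_congr fun w => ?_).trans lintegral_zero
      refine Set.indicator_of_notMem (fun hx => hr ?_) _
      have h2 := (mem_cell T).1 hx
      have h3 := sum_lam T (T.points i + (T.height i * r) • normal T i + (w : Space d))
      have h4 := Finset.single_le_sum (fun t _ => h2 t) (Finset.mem_univ i)
      rw [h3, hlam] at h4
      have h5 := h2 i
      rw [hlam] at h5
      constructor <;> linarith
  rw [h1, ← lintegral_const_mul' _ _ ENNReal.ofReal_ne_top]
  refine setLIntegral_congr_fun measurableSet_Ioo fun r hr => ?_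
  have hK : Measurable fun w : Hyp (normal T i) =>
      G (T.points i + (T.height i * r) • normal T i + w) := by
    refine hGm.comp ?_
    fun_prop
  have hF : Measurable fun y => f (T.points i + r • (y - T.points i)) := hf.comp (by fun_prop)
  rw [lintegral_eq_smul volume hK hr.1, finrank_hyp hn, ← mul_assoc, ← ENNReal.ofReal_mul hh.le,
    lintegral_face T i hF]
  congr 1
  refine lintegral_congr fun w => ?_
  have h6 : T.points i + (T.height i * r) • normal T i + ((r • w : Hyp (normal T i)) : Space d) =
      T.points i + r • (T.altitudeFoot i + w - T.points i) := by
    rw [altitudeFoot_eq, Submodule.coe_smul, mul_comm, mul_smul]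
    module
  have h7 : lam T i (T.altitudeFoot i + w) = 0 := by
    have := hlam 1 w
    rwa [mul_one, ← altitudeFoot_eq, sub_self] at this
  rw [h6, hG]
  by_cases hw : T.altitudeFoot i + (w : Space d) ∈ face T i
  · rw [Set.indicator_of_mem hw, Set.indicator_of_mem ((cone_mem_cell_iff T hr.1 hr.2.le h7).2 hw)]
  · rw [Set.indicator_of_notMem hw,
      Set.indicator_of_notMem (mt (cone_mem_cell_iff T hr.1 hr.2.le h7).1 hw)]

/-- The density of the radial variable in the cone decomposition. -/
def radial (i : Fin (d + 1)) : Measure ℝ :=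
  (volume.restrict (Set.Ioo (0 : ℝ) 1)).withDensity
    (fun r => ENNReal.ofReal (T.height i * r ^ (d - 1)))

/-- The cone decomposition as a statement about measures, so that it also applies to Bochner
integrals of signed functions. -/
lemma measurePreserving_cone (i : Fin (d + 1)) :
    MeasurePreserving (fun q : ℝ × Space d => T.points i + q.1 • (q.2 - T.points i))
      ((radial T i).prod (faceMeasure T i)) (cellMeasure T) := by
  have hm : Measurable fun q : ℝ × Space d => T.points i + q.1 • (q.2 - T.points i) := by fun_prop
  refine ⟨hm, Measure.ext_of_lintegral _ fun f hf => ?_⟩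
  have hw : Measurable fun r : ℝ => ENNReal.ofReal (T.height i * r ^ (d - 1)) := by fun_prop
  rw [lintegral_map hf hm, lintegral_prod (fun q : ℝ × Space d => f (T.points i + q.1 • (q.2 - T.points i)))
      (hf.comp hm).aemeasurable, radial,
    lintegral_withDensity_eq_lintegral_mul _ hw (g := fun r => ∫⁻ y,
      f (T.points i + r • (y - T.points i)) ∂(faceMeasure T i)) (hf.comp hm).lintegral_prod_right',
    lintegral_cell T i hf]
  rfl

instance (i : Fin (d + 1)) : IsFiniteMeasure (radial T i) := by
  refine ⟨?_⟩
  rw [radial, withDensity_apply _ MeasurableSet.univ, Measure.restrict_univ]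
  refine lt_of_le_of_lt (setLIntegral_mono (g := fun _ => ENNReal.ofReal (T.height i))
    measurable_const fun r hr => ENNReal.ofReal_le_ofReal ?_) ?_
  · exact mul_le_of_le_one_right (T.height_pos i).le (pow_le_one₀ hr.1.le hr.2.le)
  · simp

lemma integral_radial (i : Fin (d + 1)) (g : ℝ → ℝ) :
    ∫ r, g r ∂(radial T i) = ∫ r in (0 : ℝ)..1, T.height i * r ^ (d - 1) * g r := by
  have hw : Measurable fun r : ℝ => ENNReal.ofReal (T.height i * r ^ (d - 1)) := by fun_prop
  rw [intervalIntegral.integral_of_le zero_le_one, ← restrict_Ioo_eq_restrict_Ioc, radial,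
    integral_withDensity_eq_integral_toReal_smul hw (by simp)]
  refine setIntegral_congr_fun measurableSet_Ioo fun r hr => ?_
  simp only [smul_eq_mul]
  rw [ENNReal.toReal_ofReal (mul_nonneg (T.height_pos i).le (pow_nonneg hr.1.le _))]

/-! ### Integrability of continuous functions, and the divergence theorem -/

lemma ae_mem_cell : ∀ᵐ x ∂(cellMeasure T), x ∈ cell T :=
  ae_restrict_mem (isClosed_cell T).measurableSet

lemma ae_mem_face (i : Fin (d + 1)) : ∀ᵐ x ∂(faceMeasure T i), x ∈ face T i :=
  ae_restrict_mem (isClosed_face T i).measurableSet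

lemma memLp_top_cell {f : Space d → ℝ} (hf : Continuous f) : MemLp f ⊤ (cellMeasure T) := by
  obtain ⟨C, hC⟩ := (isCompact_cell T).exists_bound_of_continuousOn hf.continuousOn
  refine memLp_top_of_bound hf.aestronglyMeasurable C ?_
  filter_upwards [ae_mem_cell T] with x hx using hC x hx

lemma memLp_top_face (i : Fin (d + 1)) {f : Space d → ℝ} (hf : Continuous f) :
    MemLp f ⊤ (faceMeasure T i) := by
  obtain ⟨C, hC⟩ := (isCompact_face T i).exists_bound_of_continuousOn hf.continuousOn
  refine memLp_top_of_bound hf.aestronglyMeasurable C ?_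
  filter_upwards [ae_mem_face T i] with x hx using hC x hx

lemma integrable_cell {f : Space d → ℝ} (hf : Continuous f) : Integrable f (cellMeasure T) :=
  (memLp_top_cell T hf).integrable le_top

lemma integrable_face (i : Fin (d + 1)) {f : Space d → ℝ} (hf : Continuous f) :
    Integrable f (faceMeasure T i) := (memLp_top_face T i hf).integrable le_top

/-- Cone formula: the divergence theorem for the field `x ↦ f x • (x - p_i)`. -/
lemma integral_cell_radial (i : Fin (d + 1)) {f : Space d → ℝ} {f' : Space d → Space d →L[ℝ] ℝ}
    (hf : ∀ x, HasFDerivAt f (f' x) x) (hf' : Continuous f') :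
    ∫ x, (d * f x + f' x (x - T.points i)) ∂(cellMeasure T) =
      T.height i * ∫ y, f y ∂(faceMeasure T i) := by
  have hfc : Continuous f := continuous_iff_continuousAt.2 fun x => (hf x).continuousAt
  set F : Space d → ℝ := fun x => d * f x + f' x (x - T.points i) with hF
  have hFc : Continuous F := by fun_prop
  have hmp := measurePreserving_cone T i
  have hint : Integrable (fun q : ℝ × Space d => F (T.points i + q.1 • (q.2 - T.points i)))
      ((radial T i).prod (faceMeasure T i)) :=
    hmp.integrable_comp_of_integrable (integrable_cell T hFc)
  rw [← hmp.map_eq, integral_map hmp.measurable.aemeasurable hFc.aestronglyMeasurable,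
    integral_prod_symm _ hint, ← integral_const_mul]
  refine integral_congr_ae (Eventually.of_forall fun y => ?_)
  simp only
  rw [integral_radial]
  set c : ℝ → Space d := fun r => T.points i + r • (y - T.points i) with hc
  -- Along each ray the integrand is the derivative of h r^d f. The value at r = 0 vanishes as d >
  -- 0, and r = 1 contributes h f(y).
  have hder : ∀ r ∈ Set.uIcc (0 : ℝ) 1, HasDerivAt (fun r => T.height i * (r ^ d * f (c r)))
      (T.height i * r ^ (d - 1) * F (c r)) r := by
    intro r _
    have h1 : HasDerivAt c (y - T.points i) r := by
      have := ((hasDerivAt_id r).smul_const (y - T.points i)).const_add (T.points i)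
      rwa [one_smul] at this
    have h2 := ((hasDerivAt_pow d r).mul ((hf (c r)).comp_hasDerivAt r h1)).const_mul (T.height i)
    refine h2.congr_deriv ?_
    have h3 : r ^ d = r ^ (d - 1) * r := by
      rw [← pow_succ, Nat.sub_add_cancel (NeZero.pos d)]
    have h4 : c r - T.points i = r • (y - T.points i) := by simp [hc]
    simp only [hF, h4, map_smul, smul_eq_mul, h3, Function.comp_apply]
    ring
  rw [intervalIntegral.integral_eq_sub_of_hasDerivAt hder]
  · simp [hc, NeZero.ne d]
  · apply Continuous.intervalIntegrable
    fun_prop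

/-- The divergence theorem on a simplex. -/
theorem integral_cell_fderiv {f : Space d → ℝ} {f' : Space d → Space d →L[ℝ] ℝ}
    (hf : ∀ x, HasFDerivAt f (f' x) x) (hf' : Continuous f') (a : Space d) :
    ∫ x, f' x a ∂(cellMeasure T) = ∑ i, ⟪a, normal T i⟫ * ∫ y, f y ∂(faceMeasure T i) := by
  have hfc : Continuous f := continuous_iff_continuousAt.2 fun x => (hf x).continuousAt
  -- `c i` is the derivative of the barycentric coordinate i in direction a. Hence the `c i` sum to
  -- 0 and a = ∑ c_i p_i, so that the constant direction is -∑ c_i (x - p_i), a combination of the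
  -- radial fields of the cone formula.
  set c : Fin (d + 1) → ℝ := fun i => - ⟪a, normal T i⟫ * (T.height i)⁻¹ with hc
  have hcl : ∀ i, c i = lam T i (T.points 0 + a) - lam T i (T.points 0) := by
    intro i; rw [lam_add]; simp [hc]; ring
  have hc0 : ∑ i, c i = 0 := by simp_rw [hcl, Finset.sum_sub_distrib, sum_lam]; simp
  have hca : ∑ i, c i • T.points i = a := by
    simp_rw [hcl, sub_smul, Finset.sum_sub_distrib, sum_lam_smul]; simp
  have h1 : ∀ x, f' x a = - ∑ i, c i * (d * f x + f' x (x - T.points i)) := by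
    intro x
    conv_lhs => rw [← hca]
    have h2 : ∑ i, c i * (d * f x + f' x x) = 0 := by rw [← Finset.sum_mul, hc0, zero_mul]
    have h3 : ∀ i, c i * (d * f x + f' x (x - T.points i)) =
        c i * (d * f x + f' x x) - f' x (c i • T.points i) := fun i => by
      rw [map_sub, map_smul, smul_eq_mul]; ring
    simp_rw [h3, Finset.sum_sub_distrib, h2, map_sum]
    simp
  simp_rw [h1]
  rw [integral_neg, integral_finsetSum _ fun i _ => (integrable_cell T (by fun_prop)).const_mul _,
    ← Finset.sum_neg_distrib]
  refine Finset.sum_congr rfl fun i _ => ?_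
  rw [integral_const_mul, integral_cell_radial T i hf hf', hc]
  have := (T.height_pos i).ne'
  field_simp

end

section

/-! ### Polynomials on a simplex and on its faces -/

section Polynomials

variable {d : ℕ}

@[simp] lemma ev_add (p q : Poly d) (x : Space d) : ev (p + q) x = ev p x + ev q x := by simp [ev]
@[simp] lemma ev_sub (p q : Poly d) (x : Space d) : ev (p - q) x = ev p x - ev q x := by simp [ev]
@[simp] lemma ev_neg (p : Poly d) (x : Space d) : ev (-p) x = - ev p x := by simp [ev]
@[simp] lemma ev_mul (p q : Poly d) (x : Space d) : ev (p * q) x = ev p x * ev q x := by simp [ev]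
@[simp] lemma ev_smul (c : ℝ) (p : Poly d) (x : Space d) : ev (c • p) x = c * ev p x := by simp [ev]
@[simp] lemma ev_zero (x : Space d) : ev 0 x = 0 := by simp [ev]
@[simp] lemma ev_one (x : Space d) : ev 1 x = 1 := by simp [ev]
@[simp] lemma ev_C (c : ℝ) (x : Space d) : ev (MvPolynomial.C c) x = c := by simp [ev]
@[simp] lemma ev_X (j : Fin d) (x : Space d) : ev (MvPolynomial.X j) x = x j := by simp [ev]
@[simp] lemma ev_sum {ι : Type*} (s : Finset ι) (p : ι → Poly d) (x : Space d) :
    ev (∑ i ∈ s, p i) x = ∑ i ∈ s, ev (p i) x := by simp [ev]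
@[simp] lemma evD_add (p q : Poly d) (j : Fin d) (x : Space d) :
    evD (p + q) j x = evD p j x + evD q j x := by simp [evD]
@[simp] lemma evD_smul (c : ℝ) (p : Poly d) (j : Fin d) (x : Space d) :
    evD (c • p) j x = c * evD p j x := by simp [evD]
@[simp] lemma evD_zero (j : Fin d) (x : Space d) : evD 0 j x = 0 := by simp [evD]
lemma evD_mul (p q : Poly d) (j : Fin d) (x : Space d) :
    evD (p * q) j x = evD p j x * ev q x + ev p x * evD q j x := by
  rw [evD, MvPolynomial.pderiv_mul, ev_add, ev_mul, ev_mul]; rfl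

lemma ev_aeval (g : Fin d → Poly d) (p : Poly d) (x : Space d) :
    ev (MvPolynomial.aeval g p) x = ev p (WithLp.toLp 2 fun j => ev (g j) x) := by
  induction p using MvPolynomial.induction_on with
  | C a => simp [MvPolynomial.algebraMap_eq]
  | add p q hp hq => rw [map_add, ev_add, ev_add, hp, hq]
  | mul_X p i hp => rw [map_mul, ev_mul, ev_mul, hp, MvPolynomial.aeval_X, ev_X]

@[fun_prop] lemma continuous_ev (p : Poly d) : Continuous (ev p) :=
  (MvPolynomial.continuous_eval p).comp (by fun_prop)

@[fun_prop] lemma continuous_evD (p : Poly d) (j : Fin d) : Continuous (evD p j) := continuous_ev _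

lemma hasFDerivAt_ev (p : Poly d) (x : Space d) :
    HasFDerivAt (ev p) (∑ j, evD p j x • (EuclideanSpace.proj j : Space d →L[ℝ] ℝ)) x := by
  induction p using MvPolynomial.induction_on with
  | C a =>
    have : ev (MvPolynomial.C a : Poly d) = fun _ => a := by ext; simp
    rw [this]
    simpa [evD] using hasFDerivAt_const a x
  | add p q hp hq =>
    have : ev (p + q) = fun x => ev p x + ev q x := by ext; simp
    rw [this]
    refine (hp.add hq).congr_fderiv ?_
    simp [add_smul, Finset.sum_add_distrib]
  | mul_X p i hp =>
    have : ev (p * MvPolynomial.X i) = fun x => ev p x * (EuclideanSpace.proj i : Space d →L[ℝ] ℝ) x := by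
      ext; simp
    rw [this]
    have h : ∀ j, evD (MvPolynomial.X i : Poly d) j x = if j = i then 1 else 0 := by
      intro j
      simp only [evD, MvPolynomial.pderiv_X, Pi.single_apply, eq_comm (a := i)]
      split_ifs <;> simp
    refine (hp.mul (EuclideanSpace.proj i : Space d →L[ℝ] ℝ).hasFDerivAt).congr_fderiv ?_
    simp only [evD_mul, h, ev_X, add_smul, Finset.sum_add_distrib, mul_ite, mul_one, mul_zero,
      ite_smul, zero_smul, Finset.sum_ite_eq', Finset.mem_univ, if_true,
      Finset.smul_sum, smul_smul]
    rw [add_comm]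
    congr 1
    refine Finset.sum_congr rfl fun j _ => ?_
    rw [mul_comm]; rfl

lemma eq_of_ev_eq {p q : Poly d} (h : ∀ x, ev p x = ev q x) : p = q :=
  MvPolynomial.funext fun x => h (WithLp.toLp 2 x)

lemma mem_polyDeg {k : ℕ} {p : Poly d} : p ∈ polyDeg d k ↔ p.totalDegree ≤ k :=
  MvPolynomial.mem_restrictTotalDegree _ _ _

lemma polyDeg_mono {k l : ℕ} (h : k ≤ l) : polyDeg d k ≤ polyDeg d l := fun _ hp =>
  mem_polyDeg.2 ((mem_polyDeg.1 hp).trans h)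

lemma pderiv_mem {k : ℕ} {p : Poly d} (hp : p ∈ polyDeg d k) (j : Fin d) :
    MvPolynomial.pderiv j p ∈ polyDegPred d k := by
  rw [mem_polyDeg] at hp
  cases k with
  | zero =>
    rw [MvPolynomial.totalDegree_eq_zero_iff_eq_C.1 (Nat.le_zero.1 hp)]
    simp
  | succ k =>
    refine mem_polyDeg.2 (Finset.sup_le fun m hm => ?_)
    rw [MvPolynomial.mem_support_iff, MvPolynomial.coeff_pderiv] at hm
    have h1 : m + Finsupp.single j 1 ∈ p.support := by
      rw [MvPolynomial.mem_support_iff]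
      exact left_ne_zero_of_mul hm
    have h2 := (MvPolynomial.le_totalDegree h1).trans hp
    rw [Finsupp.sum_add_index' (by simp) (by simp), Finsupp.sum_single_index rfl] at h2
    omega

lemma pderiv_mem' {k : ℕ} {p : Poly d} (hp : p ∈ polyDeg d (k + 1)) (j : Fin d) :
    MvPolynomial.pderiv j p ∈ polyDeg d k := pderiv_mem hp j

lemma mul_mem_polyDeg {p r : Poly d} {k : ℕ} (hp : p ∈ polyDeg d 1) (hr : r ∈ polyDegPred d k) :
    p * r ∈ polyDeg d k := by
  cases k with
  | zero => rw [(Submodule.mem_bot ℝ).1 hr, mul_zero]; exact zero_mem _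
  | succ k =>
    have h1 := mem_polyDeg.1 hp
    have h2 := mem_polyDeg.1 hr
    exact mem_polyDeg.2 ((MvPolynomial.totalDegree_mul _ _).trans (by omega))

/-- A polynomial of degree at most `k + 1` is the sum of a homogeneous one of degree `k + 1` and
one of degree at most `k`. -/
lemma exists_homogeneous_add {k : ℕ} {p : Poly d} (hp : p ∈ polyDeg d (k + 1)) :
    ∃ q r : Poly d, q.IsHomogeneous (k + 1) ∧ r ∈ polyDeg d k ∧ p = q + r := by
  refine ⟨_, p - MvPolynomial.homogeneousComponent (k + 1) p,
    MvPolynomial.homogeneousComponent_isHomogeneous (k + 1) p, ?_, by ring⟩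
  refine mem_polyDeg.2 (Finset.sup_le fun m hm => ?_)
  rw [MvPolynomial.mem_support_iff, MvPolynomial.coeff_sub,
    MvPolynomial.coeff_homogeneousComponent] at hm
  split_ifs at hm with h
  · simp at hm
  · have h2 := (MvPolynomial.le_totalDegree (p := p) (s := m) (by
      rw [MvPolynomial.mem_support_iff]; simpa using hm)).trans (mem_polyDeg.1 hp)
    have h3 : m.degree = m.sum fun _ e => e := rfl
    omega

lemma eq_zero_of_eqOn_open {p : Poly d} {U : Set (Space d)} (hU : IsOpen U) (hne : U.Nonempty)
    (h : ∀ x ∈ U, ev p x = 0) : p = 0 := by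
  obtain ⟨x, hx⟩ := hne
  have ha : AnalyticOnNhd ℝ (ev p) Set.univ := by
    have := AnalyticOnNhd.eval_continuousLinearMap (𝕜 := ℝ)
      (EuclideanSpace.equiv (Fin d) ℝ : Space d →L[ℝ] (Fin d → ℝ)) p
    exact this
  have h0 : AnalyticOnNhd ℝ (fun _ : Space d => (0 : ℝ)) Set.univ := analyticOnNhd_const
  have := ha.eq_of_eventuallyEq h0 (z₀ := x)
    (Filter.eventually_of_mem (hU.mem_nhds hx) fun y hy => h y hy)
  exact eq_of_ev_eq fun y => by rw [this]; simp

end Polynomials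

variable {d : ℕ} [NeZero d] (T : Affine.Simplex ℝ (Space d) d)

lemma eq_zero_of_ae_cell {p : Poly d} (h : ∀ᵐ x ∂(cellMeasure T), ev p x = 0) : p = 0 := by
  refine eq_zero_of_eqOn_open isOpen_interior (interior_cell_nonempty T) ?_
  have h1 : ev p =ᵐ[volume.restrict (interior (cell T))] fun _ => 0 :=
    ae_restrict_of_ae_restrict_of_subset interior_subset h
  exact Measure.eqOn_open_of_ae_eq h1 isOpen_interior (continuous_ev p).continuousOn
    continuousOn_const

lemma eq_zero_of_integral_nonneg {p : Poly d} (h0 : ∀ x ∈ cell T, 0 ≤ ev p x)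
    (h : ∫ x, ev p x ∂(cellMeasure T) = 0) : p = 0 := by
  have h1 : 0 ≤ᵐ[cellMeasure T] ev p := by
    filter_upwards [ae_mem_cell T] with x hx using h0 x hx
  exact eq_zero_of_ae_cell T
    ((integral_eq_zero_iff_of_nonneg_ae h1 (integrable_cell T (continuous_ev p))).1 h)

/-- Continuity turns almost everywhere into everywhere on the relative interior of the face;
analyticity then propagates the zero to the whole hyperplane. -/
lemma ev_eq_zero_of_ae_face {p : Poly d} {i : Fin (d + 1)}
    (h : ∀ᵐ x ∂(faceMeasure T i), ev p x = 0) {x : Space d} (hx : lam T i x = 0) : ev p x = 0 := by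
  set φ : Hyp (normal T i) → Space d := fun w => T.altitudeFoot i + (w : Space d) with hφ
  have hφc : Continuous φ := by fun_prop
  rw [faceMeasure_eq_map, ae_restrict_iff' (isClosed_face T i).measurableSet,
    ae_map_iff hφc.measurable.aemeasurable] at h
  swap
  · exact (isClosed_face T i).measurableSet.imp ((measurableSet_singleton (0 : ℝ)).preimage (continuous_ev p).measurable)
  -- The relative interior of the face, in the coordinates of its hyperplane.
  set U : Set (Hyp (normal T i)) := {w | ∀ j, j ≠ i → 0 < lam T j (φ w)} with hU
  have hUo : IsOpen U := by
    simp only [hU, Set.ofPred_forall]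
    exact isOpen_iInter_of_finite fun j => isOpen_iInter_of_finite fun _ =>
      isOpen_lt continuous_const ((continuous_lam T j).comp hφc)
  have hrange := range_add_hyp T i
  have hφ0 : ∀ w, lam T i (φ w) = 0 := fun w => by
    have : φ w ∈ {x | lam T i x = 0} := hrange ▸ Set.mem_range_self w
    exact this
  have h2 : (fun w => ev p (φ w)) =ᵐ[volume.restrict U] fun _ => 0 := by
    rw [Filter.EventuallyEq, ae_restrict_iff' hUo.measurableSet]
    filter_upwards [h] with w hw hwU
    refine hw ((mem_face T).2 ⟨hφ0 w, fun j => ?_⟩)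
    by_cases hj : j = i
    · subst hj; exact (hφ0 w).ge
    · exact (hwU j hj).le
  have h3 := Measure.eqOn_open_of_ae_eq h2 hUo ((continuous_ev p).comp hφc).continuousOn
    continuousOn_const
  obtain ⟨y, hy0, hy⟩ := exists_pos_point T i
  obtain ⟨w₀, hw₀⟩ : y ∈ Set.range φ := by rw [hφ, hrange]; exact hy0
  have ha : AnalyticOnNhd ℝ (fun w => ev p (φ w)) Set.univ := by
    have := AnalyticOnNhd.aeval_mvPolynomial (𝕜 := ℝ) (A := ℝ) (f := fun w j => (φ w) j)
      (s := Set.univ) (fun j w _ => by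
        have h1 : AnalyticAt ℝ (fun w : Hyp (normal T i) => T.altitudeFoot i j +
          ((EuclideanSpace.proj j : Space d →L[ℝ] ℝ).comp (Hyp (normal T i)).subtypeL) w) w :=
          analyticAt_const.add (ContinuousLinearMap.analyticAt _ w)
        exact h1) p
    exact this
  have h4 := ha.eq_of_eventuallyEq analyticOnNhd_const (z₀ := w₀)
    (Filter.eventually_of_mem (hUo.mem_nhds (show w₀ ∈ U by intro j hj; rw [hw₀]; exact hy j hj))
      fun y hy => h3 hy)
  obtain ⟨w, rfl⟩ : x ∈ Set.range φ := by rw [hφ, hrange]; exact hx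
  exact congrFun h4 w

/-- The barycentric coordinate as a polynomial. -/
def lamPoly (i : Fin (d + 1)) : Poly d :=
  MvPolynomial.C (1 + (T.height i)⁻¹ * ⟪T.points i, normal T i⟫) -
    ∑ j, MvPolynomial.C ((T.height i)⁻¹ * normal T i j) * MvPolynomial.X j

@[simp] lemma ev_lamPoly (i : Fin (d + 1)) (x : Space d) : ev (lamPoly T i) x = lam T i x := by
  rw [lamPoly, lam, inner_sub_left, PiLp.inner_apply x]
  simp only [ev_sub, ev_C, ev_sum, ev_mul, ev_X, mul_assoc, ← Finset.mul_sum]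
  simp
  ring

lemma lamPoly_mem (i : Fin (d + 1)) : lamPoly T i ∈ polyDeg d 1 := by
  refine sub_mem (mem_polyDeg.2 (by rw [MvPolynomial.totalDegree_C]; omega)) (sum_mem fun j _ => mem_polyDeg.2 ?_)
  exact (MvPolynomial.totalDegree_mul _ _).trans
    (by rw [MvPolynomial.totalDegree_C, MvPolynomial.totalDegree_X])

lemma totalDegree_lamPoly (i : Fin (d + 1)) : 1 ≤ (lamPoly T i).totalDegree := by
  by_contra h
  have h1 := MvPolynomial.totalDegree_eq_zero_iff_eq_C.1 (show (lamPoly T i).totalDegree = 0 by omega)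
  obtain ⟨x, hx, -⟩ := exists_pos_point T i
  have h2 := ev_lamPoly T i x
  have h3 := ev_lamPoly T i (T.points i)
  rw [h1, ev_C] at h2 h3
  rw [lam_points, if_pos rfl] at h3
  linarith

lemma lamPoly_ne_zero (i : Fin (d + 1)) : lamPoly T i ≠ 0 := by
  intro h
  have := totalDegree_lamPoly T i
  simp [h] at this

lemma lamPoly_dvd {i : Fin (d + 1)} {p : Poly d} (h : ∀ x, lam T i x = 0 → ev p x = 0) :
    lamPoly T i ∣ p := by
  rw [← Ideal.mem_span_singleton, ← Ideal.Quotient.eq_zero_iff_mem]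
  set I := Ideal.span {lamPoly T i}
  -- The substitution x ↦ x + h λ(x) n is the orthogonal projection onto the hyperplane λ = 0, so it
  -- sends p to zero.
  set g : Fin d → Poly d := fun j => MvPolynomial.X j +
    MvPolynomial.C (T.height i * normal T i j) * lamPoly T i with hg
  have h1 : MvPolynomial.aeval g p = 0 := by
    refine eq_of_ev_eq fun x => ?_
    have h2 : ev (MvPolynomial.aeval g p) x =
        ev p (x + (T.height i * lam T i x) • normal T i) := by
      rw [ev_aeval]
      congr 1
      ext j
      simp [hg]
      ring
    rw [h2, ev_zero]
    refine h _ ?_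
    have := (T.height_pos i).ne'
    rw [lam_add, inner_smul_left, real_inner_self_eq_norm_sq, norm_normal]
    simp only [conj_trivial]
    field_simp
    ring
  -- Modulo λ the same substitution is the identity, so p is congruent to its image, which is zero.
  have h2 : (Ideal.Quotient.mkₐ ℝ I) = (Ideal.Quotient.mkₐ ℝ I).comp (MvPolynomial.aeval g) := by
    refine MvPolynomial.algHom_ext fun j => ?_
    have : Ideal.Quotient.mkₐ ℝ I (lamPoly T i) = 0 :=
      Ideal.Quotient.eq_zero_iff_mem.2 (Ideal.mem_span_singleton_self _)
    simp only [AlgHom.comp_apply, MvPolynomial.aeval_X, hg, map_add, map_mul, this]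
    simp
  have h3 := DFunLike.congr_fun h2 p
  rw [AlgHom.comp_apply, h1, map_zero] at h3
  exact h3

/-- The kernel of the restriction of ℙᵏ to a face; since λ has degree one, the cofactor loses one
degree. For k = 0 a nonzero p is excluded by degree. -/
lemma exists_eq_lamPoly_mul {i : Fin (d + 1)} {k : ℕ} {p : Poly d} (hp : p ∈ polyDeg d k)
    (h : ∀ᵐ x ∂(faceMeasure T i), ev p x = 0) : ∃ r ∈ polyDegPred d k, p = lamPoly T i * r := by
  by_cases hp0 : p = 0
  · exact ⟨0, zero_mem _, by simp [hp0]⟩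
  obtain ⟨r, rfl⟩ := lamPoly_dvd T fun x hx => ev_eq_zero_of_ae_face T h hx
  refine ⟨r, ?_, rfl⟩
  rw [mem_polyDeg, MvPolynomial.totalDegree_mul_of_isDomain (left_ne_zero_of_mul hp0)
    (right_ne_zero_of_mul hp0)] at hp
  have := totalDegree_lamPoly T i
  cases k with
  | zero => omega
  | succ k => exact mem_polyDeg.2 (by omega)

/-- A polynomial of degree at most `k` is determined by its values on a face and its moments
against polynomials of degree at most `k - 1`. -/
lemma eq_zero_of_face_of_moments {i : Fin (d + 1)} {k : ℕ} {p : Poly d} (hp : p ∈ polyDeg d k)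
    (h : ∀ᵐ x ∂(faceMeasure T i), ev p x = 0)
    (hm : ∀ r ∈ polyDegPred d k, ∫ x, ev p x * ev r x ∂(cellMeasure T) = 0) : p = 0 := by
  obtain ⟨r, hr, rfl⟩ := exists_eq_lamPoly_mul T hp h
  -- Testing p = λ r with r itself: λ r² is nonnegative on the simplex and has zero integral.
  have h1 : lamPoly T i * r * r = 0 := by
    refine eq_zero_of_integral_nonneg T (fun x hx => ?_) ?_
    · rw [mul_assoc, ev_mul, ev_mul, ev_lamPoly]
      exact mul_nonneg ((mem_cell T).1 hx i) (mul_self_nonneg _)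
    · simpa using hm r hr
  have h2 := lamPoly_ne_zero T i
  simp_all

/-- A translation by such an a changes no barycentric coordinate, and these determine the point. -/
lemma eq_zero_of_inner_normal {a : Space d} (h : ∀ i, ⟪a, normal T i⟫ = 0) : a = 0 := by
  have h1 := sum_lam_smul T (T.points 0 + a)
  simp_rw [lam_add, h, mul_zero, sub_zero] at h1
  rw [sum_lam_smul] at h1
  simpa using h1.symm

/-- Integration by parts for polynomials on a simplex. -/
lemma integral_parts (s : Fin d → Poly d) (u : Poly d) :
    ∑ i, ∫ x, (∑ j, ev (s j) x * normal T i j) * ev u x ∂(faceMeasure T i) =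
      (∫ x, (∑ j, evD (s j) j x) * ev u x ∂(cellMeasure T)) +
        ∫ x, ∑ j, ev (s j) x * evD u j x ∂(cellMeasure T) := by
  have h1 : ∀ j, ∫ x, evD (s j * u) j x ∂(cellMeasure T) =
      ∑ i, normal T i j * ∫ x, ev (s j) x * ev u x ∂(faceMeasure T i) := by
    intro j
    have := integral_cell_fderiv T (hasFDerivAt_ev (s j * u)) (by fun_prop) (EuclideanSpace.single j 1)
    simpa [Pi.single_apply, EuclideanSpace.inner_single_left] using this
  have h2 : ∀ i, ∫ x, (∑ j, ev (s j) x * normal T i j) * ev u x ∂(faceMeasure T i) =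
      ∑ j, normal T i j * ∫ x, ev (s j) x * ev u x ∂(faceMeasure T i) := by
    intro i
    simp_rw [Finset.sum_mul, ← integral_const_mul]
    rw [integral_finsetSum _ fun j _ => integrable_face T i (by fun_prop)]
    refine Finset.sum_congr rfl fun j _ => ?_
    congr 1; ext x; ring
  simp_rw [h2]
  rw [Finset.sum_comm]
  simp_rw [← h1, evD_mul]
  rw [← integral_add (integrable_cell T (by fun_prop)) (integrable_cell T (by fun_prop)),
    ← integral_finsetSum _ fun j _ => integrable_cell T (by fun_prop)]
  congr 1; ext x
  rw [Finset.sum_add_distrib, Finset.sum_mul]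

end

section

/-! ### Solvability of finite-dimensional variational problems -/

section Algebra

variable {X Y Z : Type*} [AddCommGroup X] [Module ℝ X] [AddCommGroup Y] [Module ℝ Y]
  [AddCommGroup Z] [Module ℝ Z] [FiniteDimensional ℝ X]

/-- The Fredholm alternative in finite dimension. -/
lemma exists_of_forall_null (A : X →ₗ[ℝ] Y →ₗ[ℝ] ℝ) (l : Y →ₗ[ℝ] ℝ)
    (h : ∀ y, (∀ x, A x y = 0) → l y = 0) : ∃ x, ∀ y, A x y = l y := by
  have h1 : l ∈ (LinearMap.range A).dualCoannihilator.dualAnnihilator := by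
    rw [Submodule.mem_dualAnnihilator]
    intro y hy
    rw [Submodule.mem_dualCoannihilator] at hy
    exact h y fun x => hy _ ⟨x, rfl⟩
  -- The range of `A` is finite-dimensional, hence equal to its double annihilator; `Y` itself may
  -- have infinite dimension.
  rw [Subspace.dualCoannihilator_dualAnnihilator_eq] at h1
  obtain ⟨x, hx⟩ := h1
  exact ⟨x, fun y => by rw [hx]⟩

/-- An injective system with redundant equations is solvable if the dimensions match and the data
are compatible with the redundant equations. -/
lemma exists_of_injective_of_finrank [FiniteDimensional ℝ Y] (A : X →ₗ[ℝ] Y →ₗ[ℝ] ℝ) (l : Y →ₗ[ℝ] ℝ) (J : Z →ₗ[ℝ] Y)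
    (hA : ∀ x, (∀ y, A x y = 0) → x = 0) (hJ : Function.Injective J)
    (hAJ : ∀ x z, A x (J z) = 0) (hl : ∀ z, l (J z) = 0)
    (hdim : Module.finrank ℝ X + Module.finrank ℝ Z = Module.finrank ℝ Y) :
    ∃ x, ∀ y, A x y = l y := by
  refine exists_of_forall_null A l fun y hy => ?_
  have h1 : LinearMap.range J ≤ LinearMap.ker A.flip := by
    rintro _ ⟨z, rfl⟩
    rw [LinearMap.mem_ker]
    ext x
    exact hAJ x z
  -- Injectivity of `A` means that the tests induce all functionals on `X`. So the null tests have
  -- dimension dim Y - dim X = dim Z and are exactly the range of `J`, where `l` vanishes.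
  have h2 : Function.Surjective A.flip := by
    intro φ
    obtain ⟨y, hy⟩ := exists_of_forall_null A.flip φ fun x hx => by
      rw [hA x hx, map_zero]
    exact ⟨y, LinearMap.ext hy⟩
  have h3 := LinearMap.finrank_range_add_finrank_ker A.flip
  rw [LinearMap.range_eq_top.2 h2, finrank_top, Subspace.dual_finrank_eq] at h3
  have h4 := LinearMap.finrank_range_of_inj hJ
  have h5 := Submodule.eq_of_le_of_finrank_eq h1 (by omega)
  have h6 : y ∈ LinearMap.ker A.flip := by
    rw [LinearMap.mem_ker]; ext x; exact hy x
  rw [← h5] at h6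
  obtain ⟨z, rfl⟩ := h6
  exact hl z

end Algebra

/-! ### Orthogonal projections onto polynomials -/

section Proj

variable {d : ℕ}

instance (k : ℕ) : FiniteDimensional ℝ (polyDeg d k) := by unfold polyDeg; infer_instance

instance (k : ℕ) : FiniteDimensional ℝ (polyDegPred d k) := by
  cases k <;> unfold polyDegPred <;> infer_instance

/-- Continuous functions are bounded almost everywhere. -/
def BoundsContinuous (m : Measure (Space d)) : Prop :=
  ∀ f : Space d → ℝ, Continuous f → MemLp f ⊤ m

variable {m : Measure (Space d)} [IsFiniteMeasure m] (hm : BoundsContinuous m)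
include hm

lemma BoundsContinuous.integrable {f : Space d → ℝ} (hf : Continuous f) : Integrable f m :=
  (hm f hf).integrable le_top

omit [IsFiniteMeasure m] in
lemma BoundsContinuous.integrable_mul {f g : Space d → ℝ} (hg : Integrable g m)
    (hf : Continuous f) : Integrable (fun x => g x * f x) m :=
  hg.mul_of_top_left (hm f hf)

lemma ae_eq_zero_of_integral_sq {p : Poly d} (h : ∫ x, ev p x * ev p x ∂m = 0) :
    ∀ᵐ x ∂m, ev p x = 0 := by
  have h1 := (integral_eq_zero_iff_of_nonneg (fun x => mul_self_nonneg (ev p x))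
    (hm.integrable (by fun_prop))).1 h
  filter_upwards [h1] with x hx
  simpa using hx

/-- The `L²(m)`-inner product of polynomials. -/
def pairing : Poly d →ₗ[ℝ] Poly d →ₗ[ℝ] ℝ := LinearMap.mk₂ ℝ
  (fun p q => ∫ x, ev p x * ev q x ∂m)
  (fun p p' q => by
    rw [← integral_add (hm.integrable (by fun_prop)) (hm.integrable (by fun_prop))]
    congr 1; ext x; simp; ring)
  (fun c p q => by rw [smul_eq_mul, ← integral_const_mul]; congr 1; ext x; simp; ring)
  (fun p q q' => by
    rw [← integral_add (hm.integrable (by fun_prop)) (hm.integrable (by fun_prop))]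
    congr 1; ext x; simp; ring)
  (fun c p q => by rw [smul_eq_mul, ← integral_const_mul]; congr 1; ext x; simp; ring)

lemma pairing_apply (p q : Poly d) : pairing hm p q = ∫ x, ev p x * ev q x ∂m := rfl

lemma pairing_comm (p q : Poly d) : pairing hm p q = pairing hm q p := by
  simp_rw [pairing_apply, mul_comm]

/-- The moments of an integrable function against polynomials. -/
def moment {g : Space d → ℝ} (hg : Integrable g m) : Poly d →ₗ[ℝ] ℝ where
  toFun := fun q => ∫ x, g x * ev q x ∂m
  map_add' := fun p q => by
    rw [← integral_add (hm.integrable_mul hg (by fun_prop)) (hm.integrable_mul hg (by fun_prop))]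
    congr 1; ext x; simp; ring
  map_smul' := fun c p => by
    rw [RingHom.id_apply, smul_eq_mul, ← integral_const_mul]; congr 1; ext x; simp; ring

omit [IsFiniteMeasure m] in
lemma moment_apply {g : Space d → ℝ} (hg : Integrable g m) (q : Poly d) :
    moment hm hg q = ∫ x, g x * ev q x ∂m := rfl

lemma pairing_eq_zero {p q : Poly d} (h : ∀ᵐ x ∂m, ev q x = 0) : pairing hm p q = 0 := by
  refine integral_eq_zero_of_ae ?_
  filter_upwards [h] with x hx
  simp [hx]

lemma pairing_congr {p p' q q' : Poly d} (h : ∀ᵐ x ∂m, ev p x = ev p' x)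
    (h' : ∀ᵐ x ∂m, ev q x = ev q' x) : pairing hm p q = pairing hm p' q' := by
  refine integral_congr_ae ?_
  filter_upwards [h, h'] with x hx hx'
  rw [hx, hx']

omit [IsFiniteMeasure m] in
lemma moment_eq_zero {g : Space d → ℝ} (hg : Integrable g m) {q : Poly d}
    (h : ∀ᵐ x ∂m, ev q x = 0) : moment hm hg q = 0 := by
  refine integral_eq_zero_of_ae ?_
  filter_upwards [h] with x hx
  simp [hx]

/-- For a face measure the pairing is degenerate on polynomials in d variables; its null vectors
vanish almost everywhere, hence have zero moments, and the Fredholm alternative still applies. -/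
lemma exists_isProj (k : ℕ) {g : Space d → ℝ} (hg : Integrable g m) : ∃ π, IsProj m k g π := by
  let ι := (polyDeg d k).subtype
  obtain ⟨π, hπ⟩ := exists_of_forall_null ((pairing hm).compl₁₂ ι ι) (moment hm hg ∘ₗ ι)
    fun q hq => moment_eq_zero hm hg (ae_eq_zero_of_integral_sq hm (hq q))
  refine ⟨π.1, π.2, fun q hq => ?_⟩
  have h2 : ∫ x, ev π.1 x * ev q x ∂m = ∫ x, g x * ev q x ∂m := hπ ⟨q, hq⟩
  simp_rw [sub_mul]
  rw [integral_sub (hm.integrable (by fun_prop)) (hm.integrable_mul hg (by fun_prop)), h2, sub_self]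

lemma isProj_proj (k : ℕ) {g : Space d → ℝ} (hg : Integrable g m) : IsProj m k g (proj m k g) :=
  Classical.epsilon_spec (exists_isProj hm k hg)

lemma proj_mem (k : ℕ) {g : Space d → ℝ} (hg : Integrable g m) : proj m k g ∈ polyDeg d k :=
  (isProj_proj hm k hg).1

lemma integral_sub_mul (p : Poly d) {g : Space d → ℝ} (hg : Integrable g m) (q : Poly d) :
    ∫ x, (ev p x - g x) * ev q x ∂m = pairing hm p q - moment hm hg q := by
  simp_rw [sub_mul]
  rw [integral_sub (hm.integrable (by fun_prop)) (hm.integrable_mul hg (by fun_prop))]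
  rfl

lemma integral_proj_mul {k : ℕ} {g : Space d → ℝ} (hg : Integrable g m) {q : Poly d}
    (hq : q ∈ polyDeg d k) : ∫ x, ev (proj m k g) x * ev q x ∂m = ∫ x, g x * ev q x ∂m := by
  have h := (isProj_proj hm k hg).2 q hq
  simp_rw [sub_mul] at h
  rwa [integral_sub (hm.integrable (by fun_prop)) (hm.integrable_mul hg (by fun_prop)),
    sub_eq_zero] at h

/-- The difference of two candidates is orthogonal to itself. Only almost everywhere equality can be
claimed, since on a face the representing polynomial is not unique. -/
lemma proj_ae_eq {k : ℕ} {g : Space d → ℝ} (hg : Integrable g m) {π : Poly d}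
    (hπ : π ∈ polyDeg d k) (h : ∀ q ∈ polyDeg d k, ∫ x, ev π x * ev q x ∂m = ∫ x, g x * ev q x ∂m) :
    ∀ᵐ x ∂m, ev (proj m k g) x = ev π x := by
  have h1 := sub_mem (proj_mem hm k hg) hπ
  have h2 : ∫ x, ev (proj m k g - π) x * ev (proj m k g - π) x ∂m = 0 := by
    have h3 := integral_proj_mul hm hg h1
    rw [← h _ h1, ← sub_eq_zero,
      ← integral_sub (hm.integrable (by fun_prop)) (hm.integrable (by fun_prop))] at h3
    rw [← h3]
    congr 1; ext x; simp; ring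
  filter_upwards [ae_eq_zero_of_integral_sq hm h2] with x hx
  rw [ev_sub] at hx
  linarith

lemma proj_ev_ae_eq {k : ℕ} {p : Poly d} (hp : p ∈ polyDeg d k) :
    ∀ᵐ x ∂m, ev (proj m k (ev p)) x = ev p x :=
  proj_ae_eq hm (hm.integrable (by fun_prop)) hp fun _ _ => rfl

-- An equality of polynomials, even on a face: functions equal almost everywhere define the same
-- predicate, from which `Classical.epsilon` makes the same choice.
omit hm [IsFiniteMeasure m] in
lemma proj_congr (k : ℕ) {g g' : Space d → ℝ} (h : g =ᵐ[m] g') : proj m k g = proj m k g' := by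
  have : IsProj m k g = IsProj m k g' := by
    funext π
    refine propext (and_congr_right fun _ => forall₂_congr fun q _ => ?_)
    rw [integral_congr_ae]
    filter_upwards [h] with x hx
    rw [hx]
  rw [proj, this, ← proj]

end Proj

variable {d : ℕ} [NeZero d] (T : Affine.Simplex ℝ (Space d) d)

lemma boundsContinuous_cell : BoundsContinuous (cellMeasure T) := fun _ hf => memLp_top_cell T hf

lemma boundsContinuous_face (i : Fin (d + 1)) : BoundsContinuous (faceMeasure T i) :=
  fun _ hf => memLp_top_face T i hf

lemma eq_of_ae_cell {p q : Poly d} (h : ∀ᵐ x ∂(cellMeasure T), ev p x = ev q x) : p = q := by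
  refine sub_eq_zero.1 (eq_zero_of_ae_cell T ?_)
  filter_upwards [h] with x hx
  rw [ev_sub, hx, sub_self]

lemma proj_cell_eq {k : ℕ} {p : Poly d} (hp : p ∈ polyDeg d k) :
    proj (cellMeasure T) k (ev p) = p :=
  eq_of_ae_cell T (proj_ev_ae_eq (boundsContinuous_cell T) hp)

/-- On the simplex, unlike on a face, almost everywhere equality of polynomials is equality, so the
projection is additive as a map into `Poly d`. -/
lemma proj_cell_add (k : ℕ) (p q : Poly d) : proj (cellMeasure T) k (ev (p + q)) =
    proj (cellMeasure T) k (ev p) + proj (cellMeasure T) k (ev q) := by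
  have hm := boundsContinuous_cell T
  have hi : ∀ p : Poly d, Integrable (ev p) (cellMeasure T) := fun p => hm.integrable (by fun_prop)
  refine eq_of_ae_cell T (proj_ae_eq hm (hi _)
    (add_mem (proj_mem hm k (hi p)) (proj_mem hm k (hi q))) fun r hr => ?_)
  simp_rw [ev_add, add_mul]
  rw [integral_add (hm.integrable (by fun_prop)) (hm.integrable (by fun_prop)),
    integral_add (hm.integrable (by fun_prop)) (hm.integrable (by fun_prop)),
    integral_proj_mul hm (hi p) hr, integral_proj_mul hm (hi q) hr]

lemma proj_cell_smul (k : ℕ) (c : ℝ) (p : Poly d) : proj (cellMeasure T) k (ev (c • p)) =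
    c • proj (cellMeasure T) k (ev p) := by
  have hm := boundsContinuous_cell T
  have hi : ∀ p : Poly d, Integrable (ev p) (cellMeasure T) := fun p => hm.integrable (by fun_prop)
  refine eq_of_ae_cell T (proj_ae_eq hm (hi _) (Submodule.smul_mem _ c (proj_mem hm k (hi p)))
    fun r hr => ?_)
  simp_rw [ev_smul, mul_assoc]
  rw [integral_const_mul, integral_const_mul, integral_proj_mul hm (hi p) hr]

/-! ### The potential reconstruction -/

lemma evD_eq_zero_of_integral {p : Poly d}
    (h : ∫ x, ∑ j, evD p j x * evD p j x ∂(cellMeasure T) = 0) (j : Fin d) :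
    MvPolynomial.pderiv j p = 0 := by
  have h1 : (∑ j, MvPolynomial.pderiv j p * MvPolynomial.pderiv j p) = 0 := by
    refine eq_zero_of_integral_nonneg T (fun x _ => ?_) ?_
    · rw [ev_sum]
      exact Finset.sum_nonneg fun j _ => by rw [ev_mul]; exact mul_self_nonneg _
    · rw [← h]; congr 1; ext x; simp [evD]
  refine eq_of_ev_eq fun x => ?_
  have h2 : ∑ j, ev (MvPolynomial.pderiv j p) x * ev (MvPolynomial.pderiv j p) x = 0 := by
    have := congrArg (fun q => ev q x) h1
    simpa using this
  have h3 := (Finset.sum_eq_zero_iff_of_nonneg fun j _ => mul_self_nonneg _).1 h2 j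
    (Finset.mem_univ j)
  simpa using h3

omit [NeZero d] in
lemma eq_C_of_pderiv_eq_zero {p : Poly d} (h : ∀ j, MvPolynomial.pderiv j p = 0) :
    ∃ c, p = MvPolynomial.C c := by
  refine ⟨ev p 0, eq_of_ev_eq fun x => ?_⟩
  rw [ev_C]
  have h1 : ∀ x, HasFDerivAt (ev p) (0 : Space d →L[ℝ] ℝ) x := fun x => by
    refine (hasFDerivAt_ev p x).congr_fderiv ?_
    simp [evD, h]
  exact is_const_of_fderiv_eq_zero (𝕜 := ℝ) (fun x => (h1 x).differentiableAt)
    (fun x => (h1 x).fderiv) x 0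

lemma integral_cell_one_ne_zero : ∫ _x, (1 : ℝ) ∂(cellMeasure T) ≠ 0 := by
  intro h
  have : (1 : Poly d) = 0 := eq_zero_of_integral_nonneg T (fun x _ => by simp) (by simpa using h)
  exact one_ne_zero this

lemma C_eq_zero_of_integral {c : ℝ} (h : ∫ x, ev (MvPolynomial.C c : Poly d) x ∂(cellMeasure T) = 0) :
    c = 0 := by
  simp only [ev_C] at h
  have h1 : ∫ _x, c ∂(cellMeasure T) = c * ∫ _x, (1 : ℝ) ∂(cellMeasure T) := by
    rw [← integral_const_mul]; simp
  rw [h1] at h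
  exact (mul_eq_zero.1 h).resolve_right (integral_cell_one_ne_zero T)

/-- The right-hand side of the equation of the potential reconstruction. -/
def reconRhs (vT : Poly d) (vF : Fin (d + 1) → Poly d) (w : Poly d) : ℝ :=
  (∫ x, ∑ j, evD vT j x * evD w j x ∂(cellMeasure T)) -
    ∑ i, ∫ x, (ev vT x - ev (vF i) x) * ∑ j, evD w j x * normal T i j ∂(faceMeasure T i)

lemma isRecon_iff {k : ℕ} {vT : Poly d} {vF : Fin (d + 1) → Poly d} {R : Poly d} :
    IsRecon T k vT vF R ↔ R ∈ polyDeg d (k + 1) ∧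
      (∀ w ∈ polyDeg d (k + 1), ∫ x, ∑ j, evD R j x * evD w j x ∂(cellMeasure T) =
        reconRhs T vT vF w) ∧ ∫ x, (ev R x - ev vT x) ∂(cellMeasure T) = 0 := Iff.rfl

lemma integral_grad_add (p q w : Poly d) :
    ∫ x, ∑ j, evD (p + q) j x * evD w j x ∂(cellMeasure T) =
      ∫ x, ∑ j, evD p j x * evD w j x ∂(cellMeasure T) +
        ∫ x, ∑ j, evD q j x * evD w j x ∂(cellMeasure T) := by
  rw [← integral_add (integrable_cell T (by fun_prop)) (integrable_cell T (by fun_prop))]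
  congr 1; ext x
  rw [← Finset.sum_add_distrib]
  exact Finset.sum_congr rfl fun j _ => by simp; ring

omit [NeZero d] in
lemma integral_grad_smul (c : ℝ) (p w : Poly d) :
    ∫ x, ∑ j, evD (c • p) j x * evD w j x ∂(cellMeasure T) =
      c * ∫ x, ∑ j, evD p j x * evD w j x ∂(cellMeasure T) := by
  rw [← integral_const_mul]
  congr 1; ext x
  rw [Finset.mul_sum]
  exact Finset.sum_congr rfl fun j _ => by simp; ring

omit [NeZero d] in
lemma integral_grad_comm (p w : Poly d) :
    ∫ x, ∑ j, evD p j x * evD w j x ∂(cellMeasure T) =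
      ∫ x, ∑ j, evD w j x * evD p j x ∂(cellMeasure T) := by
  simp_rw [mul_comm]

lemma reconRhs_add_right (vT : Poly d) (vF : Fin (d + 1) → Poly d) (w w' : Poly d) :
    reconRhs T vT vF (w + w') = reconRhs T vT vF w + reconRhs T vT vF w' := by
  simp only [reconRhs]
  rw [integral_grad_comm, integral_grad_add, integral_grad_comm T w, integral_grad_comm T w',
    sub_add_sub_comm, ← Finset.sum_add_distrib]
  congr 1
  refine Finset.sum_congr rfl fun i _ => ?_
  rw [← integral_add (integrable_face T i (by fun_prop)) (integrable_face T i (by fun_prop))]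
  congr 1; ext x
  rw [← mul_add, ← Finset.sum_add_distrib]
  simp [add_mul]

lemma reconRhs_smul_right (vT : Poly d) (vF : Fin (d + 1) → Poly d) (c : ℝ) (w : Poly d) :
    reconRhs T vT vF (c • w) = c * reconRhs T vT vF w := by
  simp only [reconRhs]
  rw [integral_grad_comm, integral_grad_smul, integral_grad_comm T w, mul_sub, Finset.mul_sum]
  congr 1
  refine Finset.sum_congr rfl fun i _ => ?_
  rw [← integral_const_mul]
  congr 1; ext x
  simp only [evD_smul, mul_assoc, ← Finset.mul_sum]
  ring

lemma reconRhs_add_left (vT vT' : Poly d) (vF vF' : Fin (d + 1) → Poly d) (w : Poly d) :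
    reconRhs T (vT + vT') (vF + vF') w = reconRhs T vT vF w + reconRhs T vT' vF' w := by
  simp only [reconRhs]
  rw [integral_grad_add, sub_add_sub_comm, ← Finset.sum_add_distrib]
  congr 1
  refine Finset.sum_congr rfl fun i _ => ?_
  rw [← integral_add (integrable_face T i (by fun_prop)) (integrable_face T i (by fun_prop))]
  congr 1; ext x
  rw [← add_mul]
  simp only [ev_add, Pi.add_apply]
  ring

lemma reconRhs_smul_left (c : ℝ) (vT : Poly d) (vF : Fin (d + 1) → Poly d) (w : Poly d) :
    reconRhs T (c • vT) (c • vF) w = c * reconRhs T vT vF w := by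
  simp only [reconRhs]
  rw [integral_grad_smul, mul_sub, Finset.mul_sum]
  congr 1
  refine Finset.sum_congr rfl fun i _ => ?_
  rw [← integral_const_mul]
  congr 1; ext x
  simp only [ev_smul, Pi.smul_apply]
  ring

/-- The gradient form is degenerate on constants only, and the right-hand side vanishes there, so
the Fredholm alternative gives a solution up to a constant. -/
lemma exists_isRecon (k : ℕ) (vT : Poly d) (vF : Fin (d + 1) → Poly d) :
    ∃ R, IsRecon T k vT vF R := by
  let A : polyDeg d (k + 1) →ₗ[ℝ] polyDeg d (k + 1) →ₗ[ℝ] ℝ := LinearMap.mk₂ ℝ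
    (fun p w => ∫ x, ∑ j, evD p.1 j x * evD w.1 j x ∂(cellMeasure T))
    (fun p q w => integral_grad_add T _ _ _) (fun c p w => integral_grad_smul T _ _ _)
    (fun w p q => by
      simp_rw [integral_grad_comm T w.1]; exact integral_grad_add T _ _ _)
    (fun c w p => by simp_rw [integral_grad_comm T w.1]; exact integral_grad_smul T _ _ _)
  let l : polyDeg d (k + 1) →ₗ[ℝ] ℝ :=
    { toFun := fun w => reconRhs T vT vF w.1
      map_add' := fun w w' => reconRhs_add_right T vT vF _ _
      map_smul' := fun c w => reconRhs_smul_right T vT vF _ _ }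
  obtain ⟨R, hR⟩ := exists_of_forall_null A l fun w hw => by
    have h1 := evD_eq_zero_of_integral T (hw w)
    change reconRhs T vT vF w.1 = 0
    simp [reconRhs, evD, h1]
  -- The constant that corrects the mean value.
  set c := (∫ _x, (1 : ℝ) ∂(cellMeasure T))⁻¹ * ∫ x, (ev vT x - ev R.1 x) ∂(cellMeasure T) with hc
  refine ⟨R.1 + MvPolynomial.C c, (isRecon_iff T).2 ⟨add_mem R.2 (mem_polyDeg.2 (by simp)),
    fun w hw => ?_, ?_⟩⟩
  · rw [integral_grad_add]
    have : ∫ x, ∑ j, evD (MvPolynomial.C c) j x * evD w j x ∂(cellMeasure T) = 0 := by simp [evD]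
    rw [this, add_zero]
    exact hR ⟨w, hw⟩
  · have h2 : ∀ x, ev (R.1 + MvPolynomial.C c) x - ev vT x =
        c * 1 - (ev vT x - ev R.1 x) := fun x => by simp; ring
    simp_rw [h2]
    rw [integral_sub (by simp) (integrable_cell T (by fun_prop)), integral_const_mul, hc,
      mul_right_comm, inv_mul_cancel₀ (integral_cell_one_ne_zero T), one_mul, sub_self]

lemma isRecon_recon (k : ℕ) (vT : Poly d) (vF : Fin (d + 1) → Poly d) :
    IsRecon T k vT vF (recon T k vT vF) := Classical.epsilon_spec (exists_isRecon T k vT vF)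

/-- The difference has zero gradient, hence is constant, and has zero mean. Uniqueness makes the
chosen `recon` linear in the pair of cell and face data. -/
lemma isRecon_unique {k : ℕ} {vT : Poly d} {vF : Fin (d + 1) → Poly d} {R R' : Poly d}
    (h : IsRecon T k vT vF R) (h' : IsRecon T k vT vF R') : R = R' := by
  rw [isRecon_iff] at h h'
  have hs := sub_mem h.1 h'.1
  have h1 : ∫ x, ∑ j, evD (R - R') j x * evD (R - R') j x ∂(cellMeasure T) = 0 := by
    have := integral_grad_add T (R - R') R' (R - R')
    rw [sub_add_cancel, h.2.1 _ hs, h'.2.1 _ hs] at this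
    linarith
  obtain ⟨c, hc⟩ := eq_C_of_pderiv_eq_zero (evD_eq_zero_of_integral T h1)
  have h2 : ∫ x, ev (MvPolynomial.C c : Poly d) x ∂(cellMeasure T) = 0 := by
    rw [← hc, ← sub_zero (0 : ℝ)]
    nth_rw 1 [← h.2.2]
    nth_rw 1 [← h'.2.2]
    rw [← integral_sub (integrable_cell T (by fun_prop)) (integrable_cell T (by fun_prop))]
    congr 1; ext x; simp
  rw [C_eq_zero_of_integral T h2, map_zero] at hc
  exact sub_eq_zero.1 hc

lemma recon_eq {k : ℕ} {vT : Poly d} {vF : Fin (d + 1) → Poly d} {R : Poly d}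
    (h : IsRecon T k vT vF R) : recon T k vT vF = R :=
  isRecon_unique T (isRecon_recon T k vT vF) h

lemma recon_add (k : ℕ) (vT vT' : Poly d) (vF vF' : Fin (d + 1) → Poly d) :
    recon T k (vT + vT') (vF + vF') = recon T k vT vF + recon T k vT' vF' := by
  have h := (isRecon_iff T).1 (isRecon_recon T k vT vF)
  have h' := (isRecon_iff T).1 (isRecon_recon T k vT' vF')
  refine recon_eq T ((isRecon_iff T).2 ⟨add_mem h.1 h'.1, fun w hw => ?_, ?_⟩)
  · rw [integral_grad_add, reconRhs_add_left, h.2.1 w hw, h'.2.1 w hw]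
  · rw [← add_zero (0 : ℝ)]
    nth_rw 1 [← h.2.2]
    nth_rw 1 [← h'.2.2]
    rw [← integral_add (integrable_cell T (by fun_prop)) (integrable_cell T (by fun_prop))]
    congr 1; ext x; simp; ring

lemma recon_smul (k : ℕ) (c : ℝ) (vT : Poly d) (vF : Fin (d + 1) → Poly d) :
    recon T k (c • vT) (c • vF) = c • recon T k vT vF := by
  have h := (isRecon_iff T).1 (isRecon_recon T k vT vF)
  refine recon_eq T ((isRecon_iff T).2 ⟨Submodule.smul_mem _ c h.1, fun w hw => ?_, ?_⟩)
  · rw [integral_grad_smul, reconRhs_smul_left, h.2.1 w hw]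
  · have h1 : ∀ x, ev (c • recon T k vT vF) x - ev (c • vT) x =
        c * (ev (recon T k vT vF) x - ev vT x) := fun x => by simp; ring
    simp_rw [h1]
    rw [integral_const_mul, h.2.2, mul_zero]

/-- The boundary term vanishes when the face data are the trace of the cell polynomial. This
polynomial consistency yields S(u, u|_∂T) = 0 in the equal-order case. -/
lemma recon_self {k : ℕ} {q : Poly d} (hq : q ∈ polyDeg d (k + 1)) :
    recon T k q (fun _ => q) = q :=
  recon_eq T ((isRecon_iff T).2 ⟨hq, fun w _ => by simp [reconRhs], by simp⟩)

/-- Face data enter only through their values on the faces, whatever polynomials represent them. -/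
lemma recon_eq_zero (k : ℕ) {μ : Fin (d + 1) → Poly d}
    (h : ∀ i, ∀ᵐ x ∂(faceMeasure T i), ev (μ i) x = 0) : recon T k 0 μ = 0 := by
  refine recon_eq T ((isRecon_iff T).2 ⟨zero_mem _, fun w _ => ?_, by simp⟩)
  have h1 : ∀ i, ∫ x, (ev 0 x - ev (μ i) x) * ∑ j, evD w j x * normal T i j ∂(faceMeasure T i) = 0 := by
    intro i
    refine integral_eq_zero_of_ae ?_
    filter_upwards [h i] with x hx
    simp [hx]
  simp only [reconRhs, h1]
  simp

/-- The reconstruction from a polynomial orthogonal to `ℙᵏ⁻¹` and zero boundary data is constant. -/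
lemma recon_eq_C {k : ℕ} {u : Poly d}
    (hm : ∀ r ∈ polyDegPred d k, ∫ x, ev u x * ev r x ∂(cellMeasure T) = 0) :
    ∃ c, recon T k u 0 = MvPolynomial.C c := by
  obtain ⟨h1, h2, -⟩ := (isRecon_iff T).1 (isRecon_recon T k u 0)
  set R := recon T k u 0
  refine eq_C_of_pderiv_eq_zero (evD_eq_zero_of_integral T ?_)
  -- Green's formula: (∇R·n, u)_∂T = (ΔR, u)_T + (∇R, ∇u)_T, with ΔR in ℙᵏ⁻¹. Inserted in the
  -- equation of R tested with R, it gives ∇R = 0.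
  have h3 := integral_parts T (fun j => MvPolynomial.pderiv j R) u
  have h4 : ∫ x, (∑ j, evD (MvPolynomial.pderiv j R) j x) * ev u x ∂(cellMeasure T) = 0 := by
    have := hm (∑ j, MvPolynomial.pderiv j (MvPolynomial.pderiv j R))
      (sum_mem fun j _ => pderiv_mem (pderiv_mem' h1 j) j)
    rw [← this]
    congr 1; ext x
    rw [mul_comm, ev_sum]; rfl
  rw [h4, zero_add] at h3
  rw [h2 R h1, reconRhs]
  have h5 : ∀ i, ∫ x, (ev u x - ev ((0 : Fin (d + 1) → Poly d) i) x) *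
      ∑ j, evD R j x * normal T i j ∂(faceMeasure T i) =
      ∫ x, (∑ j, ev (MvPolynomial.pderiv j R) x * normal T i j) * ev u x ∂(faceMeasure T i) := by
    intro i
    congr 1; ext x
    rw [Pi.zero_apply, ev_zero, sub_zero, mul_comm]; rfl
  simp_rw [h5]
  rw [h3, sub_eq_zero]
  congr 1; ext x
  exact Finset.sum_congr rfl fun j _ => mul_comm _ _

end

section

variable {d : ℕ} [NeZero d] (T : Affine.Simplex ℝ (Space d) d)

/-! ### The stabilization -/

/-- The `L²`-inner product of polynomials on the simplex. -/
abbrev cellPair : Poly d →ₗ[ℝ] Poly d →ₗ[ℝ] ℝ := pairing (boundsContinuous_cell T)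

/-- The `L²`-inner product of polynomials on a face. -/
abbrev facePair (i : Fin (d + 1)) : Poly d →ₗ[ℝ] Poly d →ₗ[ℝ] ℝ :=
  pairing (boundsContinuous_face T i)

/-- The projection of a polynomial onto polynomials of degree at most `k` on a face. -/
abbrev faceProj (i : Fin (d + 1)) (k : ℕ) (p : Poly d) : Poly d := proj (faceMeasure T i) k (ev p)

/-- The polynomial whose projection on a face is the stabilization. -/
def stabPoly (k k' : ℕ) (x : Poly d × (Fin (d + 1) → Poly d)) (i : Fin (d + 1)) : Poly d :=
  if k' = k then
    x.1 - x.2 i + (recon T k x.1 x.2 - proj (cellMeasure T) k (ev (recon T k x.1 x.2)))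
  else x.1 - x.2 i

lemma stab_eq (k k' : ℕ) (vT : Poly d) (vF : Fin (d + 1) → Poly d) (i : Fin (d + 1)) :
    stab T k k' vT vF i = faceProj T i k (stabPoly T k k' (vT, vF) i) := by
  rw [stab, stabPoly]
  split_ifs
  · rw [stabEO, faceProj]; congr 1; ext x; simp
  · rw [stabMO, faceProj]; congr 1; ext x; simp

lemma stabPoly_add (k k' : ℕ) (x y : Poly d × (Fin (d + 1) → Poly d)) (i : Fin (d + 1)) :
    stabPoly T k k' (x + y) i = stabPoly T k k' x i + stabPoly T k k' y i := by
  simp only [stabPoly, Prod.fst_add, Prod.snd_add, Pi.add_apply, recon_add, proj_cell_add]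
  split_ifs <;> ring

lemma stabPoly_smul (k k' : ℕ) (c : ℝ) (x : Poly d × (Fin (d + 1) → Poly d)) (i : Fin (d + 1)) :
    stabPoly T k k' (c • x) i = c • stabPoly T k k' x i := by
  simp only [stabPoly, Prod.smul_fst, Prod.smul_snd, Pi.smul_apply, recon_smul, proj_cell_smul]
  split_ifs
  · rw [smul_add, smul_sub, smul_sub]
  · rw [smul_sub]

lemma faceProj_mem (i : Fin (d + 1)) (k : ℕ) (p : Poly d) : faceProj T i k p ∈ polyDeg d k :=
  proj_mem (boundsContinuous_face T i) k (integrable_face T i (by fun_prop))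

lemma facePair_faceProj {i : Fin (d + 1)} {k : ℕ} (p : Poly d) {q : Poly d} (hq : q ∈ polyDeg d k) :
    facePair T i (faceProj T i k p) q = facePair T i p q :=
  integral_proj_mul (boundsContinuous_face T i) (integrable_face T i (by fun_prop)) hq

/-- The stabilization as a bilinear form. -/
def stabForm (k k' : ℕ) : (Poly d × (Fin (d + 1) → Poly d)) →ₗ[ℝ]
    (Poly d × (Fin (d + 1) → Poly d)) →ₗ[ℝ] ℝ := by
  -- By orthogonality either one of the two projections can be dropped. Bilinearity then follows
  -- from that of the pairing, without linearity of the chosen face projections, which holds only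
  -- almost everywhere.
  have h1 : ∀ i (p q : Poly d), facePair T i (faceProj T i k p) (faceProj T i k q) =
      facePair T i p (faceProj T i k q) := fun i p q => facePair_faceProj T p (faceProj_mem T i k q)
  have h2 : ∀ i (p q : Poly d), facePair T i (faceProj T i k p) (faceProj T i k q) =
      facePair T i (faceProj T i k p) q := fun i p q => by
    rw [pairing_comm, h1, pairing_comm]
  exact LinearMap.mk₂ ℝ (fun x y => ∑ i, facePair T i (faceProj T i k (stabPoly T k k' x i))
      (faceProj T i k (stabPoly T k k' y i)))
    (fun x x' y => by simp [h1, stabPoly_add, Finset.sum_add_distrib])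
    (fun c x y => by simp [h1, stabPoly_smul, Finset.mul_sum])
    (fun x y y' => by simp [h2, stabPoly_add, Finset.sum_add_distrib])
    (fun c x y => by simp [h2, stabPoly_smul, Finset.mul_sum])

lemma stabForm_apply (k k' : ℕ) (x y : Poly d × (Fin (d + 1) → Poly d)) :
    stabForm T k k' x y = ∑ i, facePair T i (faceProj T i k (stabPoly T k k' x i))
      (faceProj T i k (stabPoly T k k' y i)) := rfl

lemma sum_integral_stab (k k' : ℕ) (vT wT : Poly d) (vF wF : Fin (d + 1) → Poly d) :
    ∑ i, ∫ x, ev (stab T k k' vT vF i) x * ev (stab T k k' wT wF i) x ∂(faceMeasure T i) =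
      stabForm T k k' (vT, vF) (wT, wF) := by
  simp_rw [stab_eq]; rfl

lemma faceProj_ae_zero {i : Fin (d + 1)} (k : ℕ) {p : Poly d}
    (h : ∀ᵐ x ∂(faceMeasure T i), ev p x = 0) :
    ∀ᵐ x ∂(faceMeasure T i), ev (faceProj T i k p) x = 0 := by
  have h1 := proj_ae_eq (boundsContinuous_face T i) (k := k) (integrable_face T i (continuous_ev p))
    (zero_mem _) fun q _ => by
      refine integral_congr_ae ?_
      filter_upwards [h] with x hx
      rw [hx, ev_zero]
  filter_upwards [h1] with x hx
  rw [hx, ev_zero]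

/-- Makes the face tests λ_F r invisible to the stabilization. -/
lemma stabForm_eq_zero (k k' : ℕ) (x : Poly d × (Fin (d + 1) → Poly d)) {μ : Fin (d + 1) → Poly d}
    (h : ∀ i, ∀ᵐ x ∂(faceMeasure T i), ev (μ i) x = 0) : stabForm T k k' x (0, μ) = 0 := by
  rw [stabForm_apply]
  refine Finset.sum_eq_zero fun i _ => pairing_eq_zero _ (faceProj_ae_zero T k ?_)
  filter_upwards [h i] with y hy
  have h0 : proj (cellMeasure T) k (ev (0 : Poly d)) = 0 := proj_cell_eq T (zero_mem _)
  rw [stabPoly, recon_eq_zero T k h, h0]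
  simp [hy]

lemma ae_eq_zero_of_stabForm {k k' : ℕ} {x : Poly d × (Fin (d + 1) → Poly d)}
    (h : stabForm T k k' x x = 0) (i : Fin (d + 1)) :
    ∀ᵐ y ∂(faceMeasure T i), ev (faceProj T i k (stabPoly T k k' x i)) y = 0 := by
  rw [stabForm_apply, Finset.sum_eq_zero_iff_of_nonneg
    fun i _ => integral_nonneg fun x => mul_self_nonneg _] at h
  exact ae_eq_zero_of_integral_sq (boundsContinuous_face T i) (h i (Finset.mem_univ i))

/-! ### Unique solvability of the homogeneous system -/

/-- The normal component of a polynomial vector field on a face. -/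
def normalPart (s : Fin d → Poly d) (i : Fin (d + 1)) : Poly d := ∑ j, normal T i j • s j

lemma normalPart_mem {k : ℕ} {s : Fin d → Poly d} (hs : ∀ j, s j ∈ polyDeg d k) (i : Fin (d + 1)) :
    normalPart T s i ∈ polyDeg d k := sum_mem fun j _ => Submodule.smul_mem _ _ (hs j)

lemma sum_facePair_normalPart (s : Fin d → Poly d) (u : Poly d) :
    ∑ i, facePair T i (normalPart T s i) u =
      cellPair T (∑ j, MvPolynomial.pderiv j (s j)) u +
        ∑ j, cellPair T (s j) (MvPolynomial.pderiv j u) := by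
  have h := integral_parts T s u
  rw [integral_finsetSum _ fun j _ => integrable_cell T (by fun_prop)] at h
  convert h using 1
  · refine Finset.sum_congr rfl fun i _ => ?_
    rw [pairing_apply]
    congr 1; ext x
    simp [normalPart, mul_comm]
  · congr 1
    rw [pairing_apply]
    congr 1; ext x
    simp [evD]

/-- As n_F is constant, s·n_F is a polynomial of degree at most k on all of T that inherits the
orthogonality of s; vanishing on F, it is zero. The normals of all faces together determine s. -/
lemma eq_zero_of_normalPart {k : ℕ} {s : Fin d → Poly d} (hs : ∀ j, s j ∈ polyDeg d k)
    (hm : ∀ j, ∀ r ∈ polyDegPred d k, cellPair T (s j) r = 0)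
    (h : ∀ i, facePair T i (normalPart T s i) (normalPart T s i) = 0) : s = 0 := by
  have h1 : ∀ i, normalPart T s i = 0 := fun i => by
    refine eq_zero_of_face_of_moments T (normalPart_mem T hs i)
      (ae_eq_zero_of_integral_sq (boundsContinuous_face T i) (h i)) fun r hr => ?_
    change cellPair T (normalPart T s i) r = 0
    simp [normalPart, hm _ r hr]
  funext j
  refine eq_of_ev_eq fun x => ?_
  have h2 : (WithLp.toLp 2 fun j => ev (s j) x : Space d) = 0 := by
    refine eq_zero_of_inner_normal T fun i => ?_
    have := congrArg (fun p => ev p x) (h1 i)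
    simp only [normalPart, ev_sum, ev_smul, ev_zero] at this
    rw [PiLp.inner_apply]
    simpa using this
  have := congrArg (fun y : Space d => y j) h2
  simpa using this

/-- The homogeneous system has only the trivial solution. -/
lemma eq_zero_of_homogeneous {k k' : ℕ} (hk : k' = k ∨ k' = k + 1) {τ : ℝ} (hτ : 0 < τ)
    {s : Fin d → Poly d} {u : Poly d} (hs : ∀ j, s j ∈ polyDeg d k) (hu : u ∈ polyDeg d k')
    (ha : ∀ w ∈ polyDegPred d k, cellPair T u w = 0)
    (hb : ∀ j, ∀ w ∈ polyDegPred d k, cellPair T (s j) w = 0)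
    (hc : ∀ μ : Fin (d + 1) → Poly d, (∀ i, μ i ∈ polyDeg d k) →
      ∑ i, facePair T i (normalPart T s i) (μ i) + τ * stabForm T k k' (u, 0) (0, μ) = 0)
    (hd : ∑ j, cellPair T (s j) (MvPolynomial.pderiv j u) = 0) : s = 0 ∧ u = 0 := by
  -- The energy argument: (s·n, u)_∂T = (div s, u)_T + (s, ∇u)_T, where div s lies in ℙᵏ⁻¹.
  have hen : ∑ i, facePair T i (normalPart T s i) u = 0 := by
    rw [sum_facePair_normalPart, hd, add_zero, pairing_comm]
    exact ha _ (sum_mem fun j _ => pderiv_mem (hs j) j)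
  -- Once the stabilization drops out, (c) can be tested with μ = s·n.
  have hsn : (∀ μ, stabForm T k k' (u, 0) (0, μ) = 0) → s = 0 := fun h => by
    have h1 := hc _ (normalPart_mem T hs)
    rw [h, mul_zero, add_zero, Finset.sum_eq_zero_iff_of_nonneg
      fun i _ => integral_nonneg fun x => mul_self_nonneg _] at h1
    exact eq_zero_of_normalPart T hs hb fun i => h1 i (Finset.mem_univ i)
  rcases hk with rfl | rfl
  -- Equal order: S(u, u|_∂T) = 0 turns S(u, 0) into -S(0, u|_∂T), so that testing (c) with μ = u
  -- leaves a square.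
  · have h0 : ∀ y, stabForm T k' k' (u, fun _ => u) y = 0 := fun y => by
      have h1 : ∀ i, stabPoly T k' k' (u, fun _ => u) i = 0 := fun i => by
        simp [stabPoly, recon_self T (polyDeg_mono k'.le_succ hu), proj_cell_eq T hu]
      rw [stabForm_apply]
      refine Finset.sum_eq_zero fun i _ => ?_
      rw [pairing_comm]
      refine pairing_eq_zero _ (faceProj_ae_zero T k' ?_)
      simp [h1]
    have h1 : ∀ y, stabForm T k' k' (u, 0) y = - stabForm T k' k' (0, fun _ => u) y := fun y => by
      have h2 : ((u, 0) : Poly d × (Fin (d + 1) → Poly d)) =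
        (u, fun _ => u) - (0, fun _ => u) := by ext <;> simp
      rw [h2, map_sub, LinearMap.sub_apply, h0, zero_sub]
    have h2 := hc (fun _ => u) fun _ => hu
    rw [hen, zero_add, h1, mul_eq_zero, neg_eq_zero] at h2
    have h3 := ae_eq_zero_of_stabForm T (h2.resolve_left hτ.ne')
    have h4 : ∀ y, stabForm T k' k' (u, 0) y = 0 := fun y => by
      rw [h1, neg_eq_zero, stabForm_apply]
      refine Finset.sum_eq_zero fun i _ => ?_
      rw [pairing_comm]
      exact pairing_eq_zero _ (h3 i)
    refine ⟨hsn fun μ => h4 _, ?_⟩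
    have h5 := ae_eq_zero_of_stabForm T (h4 (u, 0)) 0
    -- A constant is removed by 1 - Π_T, so S(u, 0) is just the trace of u.
    obtain ⟨c, hc⟩ := recon_eq_C T ha
    have h6 : stabPoly T k' k' (u, 0) 0 = u := by
      have : MvPolynomial.C c ∈ polyDeg d k' := mem_polyDeg.2 (by simp)
      simp [stabPoly, hc, proj_cell_eq T this]
    rw [h6] at h5
    refine eq_zero_of_face_of_moments T (i := 0) hu ?_ ha
    filter_upwards [h5, proj_ev_ae_eq (boundsContinuous_face T 0) hu] with x hx hx'
    rw [← hx', hx]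
  · have hne : ¬ k + 1 = k := by omega
    -- Mixed order: S(0, μ) = -μ on the faces, so the stabilization term is -(Π_∂T u, μ)_∂T.
    have h1 : ∀ μ : Fin (d + 1) → Poly d, (∀ i, μ i ∈ polyDeg d k) →
        stabForm T k (k + 1) (u, 0) (0, μ) = - ∑ i, facePair T i (faceProj T i k u) (μ i) := by
      intro μ hμ
      rw [stabForm_apply, ← Finset.sum_neg_distrib]
      refine Finset.sum_congr rfl fun i _ => ?_
      have h2 : stabPoly T k (k + 1) (u, 0) i = u := by simp [stabPoly]
      have h3 : stabPoly T k (k + 1) (0, μ) i = - μ i := by simp [stabPoly]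
      rw [h2, h3, ← map_neg]
      exact pairing_congr _ (Eventually.of_forall fun _ => rfl)
        (proj_ev_ae_eq (boundsContinuous_face T i) (neg_mem (hμ i)))
    -- The test μ = Π_∂T u leaves a square, since s·n does not distinguish u from its projection.
    have h2 := hc (fun i => faceProj T i k u) fun i => faceProj_mem T i k u
    have h3 : ∀ i, facePair T i (normalPart T s i) (faceProj T i k u) =
        facePair T i (normalPart T s i) u := fun i => by
      rw [pairing_comm, facePair_faceProj T u (normalPart_mem T hs i), pairing_comm]
    simp_rw [h3] at h2
    rw [hen, zero_add, h1 _ fun i => faceProj_mem T i k u, mul_eq_zero, neg_eq_zero,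
      Finset.sum_eq_zero_iff_of_nonneg
      fun i _ => integral_nonneg fun x => mul_self_nonneg _] at h2
    have h4 : ∀ i, ∀ᵐ x ∂(faceMeasure T i), ev (faceProj T i k u) x = 0 := fun i =>
      ae_eq_zero_of_integral_sq (boundsContinuous_face T i)
        (h2.resolve_left hτ.ne' i (Finset.mem_univ i))
    refine ⟨hsn fun μ => ?_, ?_⟩
    · rw [stabForm_apply]
      refine Finset.sum_eq_zero fun i _ => ?_
      rw [pairing_comm]
      refine pairing_eq_zero _ ?_
      simpa [stabPoly] using h4 i
    · have h5 : ∀ i, ∀ q ∈ polyDeg d k, facePair T i u q = 0 := fun i q hq => by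
        rw [← facePair_faceProj T u hq, pairing_comm]
        exact pairing_eq_zero _ (h4 i)
      -- Green's formula for ∇u: the volume term has Δu in ℙᵏ⁻¹, orthogonal to u, and the boundary
      -- term pairs u with ∇u·n in ℙᵏ, where Π_∂T u = 0. Hence ∇u = 0.
      have h6 := sum_facePair_normalPart T (fun j => MvPolynomial.pderiv j u) u
      rw [pairing_comm (boundsContinuous_cell T), ha _ (sum_mem fun j _ => pderiv_mem (pderiv_mem' hu j) j),
        zero_add, Finset.sum_eq_zero fun i _ => by
          rw [pairing_comm]
          exact h5 i _ (normalPart_mem T (fun j => pderiv_mem' hu j) i)] at h6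
      obtain ⟨c, rfl⟩ := eq_C_of_pderiv_eq_zero (evD_eq_zero_of_integral (p := u) T (by
        rw [h6, integral_finsetSum _ fun j _ => integrable_cell T (by fun_prop)]; rfl))
      have h7 : ∀ᵐ x ∂(faceMeasure T 0), ev (MvPolynomial.C c : Poly d) x = 0 :=
        ae_eq_zero_of_integral_sq (boundsContinuous_face T 0) (h5 0 _ (mem_polyDeg.2 (by simp)))
      obtain ⟨x, hx, -⟩ := exists_pos_point T 0
      have h8 := ev_eq_zero_of_ae_face T h7 hx
      rw [ev_C] at h8
      rw [h8, map_zero]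

end

section

variable {d : ℕ} [NeZero d] (T : Affine.Simplex ℝ (Space d) d)

/-! ### The local system as a variational problem -/

/-- The space of unknowns of the local system. -/
abbrev Unknowns (d k k' : ℕ) := (Fin d → polyDeg d k) × polyDeg d k'

/-- The space of test polynomials of the local system. -/
abbrev Tests (d k k' : ℕ) :=
  polyDegPred d k × (Fin d → polyDegPred d k) × (Fin (d + 1) → polyDeg d k) × polyDeg d k'

/-- Polynomials on the simplex, extended by zero to the faces. -/
def inCell (d k : ℕ) : polyDeg d k →ₗ[ℝ] Poly d × (Fin (d + 1) → Poly d) where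
  toFun u := (u.1, 0)
  map_add' u u' := by ext <;> simp
  map_smul' c u := by ext <;> simp

/-- Polynomials on the faces, extended by zero to the simplex. -/
def inFaces (d k : ℕ) : (Fin (d + 1) → polyDeg d k) →ₗ[ℝ] Poly d × (Fin (d + 1) → Poly d) where
  toFun μ := (0, fun i => (μ i).1)
  map_add' μ μ' := by ext <;> simp
  map_smul' c μ := by ext <;> simp

/-- The left-hand side of the local system. -/
def systemForm (τ : ℝ) (k k' : ℕ) : Unknowns d k k' →ₗ[ℝ] Tests d k k' →ₗ[ℝ] ℝ :=
  LinearMap.mk₂ ℝ (fun x y => cellPair T x.2.1 y.1.1 + ∑ j, cellPair T (x.1 j).1 (y.2.1 j).1 +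
      (∑ i, facePair T i (normalPart T (fun j => (x.1 j).1) i) (y.2.2.1 i).1 +
        τ * stabForm T k k' (inCell d k' x.2) (inFaces d k y.2.2.1)) +
      ∑ j, cellPair T (x.1 j).1 (MvPolynomial.pderiv j y.2.2.2.1))
    (fun x x' y => by
      simp [normalPart, Finset.sum_add_distrib, mul_add]
      ring)
    (fun c x y => by
      simp [normalPart, Finset.mul_sum, mul_add]
      simp [mul_left_comm])
    (fun x y y' => by
      simp [Finset.sum_add_distrib, mul_add]
      ring)
    (fun c x y => by
      simp [Finset.mul_sum, mul_add]
      simp [mul_left_comm])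

lemma systemForm_apply (τ : ℝ) (k k' : ℕ) (x : Unknowns d k k') (y : Tests d k k') :
    systemForm T τ k k' x y = cellPair T x.2.1 y.1.1 + ∑ j, cellPair T (x.1 j).1 (y.2.1 j).1 +
      (∑ i, facePair T i (normalPart T (fun j => (x.1 j).1) i) (y.2.2.1 i).1 +
        τ * stabForm T k k' (x.2.1, 0) (0, fun i => (y.2.2.1 i).1)) +
      ∑ j, cellPair T (x.1 j).1 (MvPolynomial.pderiv j y.2.2.2.1) := rfl

/-- Each homogeneous equation is recovered from a test tuple supported in one component. The
gradient equation is used only with the unknown u itself as its test. -/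
lemma systemForm_injective {τ : ℝ} (hτ : 0 < τ) {k k' : ℕ} (hk : k' = k ∨ k' = k + 1)
    (x : Unknowns d k k') (h : ∀ y, systemForm T τ k k' x y = 0) : x = 0 := by
  have h0 : ((0, fun _ => 0) : Poly d × (Fin (d + 1) → Poly d)) = 0 := rfl
  simp_rw [systemForm_apply] at h
  have h1 := eq_zero_of_homogeneous T hk hτ (s := fun j => (x.1 j).1) (u := x.2.1)
    (fun j => (x.1 j).2) x.2.2 (fun w hw => by simpa [h0] using h (⟨w, hw⟩, 0, 0, 0))
    (fun j w hw => by
      have := h (0, Pi.single j ⟨w, hw⟩, 0, 0)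
      rw [Finset.sum_eq_single j] at this
      · simpa [h0] using this
      · intro i _ hi; simp [Pi.single_eq_of_ne hi]
      · simp)
    (fun μ hμ => by simpa [h0] using h (0, 0, fun i => ⟨μ i, hμ i⟩, 0))
    (by simpa [h0] using h (0, 0, 0, x.2))
  exact Prod.ext (funext fun j => Subtype.ext (congrFun h1.1 j)) (Subtype.ext h1.2)

/-- The redundant test polynomials of the local system. -/
def redundant {k k' : ℕ} (hk : k ≤ k') :
    (polyDeg d k × (Fin (d + 1) → polyDegPred d k)) →ₗ[ℝ] Tests d k k' where
  -- For q in ℙᵏ the moment test -∇q cancels the gradient test q; the face tests λ_F r vanish on F.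
  toFun z := (0, fun j => ⟨-MvPolynomial.pderiv j z.1.1, neg_mem (pderiv_mem z.1.2 j)⟩,
    fun i => ⟨lamPoly T i * (z.2 i).1, mul_mem_polyDeg (lamPoly_mem T i) (z.2 i).2⟩,
    ⟨z.1.1, polyDeg_mono hk z.1.2⟩)
  map_add' z z' := by ext <;> simp [mul_add]; ring
  map_smul' c z := by ext <;> simp

lemma redundant_injective {k k' : ℕ} (hk : k ≤ k') :
    Function.Injective (redundant T hk) := by
  rw [← LinearMap.ker_eq_bot, LinearMap.ker_eq_bot']
  intro z hz
  simp only [redundant, LinearMap.coe_mk, AddHom.coe_mk, Prod.ext_iff, funext_iff,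
    Subtype.ext_iff] at hz
  obtain ⟨-, -, h2, h3⟩ := hz
  have h4 : ∀ i, (z.2 i).1 = 0 := fun i => (mul_eq_zero.1 (h2 i)).resolve_left (lamPoly_ne_zero T i)
  refine Prod.ext (Subtype.ext h3) (funext fun i => Subtype.ext (h4 i))

-- Both sides consist of d + 1 copies of ℙᵏ, d + 1 copies of ℙᵏ⁻¹ and one of ℙᵏ', so no dimension
-- formula is needed.
omit [NeZero d] in
lemma finrank_tests (k k' : ℕ) : Module.finrank ℝ (Unknowns d k k') +
    Module.finrank ℝ (polyDeg d k × (Fin (d + 1) → polyDegPred d k)) =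
      Module.finrank ℝ (Tests d k k') := by
  simp only [Module.finrank_prod, Module.finrank_pi_fintype, Finset.sum_const, Finset.card_univ,
    Fintype.card_fin, smul_eq_mul]
  ring

lemma ae_lamPoly_mul (i : Fin (d + 1)) (r : Poly d) :
    ∀ᵐ x ∂(faceMeasure T i), ev (lamPoly T i * r) x = 0 := by
  filter_upwards [ae_mem_face T i] with x hx
  rw [ev_mul, ev_lamPoly, ((mem_face T).1 hx).1, zero_mul]

lemma systemForm_redundant (τ : ℝ) {k k' : ℕ} (hk : k ≤ k') (x : Unknowns d k k')
    (z : polyDeg d k × (Fin (d + 1) → polyDegPred d k)) :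
    systemForm T τ k k' x (redundant T hk z) = 0 := by
  rw [systemForm_apply]
  simp only [redundant, LinearMap.coe_mk, AddHom.coe_mk]
  rw [stabForm_eq_zero T k k' _ fun i => ae_lamPoly_mul T i _,
    Finset.sum_eq_zero fun i _ => pairing_eq_zero (boundsContinuous_face T i) (ae_lamPoly_mul T i _)]
  simp

/-! ### The right-hand side, and the equivalence with the interpolation conditions -/

section Data

variable {σ : Fin d → Space d → ℝ} {v : Space d → ℝ}
  {γσ : Fin (d + 1) → Fin d → Space d → ℝ} {γv : Fin (d + 1) → Space d → ℝ}
  (hσ : ∀ j, Integrable (σ j) (cellMeasure T)) (hv : Integrable v (cellMeasure T))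
  (hγσ : ∀ i j, Integrable (γσ i j) (faceMeasure T i))

/-- The right-hand side of the local system. -/
def systemRhs (τ : ℝ) (k k' : ℕ) (g : Fin (d + 1) → Poly d) : Tests d k k' →ₗ[ℝ] ℝ where
  toFun y := moment (boundsContinuous_cell T) hv y.1.1 +
    ∑ j, moment (boundsContinuous_cell T) (hσ j) (y.2.1 j).1 +
    (∑ i, ∑ j, normal T i j * moment (boundsContinuous_face T i) (hγσ i j) (y.2.2.1 i).1 -
      τ * stabForm T k k' (0, g) (inFaces d k y.2.2.1)) +
    (∑ j, moment (boundsContinuous_cell T) (hσ j) (MvPolynomial.pderiv j y.2.2.2.1) +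
      ∑ i, ∑ j, normal T i j * (facePair T i (proj (faceMeasure T i) k (γσ i j)) y.2.2.2.1 -
        moment (boundsContinuous_face T i) (hγσ i j) y.2.2.2.1))
  map_add' y y' := by
    simp [Finset.sum_add_distrib, mul_add, mul_sub]
    ring
  map_smul' c y := by
    simp [Finset.mul_sum, mul_add, mul_sub]
    simp [mul_left_comm]

lemma systemRhs_apply (τ : ℝ) (k k' : ℕ) (g : Fin (d + 1) → Poly d) (y : Tests d k k') :
    systemRhs T hσ hv hγσ τ k k' g y = moment (boundsContinuous_cell T) hv y.1.1 +
    ∑ j, moment (boundsContinuous_cell T) (hσ j) (y.2.1 j).1 +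
    (∑ i, ∑ j, normal T i j * moment (boundsContinuous_face T i) (hγσ i j) (y.2.2.1 i).1 -
      τ * stabForm T k k' (0, g) (0, fun i => (y.2.2.1 i).1)) +
    (∑ j, moment (boundsContinuous_cell T) (hσ j) (MvPolynomial.pderiv j y.2.2.2.1) +
      ∑ i, ∑ j, normal T i j * (facePair T i (proj (faceMeasure T i) k (γσ i j)) y.2.2.2.1 -
        moment (boundsContinuous_face T i) (hγσ i j) y.2.2.2.1)) := rfl

omit [NeZero d] in
lemma tests_cases {k k' : ℕ} {P : Tests d k k' → Prop} (hadd : ∀ y y', P y → P y' → P (y + y'))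
    (h1 : ∀ w, P (w, 0, 0, 0)) (h2 : ∀ ξ, P (0, ξ, 0, 0)) (h3 : ∀ μ, P (0, 0, μ, 0))
    (h4 : ∀ q, P (0, 0, 0, q)) (y : Tests d k k') : P y := by
  have := hadd _ _ (hadd _ _ (hadd _ _ (h1 y.1) (h2 y.2.1)) (h3 y.2.2.1)) (h4 y.2.2.2)
  simpa using this

lemma sum_normal_facePair (i : Fin (d + 1)) (s : Fin d → Poly d) (q : Poly d) :
    facePair T i (normalPart T s i) q = ∑ j, normal T i j * facePair T i (s j) q := by
  simp [normalPart]

include hσ in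
lemma integral_cell_vector (s ξ : Fin d → Poly d) :
    ∫ x, ∑ j, (ev (s j) x - σ j x) * ev (ξ j) x ∂(cellMeasure T) =
      ∑ j, (cellPair T (s j) (ξ j) - moment (boundsContinuous_cell T) (hσ j) (ξ j)) := by
  have hm := boundsContinuous_cell T
  simp_rw [← integral_sub_mul hm]
  exact integral_finsetSum _ fun j _ => hm.integrable_mul
    ((hm.integrable (continuous_ev (s j))).sub (hσ j)) (continuous_ev (ξ j))

include hγσ in
lemma integral_face_normal (i : Fin (d + 1)) (s : Fin d → Poly d) (q : Poly d) :
    ∫ x, (∑ j, (ev (s j) x - γσ i j x) * normal T i j) * ev q x ∂(faceMeasure T i) =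
      ∑ j, normal T i j *
        (facePair T i (s j) q - moment (boundsContinuous_face T i) (hγσ i j) q) := by
  have hm := boundsContinuous_face T i
  simp_rw [← integral_sub_mul hm, ← integral_const_mul, Finset.sum_mul]
  rw [integral_finsetSum]
  · refine Finset.sum_congr rfl fun j _ => ?_
    congr 1; ext x; ring
  · intro j _
    exact hm.integrable_mul (((hm.integrable (continuous_ev (s j))).sub (hγσ i j)).mul_const _)
      (continuous_ev q)

lemma gradientCondition_iff {k : ℕ} {p : (Fin d → Poly d) × Poly d} {q : Poly d} :
    GradientCondition T k σ γσ p q ↔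
      ∑ j, cellPair T (p.1 j) (MvPolynomial.pderiv j q) =
        ∑ j, moment (boundsContinuous_cell T) (hσ j) (MvPolynomial.pderiv j q) +
        ∑ i, ∑ j, normal T i j * (facePair T i (proj (faceMeasure T i) k (γσ i j)) q -
          moment (boundsContinuous_face T i) (hγσ i j) q) := by
  have h := integral_cell_vector T hσ p.1 (fun j => MvPolynomial.pderiv j q)
  rw [Finset.sum_sub_distrib] at h
  change (∫ x, ∑ j, (ev (p.1 j) x - σ j x) * ev (MvPolynomial.pderiv j q) x ∂(cellMeasure T)) = _ ↔ _
  rw [h]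
  simp_rw [fun i => integral_face_normal T hγσ i (fun j => proj (faceMeasure T i) k (γσ i j)) q]
  rw [sub_eq_iff_eq_add, add_comm]

lemma commonConditions_iff {l : ℝ} {k k' : ℕ} {p : (Fin d → Poly d) × Poly d} :
    CommonConditions T l k k' σ v γσ γv p ↔
      (∀ j, p.1 j ∈ polyDeg d k) ∧ p.2 ∈ polyDeg d k' ∧
      (∀ w ∈ polyDegPred d k, cellPair T p.2 w = moment (boundsContinuous_cell T) hv w) ∧
      (∀ ξ : Fin d → Poly d, (∀ j, ξ j ∈ polyDegPred d k) → ∑ j, cellPair T (p.1 j) (ξ j) =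
        ∑ j, moment (boundsContinuous_cell T) (hσ j) (ξ j)) ∧
      (∀ μ : Fin (d + 1) → Poly d, (∀ i, μ i ∈ polyDeg d k) →
        ∑ i, facePair T i (normalPart T p.1 i) (μ i) + tau T l * stabForm T k k' (p.2, 0) (0, μ) =
        ∑ i, ∑ j, normal T i j * moment (boundsContinuous_face T i) (hγσ i j) (μ i) -
          tau T l * stabForm T k k' (0, fun i => proj (faceMeasure T i) k (γv i)) (0, μ)) := by
  have h1 : ∀ w, ∫ x, (ev p.2 x - v x) * ev w x ∂(cellMeasure T) = 0 ↔
      cellPair T p.2 w = moment (boundsContinuous_cell T) hv w := fun w => by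
    rw [integral_sub_mul (boundsContinuous_cell T) _ hv, sub_eq_zero]
  have h2 : ∀ ξ : Fin d → Poly d,
      ∫ x, ∑ j, (ev (p.1 j) x - σ j x) * ev (ξ j) x ∂(cellMeasure T) = 0 ↔
      ∑ j, cellPair T (p.1 j) (ξ j) = ∑ j, moment (boundsContinuous_cell T) (hσ j) (ξ j) := fun ξ => by
    rw [integral_cell_vector T hσ, Finset.sum_sub_distrib, sub_eq_zero]
  have h3 : ∀ μ : Fin (d + 1) → Poly d,
      (∑ i, ∫ x, (∑ j, (γσ i j x - ev (p.1 j) x) * normal T i j) * ev (μ i) x ∂(faceMeasure T i) =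
      tau T l * ∑ i, ∫ x, ev (stab T k k' p.2 (fun i => proj (faceMeasure T i) k (γv i)) i) x *
        ev (stab T k k' 0 μ i) x ∂(faceMeasure T i)) ↔
      ∑ i, facePair T i (normalPart T p.1 i) (μ i) + tau T l * stabForm T k k' (p.2, 0) (0, μ) =
        ∑ i, ∑ j, normal T i j * moment (boundsContinuous_face T i) (hγσ i j) (μ i) -
          tau T l * stabForm T k k' (0, fun i => proj (faceMeasure T i) k (γv i)) (0, μ) := fun μ => by
    rw [sum_integral_stab]
    -- Splitting the argument of S moves the known face data to the right-hand side.
    have h4 : ((p.2, fun i => proj (faceMeasure T i) k (γv i)) : Poly d × (Fin (d + 1) → Poly d)) =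
        (p.2, 0) + (0, fun i => proj (faceMeasure T i) k (γv i)) := by ext <;> simp
    have h5 : ∀ i, ∫ x, (∑ j, (γσ i j x - ev (p.1 j) x) * normal T i j) * ev (μ i) x
        ∂(faceMeasure T i) = - ∑ j, normal T i j * (facePair T i (p.1 j) (μ i) -
          moment (boundsContinuous_face T i) (hγσ i j) (μ i)) := fun i => by
      rw [← integral_face_normal T hγσ i p.1 (μ i), ← integral_neg]
      congr 1; ext x
      rw [← neg_mul, ← Finset.sum_neg_distrib]
      congr 1
      exact Finset.sum_congr rfl fun j _ => by ring
    simp_rw [h5, sum_normal_facePair]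
    rw [h4, map_add, LinearMap.add_apply]
    simp only [mul_sub, Finset.sum_sub_distrib, Finset.sum_neg_distrib]
    constructor <;> intro h <;> linarith
  constructor
  · intro h
    exact ⟨h.mem_dual, h.mem_primal, fun w hw => (h1 w).1 (h.primal_moments w hw),
      fun ξ hξ => (h2 ξ).1 (h.dual_moments ξ hξ), fun μ hμ => (h3 μ).1 (h.normal_traces μ hμ)⟩
  · rintro ⟨ha, hb, hc, hd, he⟩
    exact ⟨ha, hb, fun w hw => (h1 w).2 (hc w hw), fun ξ hξ => (h2 ξ).2 (hd ξ hξ),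
      fun μ hμ => (h3 μ).2 (he μ hμ)⟩

/-- A single identity on the product of the test spaces is equivalent to the four families of
conditions, by linearity in the test tuple. -/
lemma conditions_iff {l : ℝ} {k k' : ℕ} (x : Unknowns d k k') :
    (CommonConditions T l k k' σ v γσ γv (fun j => (x.1 j).1, x.2.1) ∧
      ∀ q ∈ polyDeg d k', GradientCondition T k σ γσ (fun j => (x.1 j).1, x.2.1) q) ↔
    ∀ y, systemForm T (tau T l) k k' x y = systemRhs T hσ hv hγσ (tau T l) k k'
      (fun i => proj (faceMeasure T i) k (γv i)) y := by
  have h0 : ((0, fun _ => 0) : Poly d × (Fin (d + 1) → Poly d)) = 0 := rfl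
  rw [commonConditions_iff T hσ hv hγσ]
  simp_rw [gradientCondition_iff T hσ hγσ]
  constructor
  · rintro ⟨⟨-, -, hc, hd, he⟩, hf⟩
    refine tests_cases (fun y y' h h' => by rw [map_add, map_add, h, h']) ?_ ?_ ?_ ?_
    · intro w
      simpa [systemForm_apply, systemRhs_apply, h0] using hc w.1 w.2
    · intro ξ
      simpa [systemForm_apply, systemRhs_apply, h0] using hd (fun j => (ξ j).1) fun j => (ξ j).2
    · intro μ
      simpa [systemForm_apply, systemRhs_apply, h0] using he (fun j => (μ j).1) fun j => (μ j).2
    · intro q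
      simpa [systemForm_apply, systemRhs_apply, h0] using hf q.1 q.2
  · intro h
    refine ⟨⟨fun j => (x.1 j).2, x.2.2, fun w hw => ?_, fun ξ hξ => ?_, fun μ hμ => ?_⟩, fun q hq => ?_⟩
    · simpa [systemForm_apply, systemRhs_apply, h0] using h (⟨w, hw⟩, 0, 0, 0)
    · simpa [systemForm_apply, systemRhs_apply, h0] using h (0, fun j => ⟨ξ j, hξ j⟩, 0, 0)
    · simpa [systemForm_apply, systemRhs_apply, h0] using h (0, 0, fun j => ⟨μ j, hμ j⟩, 0)
    · simpa [systemForm_apply, systemRhs_apply, h0] using h (0, 0, 0, ⟨q, hq⟩)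

/-- On each face q is an admissible test for the projection onto ℙᵏ(F), so for such q the boundary
term of (d) disappears and (d) becomes an instance of (b). -/
lemma gradientCondition_boundary_eq_zero {k : ℕ} {q : Poly d} (hq : q ∈ polyDeg d k) :
    ∑ i, ∑ j, normal T i j * (facePair T i (proj (faceMeasure T i) k (γσ i j)) q -
      moment (boundsContinuous_face T i) (hγσ i j) q) = 0 := by
  refine Finset.sum_eq_zero fun i _ => Finset.sum_eq_zero fun j _ => ?_
  rw [pairing_apply, integral_proj_mul (boundsContinuous_face T i) (hγσ i j) hq, moment_apply,
    sub_self, mul_zero]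

lemma systemRhs_redundant (τ : ℝ) {k k' : ℕ} (hk : k ≤ k') (g : Fin (d + 1) → Poly d)
    (z : polyDeg d k × (Fin (d + 1) → polyDegPred d k)) :
    systemRhs T hσ hv hγσ τ k k' g (redundant T hk z) = 0 := by
  rw [systemRhs_apply]
  simp only [redundant, LinearMap.coe_mk, AddHom.coe_mk]
  rw [stabForm_eq_zero T k k' _ fun i => ae_lamPoly_mul T i _,
    gradientCondition_boundary_eq_zero T hγσ z.1.2,
    Finset.sum_eq_zero fun i _ => Finset.sum_eq_zero fun j _ => by
      rw [moment_eq_zero (boundsContinuous_face T i) (hγσ i j) (ae_lamPoly_mul T i _), mul_zero]]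
  simp

include hσ hv hγσ in
/-- Unique solvability of the unified system for integrable data. -/
theorem existsUnique_conditions {l : ℝ} (hl : 0 < tau T l) {k k' : ℕ} (hk : k' = k ∨ k' = k + 1) :
    ∃! p, CommonConditions T l k k' σ v γσ γv p ∧
      ∀ q ∈ polyDeg d k', GradientCondition T k σ γσ p q := by
  have hkk : k ≤ k' := by omega
  obtain ⟨x, hx⟩ := exists_of_injective_of_finrank (systemForm T (tau T l) k k')
    (systemRhs T hσ hv hγσ (tau T l) k k' (fun i => proj (faceMeasure T i) k (γv i)))
    (redundant T hkk) (systemForm_injective T hl hk) (redundant_injective T hkk)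
    (systemForm_redundant T _ hkk) (systemRhs_redundant T hσ hv hγσ _ hkk _) (finrank_tests k k')
  refine ⟨_, (conditions_iff T hσ hv hγσ x).2 hx, fun p hp => ?_⟩
  obtain ⟨x', rfl⟩ : ∃ x' : Unknowns d k k', p = (fun j => (x'.1 j).1, x'.2.1) :=
    ⟨(fun j => ⟨p.1 j, hp.1.mem_dual j⟩, ⟨p.2, hp.1.mem_primal⟩), rfl⟩
  have hx' := (conditions_iff T hσ hv hγσ x').1 hp
  have := systemForm_injective T hl hk (x' - x) fun y => by
    rw [map_sub, LinearMap.sub_apply, hx, hx', sub_self]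
  rw [sub_eq_zero.1 this]

include hσ hv hγσ in
/-- For test polynomials of degree at most `k` the gradient condition is redundant. -/
lemma CommonConditions.gradientCondition {l : ℝ} {k k' : ℕ} {p : (Fin d → Poly d) × Poly d}
    (h : CommonConditions T l k k' σ v γσ γv p) {q : Poly d} (hq : q ∈ polyDeg d k) :
    GradientCondition T k σ γσ p q := by
  rw [gradientCondition_iff T hσ hγσ, gradientCondition_boundary_eq_zero T hγσ hq, add_zero]
  exact ((commonConditions_iff T hσ hv hγσ).1 h).2.2.2.1 _ fun j => pderiv_mem hq j

include hσ hγσ in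
lemma GradientCondition.add {k : ℕ} {p : (Fin d → Poly d) × Poly d} {q r : Poly d}
    (hq : GradientCondition T k σ γσ p q) (hr : GradientCondition T k σ γσ p r) :
    GradientCondition T k σ γσ p (q + r) := by
  rw [gradientCondition_iff T hσ hγσ] at hq hr ⊢
  simp only [map_add, Finset.sum_add_distrib, hq, hr, mul_sub, mul_add, Finset.sum_sub_distrib]
  ring

end Data

lemma lam_points_nonneg (i j : Fin (d + 1)) : 0 ≤ lam T i (T.points j) := by
  rw [lam_points]; split_ifs <;> norm_num

lemma diam_cell_pos : 0 < Metric.diam (cell T) := by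
  have h0 := (mem_cell T).2 (fun i => lam_points_nonneg T i 0)
  have h1 := (mem_cell T).2 (fun i => lam_points_nonneg T i 1)
  have hne : T.points 0 ≠ T.points 1 := fun h => by
    have := T.independent.injective h
    rw [Fin.ext_iff] at this
    have hd := NeZero.pos d
    simp [Nat.mod_eq_of_lt (show 1 < d + 1 by omega)] at this
  exact (dist_pos.2 hne).trans_le (Metric.dist_le_diam_of_mem (isCompact_cell T).isBounded h0 h1)

lemma tau_pos {l : ℝ} (hl : 0 < l) : 0 < tau T l := div_pos hl (diam_cell_pos T)

end

section Fourier

variable {d : ℕ}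

/-! ### The trace estimate on hyperplanes -/

/-- The integrals of a function over the lines parallel to `n`. -/
abbrev lineIntegral (n : Space d) (g : Space d → ℂ) (ζ : Hyp n) : ℂ := ∫ t : ℝ, g (t • n + ζ)

lemma norm_smul_add_sq {n : Space d} (hn : ‖n‖ = 1) (t : ℝ) (ζ : Hyp n) :
    ‖t • n + (ζ : Space d)‖ ^ 2 = t ^ 2 + ‖ζ‖ ^ 2 := by
  have h0 : ⟪n, (ζ : Space d)⟫ = 0 :=
    (Submodule.mem_orthogonal _ _).1 ζ.2 n (Submodule.mem_span_singleton_self n)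
  rw [norm_add_sq_real, inner_smul_left, h0, norm_smul, hn]
  simp

/-- Quadratic decay suffices: (1 + t²)⁻¹ is an integrable majorant on every line parallel to n,
uniformly in the line. -/
lemma exists_decay (g : 𝓢(Space d, ℂ)) : ∃ C, ∀ x, ‖g x‖ ≤ C * (1 + ‖x‖ ^ 2)⁻¹ := by
  obtain ⟨C0, -, h0⟩ := g.decay 0 0
  obtain ⟨C2, -, h2⟩ := g.decay 2 0
  refine ⟨C0 + C2, fun x => ?_⟩
  have h0 := h0 x
  have h2 := h2 x
  simp only [pow_zero, one_mul, norm_iteratedFDeriv_zero] at h0 h2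
  rw [← div_eq_mul_inv, le_div_iff₀ (by positivity)]
  linarith

lemma continuous_lineIntegral {n : Space d} (hn : ‖n‖ = 1) {g : Space d → ℂ} (hg : Continuous g)
    {C : ℝ} (hC : ∀ x, ‖g x‖ ≤ C * (1 + ‖x‖ ^ 2)⁻¹) : Continuous (lineIntegral n g) := by
  have hC0 : 0 ≤ C := by simpa using (norm_nonneg _).trans (hC 0)
  refine continuous_of_dominated (bound := fun t => C * (1 + t ^ 2)⁻¹) ?_ ?_ ?_ ?_
  · intro ζ
    exact (hg.comp (by fun_prop)).aestronglyMeasurable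
  · intro ζ
    refine .of_forall fun t => (hC _).trans ?_
    rw [norm_smul_add_sq hn]
    gcongr
    nlinarith [sq_nonneg ‖ζ‖]
  · exact integrable_inv_one_add_sq.const_mul C
  · exact .of_forall fun t => hg.comp (by fun_prop)

lemma integrable_frame {n : Space d} (hn : ‖n‖ = 1) {g : Space d → ℂ} (hg : Integrable g) :
    Integrable (fun q : ℝ × Hyp n => g (q.1 • n + q.2)) ((volume : Measure ℝ).prod volume) := by
  have h := (measurePreserving_frame hn (0 : Space d)).integrable_comp_of_integrable hg
  refine h.congr (.of_forall fun q => ?_)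
  simp [frame]

lemma integral_frame {n : Space d} (hn : ‖n‖ = 1) {g : Space d → ℂ} (hg : Integrable g) :
    ∫ x, g x = ∫ ζ : Hyp n, ∫ t : ℝ, g (t • n + ζ) := by
  rw [← integral_prod_symm _ (integrable_frame hn hg)]
  have h := measurePreserving_frame hn (0 : Space d)
  rw [← h.map_eq, integral_map h.measurable.aemeasurable]
  · simp [frame]
  · rw [h.map_eq]; exact hg.aestronglyMeasurable

/-- The restriction of a Schwartz function to an affine hyperplane. -/
def restrictHyp (n a : Space d) (φ : 𝓢(Space d, ℂ)) : 𝓢(Hyp n, ℂ) :=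
  SchwartzMap.compCLMOfAntilipschitz ℂ (K := 1) (g := fun w : Hyp n => a + (w : Space d))
    ((Function.HasTemperateGrowth.const a).add (Hyp n).subtypeL.hasTemperateGrowth)
    (fun x y => by simp only [ENNReal.coe_one, one_mul, edist_add_left]; exact le_rfl) φ

lemma restrictHyp_apply (n a : Space d) (φ : 𝓢(Space d, ℂ)) (w : Hyp n) :
    restrictHyp n a φ w = φ (a + w) := rfl

/-- The Fourier transform of the translate of a Schwartz function by `-a`. -/
def modulated (a : Space d) (φ : 𝓢(Space d, ℂ)) (x : Space d) : ℂ :=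
  Complex.exp (2 * Real.pi * ⟪x, a⟫ * Complex.I) * 𝓕 φ x

lemma norm_modulated (a : Space d) (φ : 𝓢(Space d, ℂ)) (x : Space d) :
    ‖modulated a φ x‖ = ‖𝓕 φ x‖ := by
  rw [modulated, norm_mul]
  have := Complex.norm_exp_ofReal_mul_I (2 * Real.pi * ⟪x, a⟫)
  push_cast at this
  rw [this, one_mul]

lemma continuous_modulated (a : Space d) (φ : 𝓢(Space d, ℂ)) : Continuous (modulated a φ) := by
  unfold modulated
  have := (𝓕 φ).continuous
  fun_prop

lemma integrable_modulated (a : Space d) (φ : 𝓢(Space d, ℂ)) : Integrable (modulated a φ) :=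
  ((𝓕 φ).integrable (μ := volume)).mono (continuous_modulated a φ).aestronglyMeasurable
    (.of_forall fun x => (norm_modulated a φ x).le)

/-- The projection-slice theorem: restriction in space corresponds to integration over the normal
frequency, and the shift by a to a phase. -/
lemma fourier_restrictHyp {n : Space d} (hn : ‖n‖ = 1) (a : Space d) (φ : 𝓢(Space d, ℂ)) :
    ⇑(𝓕 (restrictHyp n a φ) : 𝓢(Hyp n, ℂ)) = lineIntegral n (modulated a φ) := by
  obtain ⟨C, hC⟩ := exists_decay (𝓕 φ)
  have hcont := continuous_lineIntegral hn (continuous_modulated a φ)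
    (fun x => (norm_modulated a φ x).trans_le (hC x))
  have hint : Integrable (lineIntegral n (modulated a φ)) :=
    (integrable_frame hn (integrable_modulated a φ)).integral_prod_right
  -- Since w is orthogonal to n, the phase does not see the normal frequency t, and Fubini isolates
  -- the line integral.
  have hinv : 𝓕⁻ (lineIntegral n (modulated a φ)) = restrictHyp n a φ := by
    funext w
    rw [restrictHyp_apply, Real.fourierInv_eq']
    have h1 : φ (a + w) = 𝓕⁻ (𝓕 φ) (a + (w : Space d)) := by
      rw [FourierTransform.fourierInv_fourier_eq]
    rw [h1, SchwartzMap.fourierInv_coe, Real.fourierInv_eq']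
    have h2 : ∀ x : Space d, Complex.exp (↑(2 * Real.pi * ⟪x, a + (w : Space d)⟫) * Complex.I) •
        𝓕 φ x = Complex.exp (↑(2 * Real.pi * ⟪x, (w : Space d)⟫) * Complex.I) *
          modulated a φ x := by
      intro x
      rw [modulated, ← mul_assoc, ← Complex.exp_add, smul_eq_mul, inner_add_right]
      congr 2
      push_cast; ring
    simp_rw [h2]
    rw [integral_frame hn]
    · refine integral_congr_ae (.of_forall fun ζ => ?_)
      dsimp only
      rw [lineIntegral, smul_eq_mul, ← integral_const_mul]
      refine integral_congr_ae (.of_forall fun t => ?_)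
      dsimp only
      have h0 : ⟪n, (w : Space d)⟫ = 0 :=
        (Submodule.mem_orthogonal _ _).1 w.2 n (Submodule.mem_span_singleton_self n)
      rw [inner_add_left, inner_smul_left, h0, mul_zero, zero_add]
      rfl
    · refine (integrable_modulated a φ).mono ?_ (.of_forall fun x => ?_)
      · have := continuous_modulated a φ
        exact Continuous.aestronglyMeasurable (by fun_prop)
      · rw [norm_mul, Complex.norm_exp_ofReal_mul_I, one_mul]
  have h3 : 𝓕 (lineIntegral n (modulated a φ)) = fun w => restrictHyp n a φ (-w) := by
    rw [← hinv]
    funext w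
    rw [Real.fourierInv_eq_fourier_neg, neg_neg]
  have hint' : Integrable (𝓕 (lineIntegral n (modulated a φ))) := by
    rw [h3]
    exact ((restrictHyp n a φ).integrable (μ := volume)).comp_neg
  rw [SchwartzMap.fourier_coe, ← hinv]
  exact hcont.fourier_fourierInv_eq hint hint'

lemma lintegral_restrictHyp {n : Space d} (hn : ‖n‖ = 1) (a : Space d) (φ : 𝓢(Space d, ℂ)) :
    ∫⁻ w : Hyp n, ‖φ (a + w)‖ₑ ^ 2 = ∫⁻ ζ : Hyp n, ‖lineIntegral n (modulated a φ) ζ‖ₑ ^ 2 := by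
  rw [← fourier_restrictHyp hn]
  have key : ∀ f : 𝓢(Hyp n, ℂ), ∫⁻ w, ‖f w‖ₑ ^ 2 = ENNReal.ofReal (∫ w, ‖f w‖ ^ 2) := by
    intro f
    rw [ofReal_integral_eq_lintegral_ofReal]
    · refine lintegral_congr fun w => ?_
      rw [← ofReal_norm, ENNReal.ofReal_pow (norm_nonneg _)]
    · exact (f.memLp 2 volume).integrable_norm_pow (by norm_num)
    · exact .of_forall fun w => by positivity
  rw [key, SchwartzMap.integral_norm_sq_fourier, ← key]
  rfl

/-- The constant of the trace estimate. -/
def traceConst (ν : ℝ) : ℝ≥0∞ := ∫⁻ t : ℝ, ENNReal.ofReal ((1 + t ^ 2) ^ (-ν))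

lemma traceConst_lt_top {ν : ℝ} (hν : 1 / 2 < ν) : traceConst ν < ∞ := by
  have h := integrable_rpow_neg_one_add_norm_sq (E := ℝ) (μ := volume) (r := 2 * ν)
    (by simp; linarith)
  refine (lintegral_mono fun t => ?_).trans_lt h.lintegral_lt_top
  rw [Real.norm_eq_abs, sq_abs]
  apply le_of_eq; congr 2; ring

lemma sq_lintegral_mul_le {α : Type*} [MeasurableSpace α] {μ : Measure α} {f g : α → ℝ≥0∞}
    (hf : AEMeasurable f μ) (hg : AEMeasurable g μ) :
    (∫⁻ x, f x * g x ∂μ) ^ 2 ≤ (∫⁻ x, f x ^ 2 ∂μ) * ∫⁻ x, g x ^ 2 ∂μ := by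
  have h := ENNReal.lintegral_mul_le_Lp_mul_Lq μ Real.HolderConjugate.two_two hf hg
  simp only [Pi.mul_apply, ENNReal.rpow_two] at h
  calc _ ≤ _ := pow_le_pow_left' h 2
    _ = _ := by
      rw [mul_pow, ← ENNReal.rpow_two, ← ENNReal.rpow_two, ← ENNReal.rpow_mul, ← ENNReal.rpow_mul]
      norm_num

/-- The trace estimate for Schwartz functions, uniform with respect to parallel hyperplanes. -/
lemma lintegral_hyp_le {n : Space d} (hn : ‖n‖ = 1) (a : Space d) {ν : ℝ} (hν : 0 ≤ ν)
    (φ : 𝓢(Space d, ℂ)) :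
    ∫⁻ w : Hyp n, ‖φ (a + w)‖ₑ ^ 2 ≤
      traceConst ν * ∫⁻ x, ENNReal.ofReal ((1 + ‖x‖ ^ 2) ^ ν) * ‖𝓕 φ x‖ₑ ^ 2 := by
  rw [lintegral_restrictHyp hn]
  have hm : Measurable fun x : Space d => ENNReal.ofReal ((1 + ‖x‖ ^ 2) ^ ν) * ‖𝓕 φ x‖ₑ ^ 2 := by
    have := (𝓕 φ).continuous.measurable
    fun_prop
  have hm2 : Measurable fun q : ℝ × Hyp n => ENNReal.ofReal ((1 + ‖q.1 • n + (q.2 : Space d)‖ ^ 2) ^ ν) *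
      ‖𝓕 φ (q.1 • n + (q.2 : Space d))‖ₑ ^ 2 := hm.comp (by fun_prop)
  rw [lintegral_frame hn 0 hm]
  simp only [zero_add]
  rw [lintegral_lintegral_swap hm2.aemeasurable]
  rw [← lintegral_const_mul _ hm2.lintegral_prod_left']
  refine lintegral_mono fun ζ => ?_
  -- The weights (1 + t²)^(±ν/2) prepare Cauchy-Schwarz; afterwards 1 + t² is bounded by 1 + ‖x‖²,
  -- where x = t n + ζ.
  have hb : ‖lineIntegral n (modulated a φ) ζ‖ₑ ≤
      ∫⁻ t : ℝ, ENNReal.ofReal ((1 + t ^ 2) ^ (-ν / 2)) *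
        (ENNReal.ofReal ((1 + t ^ 2) ^ (ν / 2)) * ‖𝓕 φ (t • n + ζ)‖ₑ) := by
    refine (enorm_integral_le_lintegral_enorm _).trans (lintegral_mono fun t => le_of_eq ?_)
    rw [← mul_assoc, ← ENNReal.ofReal_mul (by positivity), ← Real.rpow_add (by positivity)]
    simp only [← ofReal_norm, norm_modulated]
    rw [show -ν / 2 + ν / 2 = 0 by ring, Real.rpow_zero, ENNReal.ofReal_one, one_mul]
  have hmt : Measurable fun t : ℝ => ‖𝓕 φ (t • n + (ζ : Space d))‖ₑ :=
    (((𝓕 φ).continuous.comp (by fun_prop : Continuous fun t : ℝ => t • n + (ζ : Space d))).measurable).enorm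
  refine (pow_le_pow_left' hb 2).trans ((sq_lintegral_mul_le (by fun_prop) (by fun_prop)).trans ?_)
  have hsq : ∀ (s t : ℝ), ENNReal.ofReal ((1 + t ^ 2) ^ (s / 2)) ^ 2 =
      ENNReal.ofReal ((1 + t ^ 2) ^ s) := by
    intro s t
    rw [← ENNReal.ofReal_pow (by positivity), ← Real.rpow_mul_natCast (by positivity)]
    congr 2; push_cast; ring
  refine mul_le_mul' (le_of_eq (lintegral_congr fun t => hsq _ _)) (lintegral_mono fun t => ?_)
  simp only [mul_pow, hsq]
  rw [norm_smul_add_sq hn]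
  gcongr
  exact le_add_of_nonneg_right (sq_nonneg _)

end Fourier

section Bessel

variable {d : ℕ}

/-! ### Bessel potentials of Schwartz functions -/

/-- The space of square-integrable functions on `ℝᵈ`. -/
abbrev LTwo (d : ℕ) := Lp ℂ 2 (volume : Measure (Space d))

/-- The Bessel potential of a Schwartz function. -/
def bessel (s : ℝ) : 𝓢(Space d, ℂ) →L[ℂ] 𝓢(Space d, ℂ) :=
  SchwartzMap.fourierMultiplierCLM ℂ (fun x => (((1 + ‖x‖ ^ 2) ^ (s / 2) : ℝ) : ℂ))

lemma hasTemperateGrowth_symbol (s : ℝ) :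
    Function.HasTemperateGrowth
      (fun x : Space d => (((1 + ‖x‖ ^ 2) ^ (s / 2) : ℝ) : ℂ)) := by fun_prop

lemma besselPotential_coe (s : ℝ) (φ : 𝓢(Space d, ℂ)) :
    TemperedDistribution.besselPotential (Space d) ℂ s (φ : 𝓢'(Space d, ℂ)) =
      (bessel s φ : 𝓢'(Space d, ℂ)) :=
  TemperedDistribution.fourierMultiplierCLM_toTemperedDistributionCLM_eq
    (hasTemperateGrowth_symbol s) φ

lemma bessel_bessel_neg (s : ℝ) (φ : 𝓢(Space d, ℂ)) : bessel s (bessel (-s) φ) = φ := by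
  rw [bessel, bessel, SchwartzMap.fourierMultiplierCLM_fourierMultiplierCLM_apply
    (hasTemperateGrowth_symbol _) (hasTemperateGrowth_symbol _)]
  have h : ((fun x : Space d => (((1 + ‖x‖ ^ 2) ^ (s / 2) : ℝ) : ℂ)) *
      fun x => (((1 + ‖x‖ ^ 2) ^ (-s / 2) : ℝ) : ℂ)) = fun _ => 1 := by
    funext x
    rw [Pi.mul_apply, ← Complex.ofReal_mul, ← Real.rpow_add (by positivity)]
    rw [show s / 2 + -s / 2 = 0 by ring, Real.rpow_zero, Complex.ofReal_one]
  rw [h, SchwartzMap.fourierMultiplierCLM_const]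
  simp

lemma fourier_bessel (s : ℝ) (φ : 𝓢(Space d, ℂ)) (x : Space d) :
    𝓕 (bessel s φ) x = (((1 + ‖x‖ ^ 2) ^ (s / 2) : ℝ) : ℂ) * 𝓕 φ x := by
  rw [bessel, SchwartzMap.fourierMultiplierCLM_apply, FourierTransform.fourier_fourierInv_eq,
    SchwartzMap.smulLeftCLM_apply_apply (hasTemperateGrowth_symbol s), smul_eq_mul]

lemma eLpNorm_two_sq {α E : Type*} [MeasurableSpace α] [NormedAddCommGroup E] (μ : Measure α)
    (f : α → E) : eLpNorm f 2 μ ^ 2 = ∫⁻ x, ‖f x‖ₑ ^ 2 ∂μ := by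
  have h := eLpNorm_nnreal_pow_eq_lintegral (μ := μ) (f := f) (p := 2) (by norm_num)
  norm_num at h
  exact h

lemma enorm_toLp (φ : 𝓢(Space d, ℂ)) : ‖φ.toLp 2‖ₑ = eLpNorm φ 2 volume := by
  rw [Lp.enorm_def]
  exact eLpNorm_congr_ae (φ.coeFn_toLp 2)

/-- Plancherel identifies the right-hand side of the trace estimate with the squared H^s norm. -/
lemma enorm_bessel_sq (s : ℝ) (φ : 𝓢(Space d, ℂ)) :
    ‖(bessel s φ).toLp 2‖ₑ ^ 2 =
      ∫⁻ x, ENNReal.ofReal ((1 + ‖x‖ ^ 2) ^ s) * ‖𝓕 φ x‖ₑ ^ 2 := by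
  have h : ‖(bessel s φ).toLp 2‖ₑ = ‖(𝓕 (bessel s φ)).toLp 2‖ₑ := by
    rw [← ofReal_norm, ← ofReal_norm, SchwartzMap.norm_fourier_toL2_eq]
  rw [h, enorm_toLp, eLpNorm_two_sq]
  refine lintegral_congr fun x => ?_
  rw [fourier_bessel, enorm_mul, mul_pow]
  congr 1
  rw [← ofReal_norm, Complex.norm_real, Real.norm_of_nonneg (by positivity),
    ← ENNReal.ofReal_pow (by positivity), ← Real.rpow_mul_natCast (by positivity)]
  congr 2; push_cast; ring

/-! ### Convergence in Sobolev spaces -/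

lemma coe_injective {U W : LTwo d} (h : (U : 𝓢'(Space d, ℂ)) = (W : 𝓢'(Space d, ℂ))) : U = W :=
  LinearMap.ker_eq_bot.1 (Lp.ker_toTemperedDistributionCLM_eq_bot (E := Space d) (F := ℂ)
    (μ := volume) (p := 2)) h

lemma coe_sub (U W : LTwo d) : ((U - W : LTwo d) : 𝓢'(Space d, ℂ)) = (U : 𝓢'(Space d, ℂ)) - W :=
  (Lp.toTemperedDistributionCLM ℂ (volume : Measure (Space d)) 2).map_sub U W

/-- A function is bounded in `L²` by its Bessel potential of nonnegative order. -/
lemma norm_le_of_besselPotential {ν : ℝ} (hν : 0 ≤ ν) {U W : LTwo d}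
    (h : TemperedDistribution.besselPotential (Space d) ℂ ν (U : 𝓢'(Space d, ℂ)) = W) :
    ‖U‖ ≤ ‖W‖ := by
  have h1 : TemperedDistribution.besselPotential (Space d) ℂ (-ν) (W : 𝓢'(Space d, ℂ)) = U :=
    (TemperedDistribution.besselPotential_neg_apply_eq_iff _ _ _).2 h
  set g : Space d → ℂ := fun x => (((1 + ‖x‖ ^ 2) ^ (-ν / 2) : ℝ) : ℂ) with hg
  have hgt : g.HasTemperateGrowth := hasTemperateGrowth_symbol (-ν)
  have hb : ∀ x, ‖g x‖ ≤ 1 := fun x => by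
    rw [hg, Complex.norm_real, Real.norm_of_nonneg (by positivity)]
    exact Real.rpow_le_one_of_one_le_of_nonpos (by simp) (by linarith)
  have hmem : MemLp g ∞ volume :=
    memLp_top_of_bound hgt.1.continuous.aestronglyMeasurable 1 (.of_forall hb)
  -- On the Fourier side U is W times a symbol bounded by 1.
  have h2 : 𝓕 U = (hmem.toLp g • 𝓕 W : LTwo d) := by
    apply coe_injective
    rw [← Lp.fourier_toTemperedDistribution_eq, ← h1,
      TemperedDistribution.fourier_besselPotential_eq_smulLeftCLM_fourier_apply,
      Lp.toTemperedDistribution_smul_eq hgt, Lp.fourier_toTemperedDistribution_eq]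
  rw [← Lp.norm_fourier_eq U, h2, ← Lp.norm_fourier_eq W]
  refine (Lp.norm_smul_le _ _).trans ?_
  refine mul_le_of_le_one_left (norm_nonneg _) ?_
  rw [Lp.norm_toLp]
  refine ENNReal.toReal_le_of_le_ofReal zero_le_one ?_
  rw [eLpNorm_exponent_top]
  exact eLpNormEssSup_le_of_ae_bound (.of_forall hb)

/-- The remainder w n is the Bessel potential of V - φ n. Its differences measure φ m - φ n in H^ν,
for the slices, while its norm controls the L² error, for convergence on T. -/
lemma TendstoH.exists_remainder {ν : ℝ} (hν : 0 ≤ ν) {φ : ℕ → 𝓢(Space d, ℂ)} {V : LTwo d}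
    (h : TendstoH ν φ V) : ∃ w : ℕ → LTwo d, Tendsto w atTop (𝓝 0) ∧
      (∀ m n, (bessel ν (φ m - φ n)).toLp 2 = w n - w m) ∧
      ∀ n, ‖V - (φ n).toLp 2 volume‖ ≤ ‖w n‖ := by
  obtain ⟨w, hw, hw0⟩ := h
  refine ⟨w, hw0, fun m n => coe_injective ?_, fun n => norm_le_of_besselPotential hν ?_⟩
  · rw [coe_sub, ← hw, ← hw, ← map_sub, sub_sub_sub_cancel_left,
      Lp.toTemperedDistribution_toLp_eq, ← besselPotential_coe, map_sub, map_sub]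
  · rw [coe_sub, ← hw, Lp.toTemperedDistribution_toLp_eq]

/-- The Bessel potential of V is approximated in L² by Schwartz functions, and the potential of
order -ν brings these back. -/
lemma exists_tendstoH {ν : ℝ} {V : LTwo d}
    (hV : TemperedDistribution.MemSobolev ν 2 (V : 𝓢'(Space d, ℂ))) :
    ∃ φ, TendstoH ν φ V := by
  obtain ⟨w, hw⟩ := hV
  have hd : DenseRange (SchwartzMap.toLpCLM ℂ (E := Space d) ℂ 2 volume) :=
    SchwartzMap.denseRange_toLpCLM ENNReal.ofNat_ne_top
  obtain ⟨u, hu, hlim⟩ := mem_closure_iff_seq_limit.1 (hd w)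
  choose ψ hψ using hu
  refine ⟨fun n => bessel (-ν) (ψ n), fun n => w - (ψ n).toLp 2 volume, fun n => ?_, ?_⟩
  · rw [map_sub, hw, besselPotential_coe, bessel_bessel_neg, coe_sub,
      Lp.toTemperedDistribution_toLp_eq]
  · have h : Tendsto (fun n => w - u n) atTop (𝓝 (w - w)) := tendsto_const_nhds.sub hlim
    rw [sub_self] at h
    refine h.congr fun n => ?_
    rw [← hψ n, SchwartzMap.toLpCLM_apply]

end Bessel

section Slices

variable {d : ℕ} [NeZero d] (T : Affine.Simplex ℝ (Space d) d)

/-! ### Slices of a simplex parallel to a face -/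

/-- The trace estimate on the slices of the simplex parallel to a face. -/
lemma lintegral_slice_le {ν : ℝ} (hν : 0 ≤ ν) (i : Fin (d + 1)) {r : ℝ} (hr : 1 / 2 ≤ r)
    (φ : 𝓢(Space d, ℂ)) :
    ∫⁻ y, ‖φ (T.points i + r • (y - T.points i))‖ₑ ^ 2 ∂(faceMeasure T i) ≤
      2 ^ (d - 1) * traceConst ν * ‖(bessel ν φ).toLp 2‖ₑ ^ 2 := by
  have hr0 : 0 < r := by linarith
  have hc := φ.continuous
  set a := T.points i + r • (T.altitudeFoot i - T.points i) with ha
  set F : Hyp (normal T i) → ℝ≥0∞ := fun w => ‖φ (a + w)‖ₑ ^ 2 with hF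
  have hFm : Measurable F := by
    have : Measurable fun w : Hyp (normal T i) => φ (a + w) :=
      (hc.comp (by fun_prop)).measurable
    fun_prop
  have h1 : ∫⁻ y, ‖φ (T.points i + r • (y - T.points i))‖ₑ ^ 2 ∂(faceMeasure T i) ≤
      ∫⁻ w, F (r • w) := by
    rw [lintegral_face T i (by
      have : Measurable fun y => φ (T.points i + r • (y - T.points i)) :=
        (hc.comp (by fun_prop)).measurable
      exact this.enorm.pow_const 2)]
    refine lintegral_mono fun w => (Set.indicator_le_self _ _ _).trans (le_of_eq ?_)
    rw [hF]
    dsimp only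
    congr 3
    rw [ha, Submodule.coe_smul, add_assoc, ← smul_add]
    congr 2; abel
  have h2 := lintegral_eq_smul (volume : Measure (Hyp (normal T i))) hFm hr0
  rw [finrank_hyp (norm_normal T i)] at h2
  -- The restriction r ≥ 1/2 bounds the Jacobian of the dilation of the slice from below, uniformly
  -- in r.
  have h3 : (1 : ℝ≥0∞) ≤ 2 ^ (d - 1) * ENNReal.ofReal (r ^ (d - 1)) := by
    rw [← ENNReal.ofReal_ofNat 2, ← ENNReal.ofReal_pow (by norm_num),
      ← ENNReal.ofReal_mul (by positivity), ← mul_pow, ENNReal.one_le_ofReal]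
    exact one_le_pow₀ (by linarith)
  calc _ ≤ ∫⁻ w, F (r • w) := h1
    _ ≤ (2 ^ (d - 1) * ENNReal.ofReal (r ^ (d - 1))) * ∫⁻ w, F (r • w) :=
      le_mul_of_one_le_left' h3
    _ = 2 ^ (d - 1) * ∫⁻ w, F w := by rw [h2, mul_assoc]
    _ ≤ 2 ^ (d - 1) * (traceConst ν * ‖(bessel ν φ).toLp 2‖ₑ ^ 2) := by
      gcongr
      rw [enorm_bessel_sq]
      exact lintegral_hyp_le (norm_normal T i) a hν φ
    _ = _ := by rw [mul_assoc]

/-- The restriction of a function to a slice of the simplex parallel to a face. -/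
abbrev slice {E : Type*} (i : Fin (d + 1)) (r : ℝ) (u : Space d → E) (y : Space d) : E :=
  u (T.points i + r • (y - T.points i))

lemma eLpNorm_slice_le {ν : ℝ} (hν : 0 ≤ ν) (i : Fin (d + 1)) {r : ℝ} (hr : 1 / 2 ≤ r)
    (φ : 𝓢(Space d, ℂ)) :
    eLpNorm (slice T i r φ) 2 (faceMeasure T i) ≤
      (2 ^ (d - 1) * traceConst ν) ^ (1 / 2 : ℝ) * ‖(bessel ν φ).toLp 2‖ₑ := by
  have h := lintegral_slice_le T hν i hr φ
  rw [← eLpNorm_two_sq (faceMeasure T i) (slice T i r φ)] at h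
  have h' := ENNReal.rpow_le_rpow h (z := 1 / 2) (by norm_num)
  rw [ENNReal.mul_rpow_of_nonneg _ _ (by norm_num), ← ENNReal.rpow_two, ← ENNReal.rpow_two,
    ← ENNReal.rpow_mul, ← ENNReal.rpow_mul] at h'
  norm_num at h' ⊢
  exact h'

end Slices

section Traces

variable {d : ℕ} [NeZero d] (T : Affine.Simplex ℝ (Space d) d)

/-! ### Traces on the faces of a simplex -/

lemma memLp_face (i : Fin (d + 1)) {f : Space d → ℂ} (hf : Continuous f) :
    MemLp f 2 (faceMeasure T i) := by
  obtain ⟨C, hC⟩ := (isCompact_face T i).exists_bound_of_continuousOn hf.continuousOn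
  refine MemLp.of_bound hf.aestronglyMeasurable C ?_
  filter_upwards [ae_mem_face T i] with x hx using hC x hx

omit [NeZero d] in
lemma continuous_slice (i : Fin (d + 1)) (r : ℝ) {f : Space d → ℂ} (hf : Continuous f) :
    Continuous (slice T i r f) := hf.comp (by fun_prop)

/-- Slices of a continuous function converge to its restriction to the face. -/
lemma tendsto_eLpNorm_slice_sub (i : Fin (d + 1)) {f : Space d → ℂ} (hf : Continuous f) :
    Tendsto (fun r => eLpNorm (fun y => f y - slice T i r f y) 2 (faceMeasure T i)) (𝓝 1)
      (𝓝 0) := by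
  have hc : Continuous (Function.uncurry fun (r : ℝ) (y : Space d) =>
      ‖f y - slice T i r f y‖ ^ 2) := by
    unfold slice Function.uncurry
    have h1 : Continuous fun q : ℝ × Space d => f q.2 := hf.comp continuous_snd
    have h2 : Continuous fun q : ℝ × Space d => f (T.points i + q.1 • (q.2 - T.points i)) :=
      hf.comp (by fun_prop)
    exact (h1.sub h2).norm.pow 2
  have h := (continuous_parametric_integral_of_continuous (μ := faceMeasure T i) hc
    (isCompact_face T i)).tendsto 1
  have hr : (faceMeasure T i).restrict (face T i) = faceMeasure T i :=
    Measure.restrict_eq_self_of_ae_mem (ae_mem_face T i)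
  rw [hr] at h
  have h' := (ENNReal.continuous_rpow_const (y := 1 / 2)).tendsto _ |>.comp
    (ENNReal.tendsto_ofReal h)
  simp only [slice, one_smul, add_sub_cancel, sub_self, norm_zero, ne_eq, OfNat.ofNat_ne_zero,
    not_false_eq_true, zero_pow, integral_zero, ENNReal.ofReal_zero] at h'
  rw [ENNReal.zero_rpow_of_pos (by norm_num)] at h'
  refine h'.congr fun r => ?_
  have hm := memLp_face T i (hf.sub (continuous_slice T i r hf))
  have hi : Integrable (fun y => ‖f y - slice T i r f y‖ ^ 2) (faceMeasure T i) :=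
    hm.integrable_norm_pow (by norm_num)
  rw [Function.comp_apply, ofReal_integral_eq_lintegral_ofReal hi (.of_forall fun _ => by positivity)]
  have h2 := eLpNorm_two_sq (faceMeasure T i) (fun y => f y - slice T i r f y)
  have h3 : ∀ y, ENNReal.ofReal (‖f y - slice T i r f y‖ ^ 2) = ‖f y - slice T i r f y‖ₑ ^ 2 := by
    intro y
    rw [ENNReal.ofReal_pow (norm_nonneg _), ofReal_norm]
  simp_rw [h3]
  rw [← h2, ← ENNReal.rpow_two, ← ENNReal.rpow_mul]
  norm_num

lemma eLpNorm_cell_sq (i : Fin (d + 1)) {f : Space d → ℂ} (hf : Continuous f) :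
    eLpNorm f 2 (cellMeasure T) ^ 2 = ∫⁻ r in Set.Ioo (0 : ℝ) 1,
      ENNReal.ofReal (T.height i * r ^ (d - 1)) *
        eLpNorm (slice T i r f) 2 (faceMeasure T i) ^ 2 := by
  simp_rw [eLpNorm_two_sq]
  exact lintegral_cell T i (hf.measurable.enorm.pow_const 2)

/-- If the slices of continuous functions form uniformly Cauchy sequences in `L²` near a face, and
the functions tend to zero in `L²` of the simplex, then they tend to zero in `L²` of the face. -/
lemma tendsto_face_of_tendsto_cell (i : Fin (d + 1)) {u : ℕ → Space d → ℂ}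
    (hu : ∀ n, Continuous (u n))
    (hc : ∀ ε : ℝ≥0∞, 0 < ε → ∃ N, ∀ n ≥ N, ∀ r : ℝ, 1 / 2 ≤ r →
      eLpNorm (slice T i r (fun y => u n y - u N y)) 2 (faceMeasure T i) ≤ ε)
    (h0 : Tendsto (fun n => eLpNorm (u n) 2 (cellMeasure T)) atTop (𝓝 0)) :
    Tendsto (fun n => eLpNorm (u n) 2 (faceMeasure T i)) atTop (𝓝 0) := by
  rw [ENNReal.tendsto_atTop_zero]
  intro ε hε
  -- Four terms enter the triangle inequality: u n - u N on the face and on the slice, the variation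
  -- of u N between them, and u n on the slice.
  set δ : ℝ≥0∞ := ε / 4 with hδ
  have hδ0 : 0 < δ := ENNReal.div_pos hε.ne' (by norm_num)
  have h4 : δ + δ + (δ + δ) = ε := by
    have : δ + δ + (δ + δ) = 4 * δ := by ring
    rw [this, hδ, ENNReal.mul_div_cancel (by norm_num) (by norm_num)]
  obtain ⟨N, hN⟩ := hc δ hδ0
  have hev := (ENNReal.tendsto_nhds_zero.1 (tendsto_eLpNorm_slice_sub T i (hu N))) δ hδ0
  obtain ⟨η, hη, hball⟩ := Metric.eventually_nhds_iff.1 hev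
  set r₀ : ℝ := max (1 / 2) (1 - η / 2) with hr₀
  have hr₀2 : 1 / 2 ≤ r₀ := le_max_left _ _
  have hr₀1 : r₀ < 1 := max_lt (by norm_num) (by linarith)
  set c : ℝ≥0∞ := ENNReal.ofReal (T.height i * (1 / 2) ^ (d - 1)) with hcdef
  have hc0 : c ≠ 0 := by
    have := T.height_pos i
    exact (ENNReal.ofReal_pos.2 (by positivity)).ne'
  -- If the face norm of u n exceeded ε, all slices with r in (r₀, 1) would have norm at least δ,
  -- and the squared norm on T could not fall below this positive number.
  have hκ : 0 < c * δ ^ 2 * ENNReal.ofReal (1 - r₀) :=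
    ENNReal.mul_pos (mul_ne_zero hc0 (pow_ne_zero 2 hδ0.ne'))
      (ENNReal.ofReal_pos.2 (by linarith)).ne'
  have h0' : Tendsto (fun n => eLpNorm (u n) 2 (cellMeasure T) ^ 2) atTop (𝓝 0) := by
    have := (ENNReal.continuous_pow 2).tendsto 0 |>.comp h0
    rw [zero_pow (by norm_num)] at this
    exact this
  obtain ⟨M, hM⟩ := eventually_atTop.1 (h0'.eventually_lt_const hκ)
  refine ⟨max N M, fun n hn => ?_⟩
  by_contra! hlt
  refine (hM n (le_trans (le_max_right _ _) hn)).not_ge ?_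
  have hn' := hN n (le_trans (le_max_left _ _) hn)
  rw [eLpNorm_cell_sq T i (hu n)]
  have key : ∀ r ∈ Set.Ioo r₀ 1, δ ≤ eLpNorm (slice T i r (u n)) 2 (faceMeasure T i) := by
    intro r hr
    by_contra! hF
    have hr2 : 1 / 2 ≤ r := hr₀2.trans hr.1.le
    have hD := hball (y := r) (by
      have := (le_max_right (1 / 2) (1 - η / 2)).trans_lt hr.1
      rw [Real.dist_eq, abs_lt]; constructor <;> linarith [hr.2])
    have h1 := hn' 1 (by norm_num)
    have hr' := hn' r hr2
    have hA : AEStronglyMeasurable (slice T i 1 fun y => u n y - u N y) (faceMeasure T i) :=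
      (continuous_slice T i 1 ((hu n).sub (hu N))).aestronglyMeasurable
    have hB : AEStronglyMeasurable (fun y => u N y - slice T i r (u N) y) (faceMeasure T i) :=
      ((hu N).sub (continuous_slice T i r (hu N))).aestronglyMeasurable
    have hC : AEStronglyMeasurable (slice T i r fun y => u n y - u N y) (faceMeasure T i) :=
      (continuous_slice T i r ((hu n).sub (hu N))).aestronglyMeasurable
    have hE : AEStronglyMeasurable (slice T i r (u n)) (faceMeasure T i) :=
      (continuous_slice T i r (hu n)).aestronglyMeasurable
    have heq : u n = ((slice T i 1 fun y => u n y - u N y) +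
        fun y => u N y - slice T i r (u N) y) +
        (slice T i r (u n) - (slice T i r fun y => u n y - u N y)) := by
      funext y
      simp only [slice, Pi.add_apply, Pi.sub_apply, one_smul, add_sub_cancel]
      ring
    refine hlt.not_ge ?_
    rw [← h4, heq]
    refine (eLpNorm_add_le (hA.add hB) (hE.sub hC) (by norm_num)).trans (add_le_add ?_ ?_)
    · exact (eLpNorm_add_le hA hB (by norm_num)).trans (add_le_add h1 hD)
    · exact (eLpNorm_sub_le hE hC (by norm_num)).trans (add_le_add hF.le hr')
  calc c * δ ^ 2 * ENNReal.ofReal (1 - r₀) = ∫⁻ _ in Set.Ioo r₀ 1, c * δ ^ 2 := by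
        rw [setLIntegral_const, Real.volume_Ioo]
    _ ≤ ∫⁻ r in Set.Ioo r₀ 1, ENNReal.ofReal (T.height i * r ^ (d - 1)) *
        eLpNorm (slice T i r (u n)) 2 (faceMeasure T i) ^ 2 := by
      refine setLIntegral_mono' measurableSet_Ioo fun r hr => ?_
      have hh := T.height_pos i
      refine mul_le_mul' (ENNReal.ofReal_le_ofReal ?_) (pow_le_pow_left' (key r hr) 2)
      have := hr₀2.trans hr.1.le
      gcongr
    _ ≤ _ := lintegral_mono_set (Set.Ioo_subset_Ioo_left (by linarith))

/-- One index serves all slices with r ≥ 1/2, as the constant in the slice estimate does not depend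
on r. -/
lemma TendstoH.slice_cauchy {ν : ℝ} (hν : 1 / 2 < ν) (i : Fin (d + 1))
    {φ : ℕ → 𝓢(Space d, ℂ)} {V : LTwo d} (h : TendstoH ν φ V) {ε : ℝ≥0∞} (hε : 0 < ε) :
    ∃ N, ∀ n ≥ N, ∀ m ≥ N, ∀ r : ℝ, 1 / 2 ≤ r →
      eLpNorm (slice T i r (fun y => φ n y - φ m y)) 2 (faceMeasure T i) ≤ ε := by
  obtain ⟨w, hw0, hw, -⟩ := h.exists_remainder (by linarith)
  set K := (2 ^ (d - 1) * traceConst ν) ^ (1 / 2 : ℝ) with hK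
  have hKt : K ≠ ∞ := ENNReal.rpow_ne_top_of_nonneg (by norm_num)
    (ENNReal.mul_ne_top (by finiteness) (traceConst_lt_top hν).ne)
  have hlim : Tendsto (fun q : ℕ × ℕ => K * ‖w q.2 - w q.1‖ₑ) (atTop ×ˢ atTop) (𝓝 0) := by
    have h1 : Tendsto (fun q : ℕ × ℕ => w q.2 - w q.1) (atTop ×ˢ atTop) (𝓝 (0 - 0)) :=
      (hw0.comp tendsto_snd).sub (hw0.comp tendsto_fst)
    have h2 := ENNReal.Tendsto.const_mul h1.enorm (a := K) (Or.inr hKt)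
    simpa using h2
  rw [prod_atTop_atTop_eq] at hlim
  obtain ⟨N, hN⟩ := eventually_atTop.1 (ENNReal.tendsto_nhds_zero.1 hlim ε hε)
  refine ⟨max N.1 N.2, fun n hn m hm r hr => ?_⟩
  refine (eLpNorm_slice_le T (by linarith : 0 ≤ ν) i hr (φ n - φ m)).trans ?_
  rw [hw]
  exact hN (n, m) ⟨(le_max_left _ _).trans hn, (le_max_right _ _).trans hm⟩

omit [NeZero d] in
lemma TendstoH.tendsto_cell {ν : ℝ} (hν : 0 ≤ ν) {v : Space d → ℝ}
    {φ : ℕ → 𝓢(Space d, ℂ)} {V : LTwo d} (h : TendstoH ν φ V) (hV : IsExtension ν T v V) :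
    Tendsto (fun n => eLpNorm (fun x => φ n x - (v x : ℂ)) 2 (cellMeasure T)) atTop (𝓝 0) := by
  obtain ⟨w, hw0, -, hw⟩ := h.exists_remainder hν
  have hlim : Tendsto (fun n => ‖w n‖ₑ) atTop (𝓝 0) := by simpa using hw0.enorm
  refine tendsto_of_tendsto_of_tendsto_of_le_of_le tendsto_const_nhds hlim (fun _ => zero_le)
    fun n => ?_
  have h1 : ‖V - (φ n).toLp 2 volume‖ₑ ≤ ‖w n‖ₑ := by
    rw [← ofReal_norm, ← ofReal_norm]
    exact ENNReal.ofReal_le_ofReal (hw n)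
  refine le_trans ?_ h1
  have h2 : eLpNorm (fun x => φ n x - (v x : ℂ)) 2 (cellMeasure T) =
      eLpNorm (V - (φ n).toLp 2 volume : LTwo d) 2 (cellMeasure T) := by
    rw [← eLpNorm_neg]
    refine eLpNorm_congr_ae ?_
    filter_upwards [hV.2, ae_restrict_of_ae (Lp.coeFn_sub V ((φ n).toLp 2 volume)),
      ae_restrict_of_ae ((φ n).coeFn_toLp 2 volume)] with x hx1 hx2 hx3
    rw [hx2, Pi.sub_apply, hx1, hx3, Pi.neg_apply, neg_sub]
  rw [h2, Lp.enorm_def]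
  exact eLpNorm_mono_measure _ Measure.restrict_le_self

omit [NeZero d] in
lemma memLp_of_memH {ν : ℝ} {v : Space d → ℝ} (h : MemH ν T v) : MemLp v 2 (cellMeasure T) := by
  obtain ⟨V, -, hV⟩ := h
  refine ((Lp.memLp V).restrict (cell T)).re.ae_eq ?_
  filter_upwards [hV] with x hx
  simp [hx]

/-- Functions in `H^ν` with `ν > 1/2` have a trace. -/
theorem exists_isTrace {ν : ℝ} (hν : 1 / 2 < ν) (i : Fin (d + 1)) {v : Space d → ℝ}
    (h : MemH ν T v) : ∃ g, IsTrace ν T i v g := by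
  obtain ⟨V, hV⟩ := h
  obtain ⟨φ, hφ⟩ := exists_tendstoH hV.1
  have hmem : ∀ n, MemLp (φ n) 2 (faceMeasure T i) := fun n => memLp_face T i (φ n).continuous
  have hcau : CauchySeq fun n => (hmem n).toLp := by
    rw [EMetric.cauchySeq_iff]
    intro ε hε
    obtain ⟨ε', hε', hlt⟩ := exists_between hε
    obtain ⟨N, hN⟩ := hφ.slice_cauchy T hν i hε'
    refine ⟨N, fun m hm n hn => ?_⟩
    rw [Lp.edist_toLp_toLp]
    have := hN m hm n hn 1 (by norm_num)
    rw [show slice T i 1 (fun y => φ m y - φ n y) = ⇑(φ m) - ⇑(φ n) from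
      funext fun y => by simp [slice]] at this
    exact this.trans_lt hlt
  obtain ⟨G, hG⟩ := cauchySeq_tendsto_of_complete hcau
  have hG' : Tendsto (fun n => eLpNorm (fun x => φ n x - G x) 2 (faceMeasure T i)) atTop
      (𝓝 0) := by
    have := (Lp.tendsto_Lp_iff_tendsto_eLpNorm' _ _).1 hG
    refine this.congr fun n => eLpNorm_congr_ae ?_
    filter_upwards [(hmem n).coeFn_toLp] with x hx
    rw [Pi.sub_apply, hx]
  -- The approximants are complex while v is real. Their imaginary parts tend to zero on T, hence on
  -- the face, so the real part of the limit is a trace.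
  have him : Tendsto (fun n => eLpNorm (fun x => ((φ n x).im : ℂ)) 2 (faceMeasure T i)) atTop
      (𝓝 0) := by
    refine tendsto_face_of_tendsto_cell T i (fun n => ?_) (fun ε hε => ?_) ?_
    · exact Complex.continuous_ofReal.comp (Complex.continuous_im.comp (φ n).continuous)
    · obtain ⟨N, hN⟩ := hφ.slice_cauchy T hν i hε
      refine ⟨N, fun n hn r hr => (eLpNorm_mono fun y => ?_).trans (hN n hn N le_rfl r hr)⟩
      simp only [slice]
      rw [← Complex.ofReal_sub, ← Complex.sub_im, Complex.norm_real]
      exact Complex.abs_im_le_norm _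
    · refine tendsto_of_tendsto_of_tendsto_of_le_of_le tendsto_const_nhds
        (hφ.tendsto_cell T (by linarith) hV) (fun _ => zero_le)
        fun n => eLpNorm_mono fun x => ?_
      rw [Complex.norm_real]
      simpa using Complex.abs_im_le_norm (φ n x - (v x : ℂ))
  refine ⟨fun x => (G x).re, (Lp.memLp G).re, V, φ, hV, hφ, ?_⟩
  have hsum := hG'.add him
  rw [add_zero] at hsum
  refine tendsto_of_tendsto_of_tendsto_of_le_of_le tendsto_const_nhds hsum (fun _ => zero_le)
    fun n => ?_
  have hA : AEStronglyMeasurable (fun x => (((φ n x - G x).re : ℝ) : ℂ)) (faceMeasure T i) :=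
    Complex.continuous_ofReal.comp_aestronglyMeasurable
      (Complex.continuous_re.comp_aestronglyMeasurable
        ((φ n).continuous.aestronglyMeasurable.sub (Lp.aestronglyMeasurable G)))
  have hB : AEStronglyMeasurable (fun x => ((φ n x).im : ℂ) * Complex.I) (faceMeasure T i) :=
    ((Complex.continuous_ofReal.comp (Complex.continuous_im.comp (φ n).continuous)).mul
      continuous_const).aestronglyMeasurable
  have heq : (fun x => φ n x - ((G x).re : ℂ)) =
      (fun x => (((φ n x - G x).re : ℝ) : ℂ)) + fun x => ((φ n x).im : ℂ) * Complex.I := by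
    funext x
    rw [Pi.add_apply]
    apply Complex.ext <;> simp
  dsimp only
  rw [heq]
  refine (eLpNorm_add_le hA hB (by norm_num)).trans (add_le_add ?_ ?_) <;>
    refine eLpNorm_mono fun x => ?_
  · rw [Complex.norm_real]
    exact Complex.abs_re_le_norm _
  · simp

/-- Traces of functions in `H^ν` with `ν > 1/2` are unique. -/
theorem IsTrace.ae_eq {ν : ℝ} (hν : 1 / 2 < ν) {i : Fin (d + 1)} {v g g' : Space d → ℝ}
    (h : IsTrace ν T i v g) (h' : IsTrace ν T i v g') : g =ᵐ[faceMeasure T i] g' := by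
  obtain ⟨hg, V, φ, hV, hφ, hlim⟩ := h
  obtain ⟨hg', V', φ', hV', hφ', hlim'⟩ := h'
  have hgm : AEStronglyMeasurable (fun x => (g x : ℂ)) (faceMeasure T i) :=
    Complex.continuous_ofReal.comp_aestronglyMeasurable hg.1
  have hgm' : AEStronglyMeasurable (fun x => (g' x : ℂ)) (faceMeasure T i) :=
    Complex.continuous_ofReal.comp_aestronglyMeasurable hg'.1
  have hvm : AEStronglyMeasurable (fun x => (v x : ℂ)) (cellMeasure T) :=
    Complex.continuous_ofReal.comp_aestronglyMeasurable (memLp_of_memH T ⟨V, hV⟩).1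
  have hc : ∀ n, Continuous (φ n) := fun n => (φ n).continuous
  have hc' : ∀ n, Continuous (φ' n) := fun n => (φ' n).continuous
  -- The two sequences may approximate different extensions, which agree only on T; the slice
  -- argument needs no more than that.
  have hdiff : Tendsto (fun n => eLpNorm (fun x => φ n x - φ' n x) 2 (faceMeasure T i)) atTop
      (𝓝 0) := by
    refine tendsto_face_of_tendsto_cell T i (fun n => (hc n).sub (hc' n)) (fun ε hε => ?_) ?_
    · have hε2 : 0 < ε / 2 := ENNReal.half_pos hε.ne'
      obtain ⟨N, hN⟩ := hφ.slice_cauchy T hν i hε2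
      obtain ⟨N', hN'⟩ := hφ'.slice_cauchy T hν i hε2
      refine ⟨max N N', fun n hn r hr => ?_⟩
      have h1 := hN n ((le_max_left _ _).trans hn) _ (le_max_left N N') r hr
      have h2 := hN' n ((le_max_right _ _).trans hn) _ (le_max_right N N') r hr
      rw [← ENNReal.add_halves ε]
      refine le_trans ?_ (add_le_add h1 h2)
      refine le_trans (le_of_eq (congrArg (fun f => eLpNorm f 2 (faceMeasure T i)) ?_))
        (eLpNorm_sub_le
          (continuous_slice T i r ((hc n).sub (hc (max N N')))).aestronglyMeasurable
          (continuous_slice T i r ((hc' n).sub (hc' (max N N')))).aestronglyMeasurable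
          (by norm_num))
      funext y
      simp only [slice, Pi.sub_apply]
      ring
    · have h1 := (hφ.tendsto_cell T (by linarith) hV).add (hφ'.tendsto_cell T (by linarith) hV')
      rw [add_zero] at h1
      refine tendsto_of_tendsto_of_tendsto_of_le_of_le tendsto_const_nhds h1 (fun _ => zero_le)
        fun n => ?_
      refine le_trans (le_of_eq (congrArg (fun f => eLpNorm f 2 (cellMeasure T)) ?_))
        (eLpNorm_sub_le ((hc n).aestronglyMeasurable.sub hvm)
          ((hc' n).aestronglyMeasurable.sub hvm) (by norm_num))
      funext x
      simp
  have hzero : eLpNorm (fun x => (g x : ℂ) - g' x) 2 (faceMeasure T i) = 0 := by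
    have h1 := (hdiff.add hlim).add hlim'
    simp only [add_zero] at h1
    refine le_antisymm (ge_of_tendsto' h1 fun n => ?_) zero_le
    have hA := ((hc n).sub (hc' n)).aestronglyMeasurable (μ := faceMeasure T i)
    have hB := (hc n).aestronglyMeasurable.sub hgm
    have hC := (hc' n).aestronglyMeasurable.sub hgm'
    refine le_trans (le_of_eq (congrArg (fun f => eLpNorm f 2 (faceMeasure T i)) ?_))
      ((eLpNorm_add_le (hA.sub hB) hC (by norm_num)).trans
        (add_le_add (eLpNorm_sub_le hA hB (by norm_num)) le_rfl))
    funext x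
    simp only [Pi.add_apply, Pi.sub_apply]
    ring
  filter_upwards [(eLpNorm_eq_zero_iff (hgm.sub hgm') (by norm_num)).1 hzero] with x hx
  have : (g x : ℂ) - g' x = 0 := hx
  exact_mod_cast sub_eq_zero.1 this

end Traces

section Main

variable {d : ℕ} [NeZero d] (T : Affine.Simplex ℝ (Space d) d)

/-! ### The interpolation system and the choice of traces -/

variable {σ : Fin d → Space d → ℝ} {v : Space d → ℝ}
  {γσ γσ' : Fin (d + 1) → Fin d → Space d → ℝ} {γv γv' : Fin (d + 1) → Space d → ℝ}

lemma CommonConditions.congr {l : ℝ} {k k' : ℕ} {p : (Fin d → Poly d) × Poly d}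
    (hσ : ∀ i j, γσ i j =ᵐ[faceMeasure T i] γσ' i j) (hv : ∀ i, γv i =ᵐ[faceMeasure T i] γv' i)
    (h : CommonConditions T l k k' σ v γσ γv p) : CommonConditions T l k k' σ v γσ' γv' p := by
  refine ⟨h.1, h.2, h.3, h.4, fun μ hμ => ?_⟩
  have h5 := h.5 μ hμ
  simp_rw [proj_congr k (hv _)] at h5
  rw [← h5]
  refine Finset.sum_congr rfl fun i _ => integral_congr_ae ?_
  filter_upwards [ae_all_iff.2 (hσ i)] with x hx
  simp_rw [hx]

lemma GradientCondition.congr {k : ℕ} {p : (Fin d → Poly d) × Poly d} {q : Poly d}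
    (hσ : ∀ i j, γσ i j =ᵐ[faceMeasure T i] γσ' i j) (h : GradientCondition T k σ γσ p q) :
    GradientCondition T k σ γσ' p q := by
  rw [GradientCondition] at h ⊢
  rw [h]
  simp_rw [proj_congr k (hσ _ _)]
  refine Finset.sum_congr rfl fun i _ => integral_congr_ae ?_
  filter_upwards [ae_all_iff.2 (hσ i)] with x hx
  simp_rw [hx]

variable {νσ νv : ℝ} (hνσ : 1 / 2 < νσ) (hνv : 1 / 2 < νv)
  (hγσ : ∀ i j, IsTrace νσ T i (σ j) (γσ i j)) (hγv : ∀ i, IsTrace νv T i v (γv i))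

include hνσ hνv hγσ hγv

/-- Traces are unique almost everywhere and the conditions depend only on their classes, so the
traces quantified in the definition can be fixed in advance. -/
lemma isHInterp_iff {l : ℝ} {k k' : ℕ} {p : (Fin d → Poly d) × Poly d} :
    IsHInterp νσ νv T l k k' σ v p ↔ CommonConditions T l k k' σ v γσ γv p ∧
      ∀ q ∈ polyDeg d k', GradientCondition T k σ γσ p q := by
  refine ⟨?_, fun h => ⟨γσ, γv, hγσ, hγv, h⟩⟩
  rintro ⟨γσ', γv', hσ, hv, h1, h2⟩
  have e1 : ∀ i j, γσ' i j =ᵐ[faceMeasure T i] γσ i j := fun i j =>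
    (hσ i j).ae_eq T hνσ (hγσ i j)
  exact ⟨h1.congr T e1 fun i => (hv i).ae_eq T hνv (hγv i), fun q hq => (h2 q hq).congr T e1⟩

lemma isHInterpEO_iff {l : ℝ} {k : ℕ} {p : (Fin d → Poly d) × Poly d} :
    IsHInterpEO νσ νv T l k σ v p ↔ CommonConditions T l k k σ v γσ γv p := by
  refine ⟨?_, fun h => ⟨γσ, γv, hγσ, hγv, h⟩⟩
  rintro ⟨γσ', γv', hσ, hv, h1⟩
  exact h1.congr T (fun i j => (hσ i j).ae_eq T hνσ (hγσ i j))
    fun i => (hv i).ae_eq T hνv (hγv i)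

lemma isHInterpMO_iff {l : ℝ} {k : ℕ} {p : (Fin d → Poly d) × Poly d} :
    IsHInterpMO νσ νv T l k σ v p ↔ CommonConditions T l k (k + 1) σ v γσ γv p ∧
      ∀ q : Poly d, q.IsHomogeneous (k + 1) → GradientCondition T k σ γσ p q := by
  refine ⟨?_, fun h => ⟨γσ, γv, hγσ, hγv, h⟩⟩
  rintro ⟨γσ', γv', hσ, hv, h1, h2⟩
  have e1 : ∀ i j, γσ' i j =ᵐ[faceMeasure T i] γσ i j := fun i j =>
    (hσ i j).ae_eq T hνσ (hγσ i j)
  exact ⟨h1.congr T e1 fun i => (hv i).ae_eq T hνv (hγv i), fun q hq => (h2 q hq).congr T e1⟩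

end Main

end HInterp

end

theorem mainTheorem5 (d : ℕ) [NeZero d] (hd : d = 2 ∨ d = 3)
    (T : Affine.Simplex ℝ (HInterp.Space d) d) (l : ℝ) (hl : 0 < l) (k : ℕ)
    (νσ νv : ℝ) (hνσ : 1 / 2 < νσ) (hνv : 1 / 2 < νv)
    (σ : Fin d → HInterp.Space d → ℝ) (v : HInterp.Space d → ℝ)
    (hσ : ∀ j, HInterp.MemH νσ T (σ j)) (hv : HInterp.MemH νv T v) :
    -- the traces on the faces exist and are unique
    (∀ i j, (∃ g, HInterp.IsTrace νσ T i (σ j) g) ∧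
      ∀ g g', HInterp.IsTrace νσ T i (σ j) g → HInterp.IsTrace νσ T i (σ j) g' →
        g =ᵐ[HInterp.faceMeasure T i] g') ∧
    (∀ i, (∃ g, HInterp.IsTrace νv T i v g) ∧
      ∀ g g', HInterp.IsTrace νv T i v g → HInterp.IsTrace νv T i v g' →
        g =ᵐ[HInterp.faceMeasure T i] g') ∧
    -- the unified system has a unique solution in the equal- and mixed-order cases
    (∀ k', k' = k ∨ k' = k + 1 → ∃! p, HInterp.IsHInterp νσ νv T l k k' σ v p) ∧
    -- equal-order case: explicit system
    (∃! p, HInterp.IsHInterpEO νσ νv T l k σ v p) ∧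
    (∀ p, HInterp.IsHInterp νσ νv T l k k σ v p ↔ HInterp.IsHInterpEO νσ νv T l k σ v p) ∧
    -- mixed-order case: explicit system
    (∃! p, HInterp.IsHInterpMO νσ νv T l k σ v p) ∧
    (∀ p, HInterp.IsHInterp νσ νv T l k (k + 1) σ v p ↔
      HInterp.IsHInterpMO νσ νv T l k σ v p) := by
  open HInterp in
  have hexσ : ∀ i j, ∃ g, IsTrace νσ T i (σ j) g := fun i j => exists_isTrace T hνσ i (hσ j)
  have hexv : ∀ i, ∃ g, IsTrace νv T i v g := fun i => exists_isTrace T hνv i hv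
  choose γσ hγσ using hexσ
  choose γv hγv using hexv
  have iσ : ∀ j, Integrable (σ j) (cellMeasure T) := fun j =>
    (memLp_of_memH T (hσ j)).integrable (by norm_num)
  have iv : Integrable v (cellMeasure T) := (memLp_of_memH T hv).integrable (by norm_num)
  have iγ : ∀ i j, Integrable (γσ i j) (faceMeasure T i) := fun i j =>
    (hγσ i j).1.integrable (by norm_num)
  have hex : ∀ k', k' = k ∨ k' = k + 1 → ∃! p, IsHInterp νσ νv T l k k' σ v p := fun k' hk' => by
    simp_rw [isHInterp_iff T hνσ hνv hγσ hγv]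
    exact existsUnique_conditions T iσ iv iγ (tau_pos T hl) hk'
  have heo : ∀ p, IsHInterp νσ νv T l k k σ v p ↔ IsHInterpEO νσ νv T l k σ v p := fun p => by
    rw [isHInterp_iff T hνσ hνv hγσ hγv, isHInterpEO_iff T hνσ hνv hγσ hγv]
    exact ⟨And.left, fun h => ⟨h, fun q hq => h.gradientCondition T iσ iv iγ hq⟩⟩
  have hmo : ∀ p, IsHInterp νσ νv T l k (k + 1) σ v p ↔ IsHInterpMO νσ νv T l k σ v p :=
    fun p => by
    rw [isHInterp_iff T hνσ hνv hγσ hγv, isHInterpMO_iff T hνσ hνv hγσ hγv]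
    -- A test polynomial in ℙᵏ⁺¹ splits into its homogeneous part of degree k + 1 and a part in ℙᵏ,
    -- for which the gradient condition is automatic.
    refine and_congr_right fun h => ⟨fun hg q hq => hg q (mem_polyDeg.2 hq.totalDegree_le),
      fun hg q hq => ?_⟩
    obtain ⟨q₁, q₂, h₁, h₂, rfl⟩ := exists_homogeneous_add hq
    exact (hg q₁ h₁).add T iσ iγ (h.gradientCondition T iσ iv iγ h₂)
  exact ⟨fun i j => ⟨⟨_, hγσ i j⟩, fun g g' h h' => h.ae_eq T hνσ h'⟩,
    fun i => ⟨⟨_, hγv i⟩, fun g g' h h' => h.ae_eq T hνv h'⟩, hex,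
    (existsUnique_congr heo).1 (hex k (Or.inl rfl)), heo,
    (existsUnique_congr hmo).1 (hex (k + 1) (Or.inr rfl)), hmo⟩
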